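/- Let $q$ be an odd prime power. For $A\in GL_n(\mathbb F_q)$ let $$F(A)=\bigl|\{B\in GL_n(\mathbb F_q): B^T=B,\ ABA^T=B\}\bigr|,$$ the number of nondegenerate symmetric bilinear forms on $\mathbb F_q^n$ preserved by $A$. Let $\Phi$ be the set of monic irreducible polynomials $f\neq t$ in $\mathbb F_q[t]$, write $d_f=\deg f$, and let $f^*\in\Phi$ be the polynomial whose roots are the inverses of the roots of $f$. For a partition $\lambda=(\lambda_1\ge\dots\ge\lambda_\ell)$ put $|\lambda|=\sum_i\lambda_i$, $n_\lambda=\sum_i(i-1)\lambda_i$, and let $\ell_{odd}(\lambda)$ be the number of odd parts. For a finitely supported map $\boldsymbol\mu$ from $\Phi$ to partitions with $\sum_f d_f|\boldsymbol\mu(f)|=n$, let $c_{\boldsymbol\mu}$ be the conjugacy class of those $A\in GL_n(\mathbb F_q)$ for which $\mathbb F_q^n$, with $t$ acting as $A$, is isomorphic to $\bigoplus_{f\in\Phi}\bigoplus_i\mathbb F_q[t]/(f^{\boldsymbol\mu(f)_i})$ as an $\mathbb F_q[t]$-module. Call $\boldsymbol\mu$ symmetric if $\boldsymbol\mu(f)=\boldsymbol\mu(f^*)$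 for all $f\in\Phi$. The symmetric type of a symmetric $\boldsymbol\mu$ is the tuple $\eta=(\eta_+,\eta_-,\eta_s,\eta_p)$ with $\eta_\pm=\boldsymbol\mu(t\mp1)$ and, for every nonempty partition $\lambda$, $\eta_s(\lambda)$ (respectively $\eta_p(\lambda)$) the partition in which each $d\ge1$ occurs as often as there are $f\in\Phi$ with $f=f^*$, $d_f=2d$, $\boldsymbol\mu(f)=\lambda$ (respectively unordered pairs $\{f,f^*\}$ with $f\ne f^*$, $d_f=d$, $\boldsymbol\mu(f)=\lambda$). **Proposition.** If $\boldsymbol\mu$ is not symmetric, then $F$ vanishes on $c_{\boldsymbol\mu}$. For each symmetric type $\eta$ there is a polynomial $P_\eta\in\mathbb Z[x]$, depending only on $\eta$ (not on $q$ or $\boldsymbol\mu$), such that $F(A)=P_\eta(q)$ for every odd prime power $q$, every symmetric $\boldsymbol\mu$ over $\mathbb F_q$ of symmetric type $\eta$ and every $A\in c_{\boldsymbol\mu}$. If every even part of $\boldsymbol\mu(t-1)$ and of $\boldsymbol\mu(t+1)$ occurs with even multiplicity, then $P_\eta$ is monic of degree $$\tfrac12\sum_{f=t\pm1}\ell_{odd}(\boldsymbol\mu(f))+\sum_{f\in\operatorname{supp}\boldsymbol\mu}d_f\Bigl(n_{\boldsymbol\mu(f)}+\tfrac12|\boldsymbol\mu(f)|\Bigr);$$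 otherwise $P_\eta=0$. -/

import Mathlib

open Polynomial
open scoped DirectSum

/-- Integer partitions, as finite multisets of positive parts. The empty partition is `0`, and the
multiplicity of `d` in `lam` is `lam.count d`. -/
abbrev IntPartition : Type := Multiset ℕ+

namespace IntPartition

/-- The weight: the sum of the parts. -/
def weight (lam : IntPartition) : ℕ := (lam.map (fun d : ℕ+ => (d : ℕ))).sum

/-- The number of odd parts. -/
def lengthOdd (lam : IntPartition) : ℕ := lam.countP (fun d : ℕ+ => Odd (d : ℕ))

/-- The parts in weakly decreasing order. -/
def sortedParts (lam : IntPartition) : List ℕ+ := lam.sort (fun a b => b ≤ a)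

/-- `n_lam = ∑ (i - 1) lam_i` over the parts `lam_1 ≥ lam_2 ≥ ⋯`
(the index of the list starts at `0`). -/
def nStat (lam : IntPartition) : ℕ :=
  ∑ i : Fin lam.sortedParts.length, (i : ℕ) * (lam.sortedParts.get i : ℕ)

end IntPartition

/-- The set `Φ` of monic irreducible polynomials over `K` other than `t`, that is, with nonzero
roots. -/
def Phi (K : Type*) [Field K] : Type _ :=
  {f : K[X] // f.Monic ∧ Irreducible f ∧ f.coeff 0 ≠ 0}

namespace Phi

variable {K : Type*} [Field K]

/-- The degree `d_f`. -/
noncomputable def deg (f : Phi K) : ℕ := f.1.natDegree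

theorem reverse_reverse_of_coeff_zero {f : K[X]} (h : f.coeff 0 ≠ 0) :
    f.reverse.reverse = f := by
  have h0 : f.natTrailingDegree = 0 := natTrailingDegree_eq_zero.2 (Or.inr h)
  have h1 : f.reverse.natDegree = f.natDegree := by rw [reverse_natDegree, h0, Nat.sub_zero]
  ext k
  rw [coeff_reverse, coeff_reverse, h1, revAt_invol]

theorem irreducible_reverse {f : K[X]} (hf : Irreducible f) (h : f.coeff 0 ≠ 0) :
    Irreducible f.reverse := by
  have key : ∀ a : K[X], a.coeff 0 ≠ 0 → IsUnit a.reverse → IsUnit a := by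
    intro a ha hu
    have h0 : a.natTrailingDegree = 0 := natTrailingDegree_eq_zero.2 (Or.inr ha)
    have h1 : a.natDegree = 0 := by
      have := natDegree_eq_zero_of_isUnit hu
      rwa [reverse_natDegree, h0, Nat.sub_zero] at this
    rw [eq_C_of_natDegree_eq_zero h1]
    exact isUnit_C.2 (isUnit_iff_ne_zero.2 ha)
  refine ⟨fun hu => hf.not_isUnit (key f h hu), fun a b hab => ?_⟩
  have h2 : a.coeff 0 * b.coeff 0 ≠ 0 := by
    rw [← mul_coeff_zero, ← hab, coeff_zero_reverse]
    exact leadingCoeff_ne_zero.2 hf.ne_zero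
  have h3 : f = a.reverse * b.reverse := by
    rw [← reverse_mul_of_domain, ← hab, reverse_reverse_of_coeff_zero h]
  exact (hf.isUnit_or_isUnit h3).imp (key a (left_ne_zero_of_mul h2))
    (key b (right_ne_zero_of_mul h2))

/-- The dual `f* = f(0)⁻¹ t ^ {d_f} f(t⁻¹)`: the monic irreducible polynomial whose roots are the
inverses of the roots of `f`. -/
noncomputable def star (f : Phi K) : Phi K :=
  ⟨C (f.1.coeff 0)⁻¹ * f.1.reverse, by
    obtain ⟨f, hm, hi, h0⟩ := f
    have ht : f.natTrailingDegree = 0 := natTrailingDegree_eq_zero.2 (Or.inr h0)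
    refine ⟨?_, ?_, ?_⟩
    · rw [Monic, leadingCoeff_mul, leadingCoeff_C, reverse_leadingCoeff, trailingCoeff, ht]
      exact inv_mul_cancel₀ h0
    · exact (irreducible_isUnit_mul (isUnit_C.2 (isUnit_iff_ne_zero.2 (inv_ne_zero h0)))).2
        (irreducible_reverse hi h0)
    · rw [coeff_C_mul, coeff_zero_reverse]
      exact mul_ne_zero (inv_ne_zero h0) (leadingCoeff_ne_zero.2 hi.ne_zero)⟩

/-- The element `t - a` of `Φ`, for `a ≠ 0`. -/
noncomputable def linear (a : Kˣ) : Phi K :=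
  ⟨X - C (a : K), monic_X_sub_C _, irreducible_X_sub_C _, by simp⟩

end Phi

section ConjugacyClasses

variable {K : Type*} [Field K]

/-- The conjugacy class `c_μ` in `GL_n(K)` of a finitely supported map `μ : Φ → {partitions}`: the
matrices `A` such that `K ^ n`, with `t` acting as `A`, is isomorphic as a `K[t]`-module to the
direct sum of the `K[t] / (f ^ {lam_i})` over `f ∈ Φ` and the parts `lam_i` of `μ(f)`. -/
def conjClass (n : ℕ) (μ : Phi K →₀ IntPartition) : Set (GL (Fin n) K) :=
  {A | Nonempty (Module.AEval' (Matrix.toLin' (A : Matrix (Fin n) (Fin n) K)) ≃ₗ[K[X]]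
    ⨁ f : Phi K, ⨁ i : (μ f).ToType, (K[X] ⧸ Ideal.span {f.1 ^ (i.1 : ℕ)}))}

/-- `μ` is symmetric: `μ(f) = μ(f*)` for all `f ∈ Φ`. -/
def IsSymmetricMap (μ : Phi K →₀ IntPartition) : Prop := ∀ f, μ f = μ f.star

/-- Every even part of `μ(t - 1)` and of `μ(t + 1)` has even multiplicity. -/
def EvenPartsPaired (μ : Phi K →₀ IntPartition) : Prop :=
  ∀ d : ℕ+, Even (d : ℕ) →
    Even ((μ (Phi.linear 1)).count d) ∧ Even ((μ (Phi.linear (-1))).count d)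

/-- Symmetric types `(η_+, η_-, η_s, η_p)`. The partitions `η_s(lam) = (1 ^ {m_1} 2 ^ {m_2} ⋯)` and
`η_p(lam)`, for `lam` a nonempty partition, are recorded by their multiplicities `d ↦ m_d`. -/
@[ext]
structure SymType where
  plus : IntPartition
  minus : IntPartition
  selfDual : {lam : IntPartition // lam ≠ 0} → ℕ+ → ℕ
  pairs : {lam : IntPartition // lam ≠ 0} → ℕ+ → ℕ

/-- The symmetric type of `μ`: `η_± = μ(t ∓ 1)`, `m_d` of `η_s(lam)` is the number of self-dual `f`
of degree `2 d` with `μ(f) = lam`, and `m_d` of `η_p(lam)` is the number of unordered pairs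
`{f, f*}` with `f ≠ f*` of degree `d` and `μ(f) = lam`. -/
noncomputable def symType (μ : Phi K →₀ IntPartition) : SymType where
  plus := μ (Phi.linear 1)
  minus := μ (Phi.linear (-1))
  selfDual lam d := {f : Phi K | f.star = f ∧ f.deg = 2 * (d : ℕ) ∧ μ f = lam.1}.ncard
  pairs lam d := {P : Sym2 (Phi K) | ∃ f : Phi K,
    P = s(f, f.star) ∧ f.star ≠ f ∧ f.deg = (d : ℕ) ∧ μ f = lam.1}.ncard

/-- The number
`½ ∑_{f = t ± 1} ℓ_odd(μ(f)) + ∑_{f ∈ supp μ} d_f (n_{μ(f)} + ½ |μ(f)|)`. -/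
noncomputable def degFormula (μ : Phi K →₀ IntPartition) : ℚ :=
  1 / 2 * (((μ (Phi.linear 1)).lengthOdd : ℚ) + ((μ (Phi.linear (-1))).lengthOdd : ℚ)) +
    ∑ f ∈ μ.support, (f.deg : ℚ) * (((μ f).nStat : ℚ) + 1 / 2 * ((μ f).weight : ℚ))

/-- `F(A)`: the number of invertible symmetric matrices `B` with `A B Aᵀ = B`. -/
noncomputable def formCount {n : ℕ} (A : GL (Fin n) K) : ℕ :=
  Nat.card {B : GL (Fin n) K // (B : Matrix (Fin n) (Fin n) K).transpose = B ∧
    (A : Matrix (Fin n) (Fin n) K) * B * (A : Matrix (Fin n) (Fin n) K).transpose = B}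

end ConjugacyClasses

/-!
For a form preserved by `A`, the `f`-primary component is paired nondegenerately with the
`f*`-primary component and trivially with all others. So `F` vanishes unless `μ` is symmetric, and
otherwise it is a product over the orbits `{f, f*}` of the duality.

On `⨁ i, K[t] / (f ^ kᵢ)` an invariant pairing is a matrix of functionals, whose `(i, j)` entry is
a functional on `K[t] / (f ^ min kᵢ kⱼ)`. The restriction of this entry to the socle is represented
through the trace form by an element of the residue field of `f`. The pairing is nondegenerate if
and only if, for each size `a`, the matrix of these elements for `kᵢ = kⱼ = a` is invertible; all
other choices are free and contribute a power of the cardinality of the residue field.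

Symmetry of the form makes these matrices `ε`-hermitian with respect to the involution `t ↦ t⁻¹` of
the residue field. For `f = t ∓ 1` this involution is trivial and `ε = (-1) ^ (a - 1)`, for the
other `f = f*` it has order two, and for `f ≠ f*` there is no constraint. The numbers of invertible
`ε`-hermitian matrices satisfy a two-term recurrence, whose solutions are polynomials in `q`, and
`0` for alternating matrices of odd size.
-/

/-! ### Invertible `ε`-hermitian matrices -/

/-- The recurrence for the number of nondegenerate `ε`-hermitian forms on a space of dimension `m`,
where `s` is the number of `ε`-hermitian scalars and `Q` is the number of all scalars. The first
summand counts the Gram matrices with nonzero corner entry, the second one those where the corner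
entry is zero and the first row spans a hyperbolic plane. -/
def nondegSeq {A : Type*} [CommRing A] (s Q : A) : ℕ → A
  | 0 => 1
  | 1 => s - 1
  | m + 2 => (s - 1) * Q ^ (m + 1) * nondegSeq s Q (m + 1) +
      (Q ^ (m + 1) - 1) * (s * Q ^ m * nondegSeq s Q m)

theorem map_nondegSeq {A B : Type*} [CommRing A] [CommRing B] (φ : A →+* B) (s Q : A) (m : ℕ) :
    φ (nondegSeq s Q m) = nondegSeq (φ s) (φ Q) m := by
  induction m using nondegSeq.induct with
  | case1 => simp [nondegSeq]
  | case2 => simp [nondegSeq]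
  | case3 m ih_succ ih => simp [nondegSeq, ih_succ, ih]

section UnitBlocks

open Matrix

variable {F : Type*}

theorem card_matrix_unit [Finite F] (κ : Type*) [Fintype κ] :
    Nat.card (Matrix Unit κ F) = Nat.card F ^ Fintype.card κ := by
  rw [Matrix, Nat.card_fun, Nat.card_fun, Nat.card_unique (α := Unit), pow_one,
    Nat.card_eq_fintype_card (α := κ)]

theorem det_fromBlocks_unit [CommRing F] (a b c d : Matrix Unit Unit F) :
    (fromBlocks a b c d).det = a () () * d () () - b () () * c () () := by
  rw [← det_reindex_self (Equiv.boolEquivPUnitSumPUnit.symm.trans finTwoEquiv.symm), det_fin_two]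
  rfl

end UnitBlocks

section EpsHermitian

open Matrix

variable {F : Type*} [Field F] [StarRing F] {ε : F} {ι κ : Type*}

/-- `B` is the Gram matrix of an `ε`-hermitian form. -/
def IsEpsHermitian (ε : F) (B : Matrix ι ι F) : Prop := B = ε • Bᴴ

namespace IsEpsHermitian

theorem reindex_iff (e : ι ≃ κ) {B : Matrix ι ι F} :
    IsEpsHermitian ε (reindex e e B) ↔ IsEpsHermitian ε B := by
  rw [IsEpsHermitian, IsEpsHermitian, conjTranspose_reindex, ← (reindex e e).injective.eq_iff]
  rfl

theorem fromBlocks_iff (hε : ε * star ε = 1) {A : Matrix ι ι F} {b : Matrix ι κ F}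
    {c : Matrix κ ι F} {D : Matrix κ κ F} :
    IsEpsHermitian ε (fromBlocks A b c D) ↔
      IsEpsHermitian ε A ∧ c = ε • bᴴ ∧ IsEpsHermitian ε D := by
  rw [IsEpsHermitian, fromBlocks_conjTranspose, fromBlocks_smul, fromBlocks_inj]
  refine and_congr_right' ⟨fun h => h.2, fun h => ⟨?_, h⟩⟩
  rw [h.1, conjTranspose_smul, conjTranspose_conjTranspose, smul_smul, hε, one_smul]

theorem add {B C : Matrix ι ι F} (hB : IsEpsHermitian ε B) (hC : IsEpsHermitian ε C) :
    IsEpsHermitian ε (B + C) := by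
  rw [IsEpsHermitian, conjTranspose_add, smul_add]
  exact congrArg₂ (· + ·) hB hC

theorem sub {B C : Matrix ι ι F} (hB : IsEpsHermitian ε B) (hC : IsEpsHermitian ε C) :
    IsEpsHermitian ε (B - C) := by
  rw [IsEpsHermitian, conjTranspose_sub, smul_sub]
  exact congrArg₂ (· - ·) hB hC

theorem zero : IsEpsHermitian ε (0 : Matrix ι ι F) := by
  rw [IsEpsHermitian, conjTranspose_zero, smul_zero]

theorem conjTranspose_eq (hε : ε * star ε = 1) {B : Matrix ι ι F} (hB : IsEpsHermitian ε B) :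
    Bᴴ = star ε • B := by
  conv_rhs => rw [hB]
  rw [smul_smul, mul_comm, hε, one_smul]

theorem schur [Fintype ι] [DecidableEq ι] (hε : ε * star ε = 1) {A : Matrix ι ι F}
    (hA : IsEpsHermitian ε A) (hdet : IsUnit A.det) (b : Matrix ι κ F) :
    IsEpsHermitian ε ((ε • bᴴ) * A⁻¹ * b) := by
  have hinv : A⁻¹ᴴ = ε • A⁻¹ := by
    rw [conjTranspose_nonsing_inv, hA.conjTranspose_eq hε]
    exact inv_eq_left_inv (by rw [smul_mul_smul_comm, hε, nonsing_inv_mul _ hdet, one_smul])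
  rw [IsEpsHermitian, conjTranspose_mul, conjTranspose_mul, hinv, conjTranspose_smul,
    conjTranspose_conjTranspose]
  simp only [smul_mul, Matrix.mul_smul, smul_smul, Matrix.mul_assoc]
  rw [mul_comm (star ε), hε, mul_one]

end IsEpsHermitian

variable [Fintype κ] [DecidableEq κ]

variable (ε κ) in
/-- The number of invertible `ε`-hermitian matrices with rows and columns indexed by `κ`. -/
noncomputable def nondegCount : ℕ :=
  Nat.card {B : Matrix κ κ F // IsEpsHermitian ε B ∧ B.det ≠ 0}

theorem nondegCount_congr [Fintype ι] [DecidableEq ι] (e : ι ≃ κ) :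
    nondegCount ε ι = nondegCount ε κ :=
  Nat.card_congr ((reindex e e).subtypeEquiv fun B => by
    rw [IsEpsHermitian.reindex_iff, det_reindex_self])

theorem nondegCount_of_isEmpty [IsEmpty κ] : nondegCount ε κ = 1 := by
  rw [nondegCount, Nat.card_eq_one_iff_unique]
  exact ⟨inferInstance, ⟨⟨0, .zero, by simp⟩⟩⟩

/-- The `ε`-hermitian matrices whose upper left block is `x.1` and whose upper right block is `x.2`
are determined by their lower right blocks. -/
def epsHermitianEquivSigma (hε : ε * star ε = 1) (P : Matrix (ι ⊕ κ) (ι ⊕ κ) F → Prop) :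
    {B : Matrix (ι ⊕ κ) (ι ⊕ κ) F // IsEpsHermitian ε B ∧ P B} ≃
      Σ x : {A : Matrix ι ι F // IsEpsHermitian ε A} × Matrix ι κ F,
        {D : Matrix κ κ F // IsEpsHermitian ε D ∧
          P (fromBlocks x.1.1 x.2 (ε • x.2ᴴ) D)} where
  toFun B :=
    have h := (IsEpsHermitian.fromBlocks_iff hε).1 ((fromBlocks_toBlocks B.1).symm ▸ B.2.1)
    ⟨(⟨B.1.toBlocks₁₁, h.1⟩, B.1.toBlocks₁₂), B.1.toBlocks₂₂, h.2.2,
      (congrArg P ((congrArg₂ (fromBlocks _ _) h.2.1 rfl).symm.trans (fromBlocks_toBlocks B.1))).mpr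
        B.2.2⟩
  invFun x := ⟨fromBlocks x.1.1.1 x.1.2 (ε • x.1.2ᴴ) x.2.1,
    (IsEpsHermitian.fromBlocks_iff hε).2 ⟨x.1.1.2, rfl, x.2.2.1⟩, x.2.2.2⟩
  left_inv B := by
    have h := (IsEpsHermitian.fromBlocks_iff hε).1 ((fromBlocks_toBlocks B.1).symm ▸ B.2.1)
    ext1
    simp only [← h.2.1, fromBlocks_toBlocks]
  right_inv _ := rfl

/-- The number of invertible `ε`-hermitian matrices with given upper blocks. -/
noncomputable def completionCount [Fintype ι] [DecidableEq ι] (ε : F) (A : Matrix ι ι F)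
    (b : Matrix ι κ F) : ℕ :=
  Nat.card {D : Matrix κ κ F // IsEpsHermitian ε D ∧ (fromBlocks A b (ε • bᴴ) D).det ≠ 0}

theorem completionCount_of_det_ne_zero [Fintype ι] [DecidableEq ι] (hε : ε * star ε = 1)
    {A : Matrix ι ι F} (hA : IsEpsHermitian ε A) (hdet : A.det ≠ 0) (b : Matrix ι κ F) :
    completionCount ε A b = nondegCount ε κ := by
  have hX := hA.schur hε hdet.isUnit b
  refine Nat.card_congr ((Equiv.subRight ((ε • bᴴ) * A⁻¹ * b)).subtypeEquiv fun D => ?_)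
  let _ : Invertible A := invertibleOfIsUnitDet A hdet.isUnit
  rw [det_fromBlocks₁₁, invOf_eq_nonsing_inv, Equiv.subRight_apply]
  refine and_congr ⟨fun h => h.sub hX, fun h => ?_⟩ (by simp [hdet])
  simpa using h.add hX

theorem completionCount_zero_zero [Fintype ι] [DecidableEq ι] [Nonempty ι] :
    completionCount ε (0 : Matrix ι ι F) (0 : Matrix ι κ F) = 0 := by
  simp [completionCount]

theorem completionCount_reindex {κ' : Type*} [Fintype κ'] [DecidableEq κ'] [Fintype ι]
    [DecidableEq ι] (A : Matrix ι ι F) (b : Matrix ι κ F) (e : κ ≃ κ') :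
    completionCount ε A (reindex (Equiv.refl ι) e b) = completionCount ε A b := by
  refine (Nat.card_congr ((reindex e e).subtypeEquiv fun D => ?_)).symm
  have hblocks : fromBlocks A (reindex (Equiv.refl ι) e b) (ε • (reindex (Equiv.refl ι) e b)ᴴ)
      (reindex e e D) = reindex ((Equiv.refl ι).sumCongr e) ((Equiv.refl ι).sumCongr e)
        (fromBlocks A b (ε • bᴴ) D) := by
    ext (i | i) (j | j) <;> rfl
  rw [IsEpsHermitian.reindex_iff, hblocks, det_reindex_self]

theorem card_isEpsHermitian_unit :
    Nat.card {A : Matrix Unit Unit F // IsEpsHermitian ε A} =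
      Nat.card {a : F // a = ε * star a} :=
  Nat.card_congr (uniqueEquiv.subtypeEquiv fun _ =>
    ⟨fun h => congrFun₂ h () (), fun h => ext fun _ _ => h⟩)

/-- A zero corner and a nonzero entry of the first row span a hyperbolic plane, whose orthogonal
complement is arbitrary. -/
theorem completionCount_zero_of_inl_ne_zero [Finite F] (hε : ε * star ε = 1)
    {b : Matrix Unit (Unit ⊕ κ) F} (hb : b () (.inl ()) ≠ 0) :
    completionCount ε 0 b =
      Nat.card {a : F // a = ε * star a} * Nat.card F ^ Fintype.card κ * nondegCount ε κ := by
  have hfiber (x : {A : Matrix Unit Unit F // IsEpsHermitian ε A} × Matrix Unit κ F) :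
      Nat.card {D : Matrix κ κ F // IsEpsHermitian ε D ∧
        (fromBlocks 0 b (ε • bᴴ) (fromBlocks x.1.1 x.2 (ε • x.2ᴴ) D)).det ≠ 0} =
      nondegCount ε κ := by
    set plane : Matrix (Unit ⊕ Unit) (Unit ⊕ Unit) F :=
      fromBlocks 0 b.toCols₁ (ε • b.toCols₁ᴴ) x.1.1 with hplane
    have hA : IsEpsHermitian ε plane :=
      (IsEpsHermitian.fromBlocks_iff hε).2 ⟨.zero, rfl, x.1.2⟩
    have hdet : plane.det ≠ 0 := by
      rw [hplane, det_fromBlocks_unit]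
      simpa [left_ne_zero_of_mul_eq_one hε] using hb
    rw [← completionCount_of_det_ne_zero hε hA hdet (fromRows b.toCols₂ x.2)]
    refine Nat.card_congr (Equiv.subtypeEquivRight fun D => and_congr_right fun _ => ?_)
    rw [← det_reindex_self (Equiv.sumAssoc Unit Unit κ).symm]
    refine iff_of_eq (congrArg (fun M => det M ≠ 0) ?_)
    ext ((i | i) | i) ((j | j) | j) <;> rfl
  have := Fintype.ofFinite ({A : Matrix Unit Unit F // IsEpsHermitian ε A} × Matrix Unit κ F)
  rw [completionCount,
    Nat.card_congr (epsHermitianEquivSigma hε fun D => (fromBlocks 0 b (ε • bᴴ) D).det ≠ 0),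
    Nat.card_sigma, Finset.sum_congr rfl fun x _ => hfiber x, Finset.sum_const, Finset.card_univ,
    smul_eq_mul, ← Nat.card_eq_fintype_card, Nat.card_prod, card_isEpsHermitian_unit,
    card_matrix_unit]

theorem completionCount_zero_of_ne_zero [Finite F] (hε : ε * star ε = 1) {m : ℕ}
    {b : Matrix Unit (Fin (m + 1)) F} (hb : b ≠ 0) :
    completionCount ε 0 b =
      Nat.card {a : F // a = ε * star a} * Nat.card F ^ m * nondegCount ε (Fin m) := by
  obtain ⟨j, hj⟩ : ∃ j, b () j ≠ 0 := by
    by_contra! h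
    exact hb (ext fun _ j => h j)
  let e : Fin (m + 1) ≃ Unit ⊕ Fin m :=
    (finSuccEquiv' j).trans ((Equiv.optionEquivSumPUnit _).trans (Equiv.sumComm _ _))
  have he : e.symm (.inl ()) = j := by simp [e]
  rw [← completionCount_reindex 0 b e,
    completionCount_zero_of_inl_ne_zero hε (by simpa [he] using hj), Fintype.card_fin]

theorem nondegCount_unit_sum [Finite F] (hε : ε * star ε = 1) {N : ℕ}
    (hN : ∀ b : Matrix Unit κ F, b ≠ 0 → completionCount ε 0 b = N) :
    (nondegCount ε (Unit ⊕ κ) : ℤ) =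
      (Nat.card {a : F // a = ε * star a} - 1) * (Nat.card F : ℤ) ^ Fintype.card κ *
        nondegCount ε κ + ((Nat.card F : ℤ) ^ Fintype.card κ - 1) * N := by
  classical
  have := Fintype.ofFinite F
  let zeroCorner : {A : Matrix Unit Unit F // IsEpsHermitian ε A} := ⟨0, .zero⟩
  have hcorner : ∀ A ∈ Finset.univ.erase zeroCorner, ∑ b : Matrix Unit κ F,
      completionCount ε A.1 b = Nat.card F ^ Fintype.card κ * nondegCount ε κ := by
    intro A hA
    have hdet : A.1.det ≠ 0 := fun h => Finset.ne_of_mem_erase hA (Subtype.ext (by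
      rw [det_unique] at h
      exact ext fun _ _ => h))
    rw [Finset.sum_congr rfl fun b _ => completionCount_of_det_ne_zero hε A.2 hdet b,
      Finset.sum_const, Finset.card_univ, smul_eq_mul, ← Nat.card_eq_fintype_card,
      card_matrix_unit]
  have hzeroCorner : ∑ b : Matrix Unit κ F, completionCount ε zeroCorner.1 b =
      (Nat.card F ^ Fintype.card κ - 1) * N := by
    rw [← Finset.add_sum_erase _ _ (Finset.mem_univ 0), completionCount_zero_zero, zero_add,
      Finset.sum_congr rfl fun b hb => hN b (Finset.ne_of_mem_erase hb), Finset.sum_const,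
      Finset.card_erase_of_mem (Finset.mem_univ _), Finset.card_univ, smul_eq_mul,
      ← Nat.card_eq_fintype_card, card_matrix_unit]
  have hcount : nondegCount ε (Unit ⊕ κ) =
      (Nat.card F ^ Fintype.card κ - 1) * N + (Nat.card {a : F // a = ε * star a} - 1) *
        (Nat.card F ^ Fintype.card κ * nondegCount ε κ) := by
    rw [nondegCount, Nat.card_congr (epsHermitianEquivSigma hε fun D => D.det ≠ 0), Nat.card_sigma,
      Fintype.sum_prod_type, ← Finset.add_sum_erase _ _ (Finset.mem_univ zeroCorner)]
    refine congrArg₂ (· + ·) hzeroCorner ((Finset.sum_congr rfl hcorner).trans ?_)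
    rw [Finset.sum_const, Finset.card_erase_of_mem (Finset.mem_univ _), Finset.card_univ,
      smul_eq_mul, ← Nat.card_eq_fintype_card, card_isEpsHermitian_unit]
  have : Nonempty {a : F // a = ε * star a} := ⟨⟨0, by simp⟩⟩
  have hs : 1 ≤ Nat.card {a : F // a = ε * star a} := Nat.card_pos
  have hq : 1 ≤ Nat.card F ^ Fintype.card κ := Nat.one_le_pow _ _ Nat.card_pos
  rw [hcount]
  push_cast [Nat.cast_sub hs, Nat.cast_sub hq]
  ring

theorem nondegCount_eq_nondegSeq [Finite F] (hε : ε * star ε = 1) :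
    (nondegCount ε κ : ℤ) =
      nondegSeq (Nat.card {a : F // a = ε * star a} : ℤ) (Nat.card F : ℤ) (Fintype.card κ) := by
  rw [nondegCount_congr (Fintype.equivFin κ)]
  generalize Fintype.card κ = m
  have hsucc (m : ℕ) : nondegCount ε (Fin (m + 1)) = nondegCount ε (Unit ⊕ Fin m) :=
    nondegCount_congr (Fintype.equivOfCardEq (by simp [add_comm]))
  induction m using nondegSeq.induct with
  | case1 => rw [nondegSeq, nondegCount_of_isEmpty, Nat.cast_one]
  | case2 =>
    rw [hsucc, nondegCount_unit_sum (N := 0) hε fun b hb => (hb (ext fun _ j => j.elim0)).elim,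
      nondegCount_of_isEmpty]
    simp [nondegSeq]
  | case3 m ih_succ ih =>
    rw [hsucc, nondegCount_unit_sum hε fun b hb => completionCount_zero_of_ne_zero hε hb,
      nondegSeq, Fintype.card_fin, ih_succ, ← ih]
    push_cast
    ring

end EpsHermitian

/-! ### Functionals on a uniserial algebra -/

theorem natCard_mem_and_map {G H : Type*} [AddCommGroup G] [AddCommGroup H] (φ : G →+ H)
    (S : AddSubgroup G) (T : AddSubgroup H) (hST : ∀ g ∈ S, φ g ∈ T)
    (hsurj : ∀ h ∈ T, ∃ g ∈ S, φ g = h) (P : H → Prop) :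
    Nat.card {g // g ∈ S ∧ P (φ g)} =
      Nat.card {g // g ∈ S ∧ φ g = 0} * Nat.card {h // h ∈ T ∧ P h} := by
  choose! s hs hφs using hsurj
  rw [← Nat.card_prod]
  refine Nat.card_congr
    { toFun := fun g => (⟨g.1 - s (φ g.1), S.sub_mem g.2.1 (hs _ (hST _ g.2.1)), by
        rw [map_sub, hφs _ (hST _ g.2.1), sub_self]⟩, ⟨φ g.1, hST _ g.2.1, g.2.2⟩)
      invFun := fun x => ⟨x.1.1 + s x.2.1, S.add_mem x.1.2.1 (hs _ x.2.2.1), by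
        rw [map_add, x.1.2.2, hφs _ x.2.2.1, zero_add]
        exact x.2.2.2⟩
      left_inv := fun g => Subtype.ext (sub_add_cancel _ _)
      right_inv := ?_ }
  rintro ⟨⟨g, hg⟩, ⟨h, hh⟩⟩
  have hφ : φ (g + s h) = h := by rw [map_add, hg.2, hφs _ hh.1, zero_add]
  simp [hφ]

/-- A `K`-algebra `R` with a surjection `ρ` onto a field `F` whose kernel is generated by `π`, and
such that `π` can be cancelled in divisibilities by powers of `π` up to the `N`-th. -/
structure Uniformized (K R F : Type*) [Field K] [CommRing R] [Algebra K R] [Field F] [Algebra K F]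
    (N : ℕ) where
  ρ : R →ₐ[K] F
  π : R
  surj : Function.Surjective ρ
  ker : ∀ u, ρ u = 0 ↔ π ∣ u
  cancel : ∀ a b u, a + b ≤ N → π ^ (a + b) ∣ π ^ b * u → π ^ a ∣ u

namespace Uniformized

variable {K R F : Type*} [Field K] [CommRing R] [Algebra K R] [Field F] [Algebra K F] {N : ℕ}
  (D : Uniformized K R F N)

/-- The functionals that vanish on the ideal generated by `π ^ a`. -/
def ann (a : ℕ) : Submodule K (Module.Dual K R) where
  carrier := {ℓ | ∀ u, ℓ (D.π ^ a * u) = 0}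
  add_mem' h h' u := by rw [LinearMap.add_apply, h, h', add_zero]
  zero_mem' _ := rfl
  smul_mem' c ℓ h u := by rw [LinearMap.smul_apply, h, smul_zero]

theorem ann_mono {a b : ℕ} (h : a ≤ b) : D.ann a ≤ D.ann b := fun ℓ hℓ u => by
  obtain ⟨c, rfl⟩ := Nat.exists_eq_add_of_le h
  rw [pow_add, mul_assoc]
  exact hℓ _

theorem apply_eq_zero {a : ℕ} {ℓ : Module.Dual K R} (h : ℓ ∈ D.ann a) {u : R}
    (hu : D.π ^ a ∣ u) : ℓ u = 0 := by
  obtain ⟨v, rfl⟩ := hu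
  exact h v

theorem mem_ann_zero {ℓ : Module.Dual K R} : ℓ ∈ D.ann 0 ↔ ℓ = 0 := by
  refine ⟨fun h => LinearMap.ext fun u => by simpa using h u, ?_⟩
  rintro rfl
  exact Submodule.zero_mem _

variable [FiniteDimensional K F] [Algebra.IsSeparable K F]

/-- A `K`-linear section of the residue map. -/
noncomputable def lift : F →ₗ[K] R :=
  (LinearMap.exists_rightInverse_of_surjective D.ρ.toLinearMap
    (LinearMap.range_eq_top.2 D.surj)).choose

theorem ρ_lift (y : F) : D.ρ (D.lift y) = y :=
  LinearMap.congr_fun (LinearMap.exists_rightInverse_of_surjective D.ρ.toLinearMap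
    (LinearMap.range_eq_top.2 D.surj)).choose_spec y

/-- The element of `F` that represents a functional on `F = R / (π)` through the trace form. -/
noncomputable def coef : Module.Dual K R →ₗ[K] F :=
  (LinearMap.BilinForm.toDual (Algebra.traceForm K F)
    (traceForm_nondegenerate K F)).symm.toLinearMap ∘ₗ D.lift.dualMap

theorem trace_coef_mul (ψ : Module.Dual K R) (y : F) :
    Algebra.trace K F (D.coef ψ * y) = ψ (D.lift y) :=
  LinearMap.congr_fun ((LinearMap.BilinForm.toDual (Algebra.traceForm K F)
    (traceForm_nondegenerate K F)).apply_symm_apply (D.lift.dualMap ψ)) y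

/-- The leading coefficient of a functional that vanishes on the multiples of `π ^ (a + 1)`. -/
noncomputable def topCoef (a : ℕ) : Module.Dual K R →ₗ[K] F :=
  D.coef ∘ₗ (LinearMap.mulLeft K (D.π ^ a)).dualMap

theorem apply_eq_trace {a : ℕ} {ℓ : Module.Dual K R} (h : ℓ ∈ D.ann (a + 1)) (u : R) :
    ℓ (D.π ^ a * u) = Algebra.trace K F (D.topCoef a ℓ * D.ρ u) := by
  obtain ⟨v, hv⟩ : D.π ∣ u - D.lift (D.ρ u) := (D.ker _).1 (by rw [map_sub, ρ_lift, sub_self])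
  rw [topCoef, LinearMap.comp_apply, trace_coef_mul, LinearMap.dualMap_apply,
    LinearMap.mulLeft_apply, ← sub_eq_zero, ← map_sub, ← mul_sub, hv, ← mul_assoc, ← pow_succ]
  exact h v

theorem topCoef_eq {a : ℕ} {ℓ : Module.Dual K R} {c : F}
    (h : ∀ u, ℓ (D.π ^ a * u) = Algebra.trace K F (c * D.ρ u)) : D.topCoef a ℓ = c := by
  refine (LinearMap.BilinForm.toDual (Algebra.traceForm K F)
    (traceForm_nondegenerate K F)).injective (LinearMap.ext fun y => ?_)
  refine (D.trace_coef_mul _ y).trans ((h (D.lift y)).trans ?_)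
  rw [ρ_lift]
  rfl

theorem topCoef_eq_zero {a : ℕ} {ℓ : Module.Dual K R} (h : ℓ ∈ D.ann a) : D.topCoef a ℓ = 0 :=
  D.topCoef_eq fun u => by rw [h, zero_mul, map_zero]

theorem topCoef_eq_zero_iff {a : ℕ} {ℓ : Module.Dual K R} (h : ℓ ∈ D.ann (a + 1)) :
    D.topCoef a ℓ = 0 ↔ ℓ ∈ D.ann a := by
  refine ⟨fun h0 u => ?_, D.topCoef_eq_zero⟩
  rw [D.apply_eq_trace h, h0, zero_mul, map_zero]

omit [FiniteDimensional K F] [Algebra.IsSeparable K F] in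
theorem exists_mem_ann_apply_pi_pow {a : ℕ} (ha : a + 1 ≤ N) {ψ : Module.Dual K R}
    (hψ : ψ ∈ D.ann 1) : ∃ ℓ ∈ D.ann (a + 1), ∀ u, ℓ (D.π ^ a * u) = ψ u := by
  let mk : R →ₗ[K] R ⧸ Ideal.span {D.π ^ (a + 1)} := (Ideal.Quotient.mkₐ K _).toLinearMap
  have hmk : ∀ u, mk u = 0 ↔ D.π ^ (a + 1) ∣ u := fun u =>
    Ideal.Quotient.eq_zero_iff_dvd _ _
  have hker : ψ ∈ (mk ∘ₗ LinearMap.mulLeft K (D.π ^ a)).ker.dualAnnihilator := by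
    rw [Submodule.mem_dualAnnihilator]
    intro u hu
    rw [LinearMap.mem_ker, LinearMap.comp_apply, LinearMap.mulLeft_apply, hmk, add_comm] at hu
    exact D.apply_eq_zero hψ (D.cancel 1 a u (by omega) hu)
  rw [← LinearMap.range_dualMap_eq_dualAnnihilator_ker] at hker
  obtain ⟨χ, hχ⟩ := hker
  refine ⟨χ ∘ₗ mk, fun u => ?_, fun u => LinearMap.congr_fun hχ u⟩
  rw [LinearMap.comp_apply, (hmk _).2 (dvd_mul_right _ _), map_zero]

theorem exists_topCoef_eq {a : ℕ} (ha : a + 1 ≤ N) (c : F) :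
    ∃ ℓ ∈ D.ann (a + 1), D.topCoef a ℓ = c := by
  let ψ : Module.Dual K R := Algebra.trace K F ∘ₗ LinearMap.mulLeft K c ∘ₗ D.ρ.toLinearMap
  have hψ : ψ ∈ D.ann 1 := fun u => by
    change Algebra.trace K F (c * D.ρ (D.π ^ 1 * u)) = 0
    rw [pow_one, (D.ker _).2 (dvd_mul_right _ _), mul_zero, map_zero]
  obtain ⟨ℓ, hℓ, hℓψ⟩ := D.exists_mem_ann_apply_pi_pow ha hψ
  exact ⟨ℓ, hℓ, D.topCoef_eq hℓψ⟩

theorem card_ann {a : ℕ} (ha : a ≤ N) : Nat.card (D.ann a) = Nat.card F ^ a := by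
  induction a with
  | zero =>
    have hbot : D.ann 0 = ⊥ := (Submodule.eq_bot_iff _).2 fun _ => D.mem_ann_zero.1
    rw [hbot, pow_zero, Nat.card_unique]
  | succ a ih =>
    have hker (ℓ : Module.Dual K R) : ℓ ∈ D.ann (a + 1) ∧ D.topCoef a ℓ = 0 ↔ ℓ ∈ D.ann a :=
      ⟨fun h => (D.topCoef_eq_zero_iff h.1).1 h.2,
        fun h => ⟨D.ann_mono (Nat.le_succ a) h, D.topCoef_eq_zero h⟩⟩
    have h := natCard_mem_and_map (D.topCoef a).toAddMonoidHom (D.ann (a + 1)).toAddSubgroup ⊤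
      (fun _ _ => trivial) (fun c _ => D.exists_topCoef_eq ha c) (fun _ => True)
    simpa [hker, ih (Nat.le_of_succ_le ha), ← pow_succ] using h

variable {I : Type*}

/-- The families of functionals that vanish to the orders `a i j`. -/
def family (a : I → I → ℕ) : AddSubgroup (I → I → Module.Dual K R) where
  carrier := {ℓ | ∀ i j, ℓ i j ∈ D.ann (a i j)}
  add_mem' h h' i j := Submodule.add_mem _ (h i j) (h' i j)
  zero_mem' _ _ := Submodule.zero_mem _
  neg_mem' h i j := Submodule.neg_mem _ (h i j)

variable (k : I → ℕ)

/-- The exponents of the families of functionals that describe the pairings. -/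
def minExp (i j : I) : ℕ := min (k i) (k j)

/-- The exponents of the families with vanishing leading coefficients. -/
def subExp (i j : I) : ℕ := if k i = k j then k i - 1 else min (k i) (k j)

/-- The matrix of leading coefficients of a family of functionals. -/
noncomputable def coefMatrix (ℓ : I → I → Module.Dual K R) : Matrix I I F :=
  Matrix.of fun i j => D.topCoef (k i - 1) (ℓ i j)

variable {k}

theorem coefMatrix_blockTriangular {ℓ : I → I → Module.Dual K R}
    (hℓ : ℓ ∈ D.family (minExp k)) : (D.coefMatrix k ℓ).BlockTriangular k := by
  intro i j hij
  refine D.topCoef_eq_zero (D.ann_mono ?_ (hℓ i j))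
  rw [minExp, min_eq_right hij.le]
  omega

variable (k) in
/-- The diagonal blocks of the matrix of leading coefficients. -/
noncomputable def blocks [Fintype I] : (I → I → Module.Dual K R) →+
    ∀ a : Finset.univ.image k, Matrix {i // k i = a} {i // k i = a} F where
  toFun ℓ a := (D.coefMatrix k ℓ).toSquareBlock k a
  map_zero' := by
    ext a i _
    exact map_zero (D.topCoef (k i.1 - 1))
  map_add' ℓ ℓ' := by
    ext a i _
    exact map_add (D.topCoef (k i.1 - 1)) _ _

theorem det_coefMatrix_ne_zero [Fintype I] [DecidableEq I] {ℓ : I → I → Module.Dual K R}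
    (hℓ : ℓ ∈ D.family (minExp k)) :
    (D.coefMatrix k ℓ).det ≠ 0 ↔ ∀ a : Finset.univ.image k, (D.blocks k ℓ a).det ≠ 0 := by
  rw [(D.coefMatrix_blockTriangular hℓ).det, Finset.prod_ne_zero_iff]
  exact ⟨fun h a => h a.1 a.2, fun h a ha => h ⟨a, ha⟩⟩

theorem subExp_le_minExp (i j : I) : subExp k i j ≤ minExp k i j := by
  unfold subExp minExp
  split_ifs with h
  · rw [h, min_self]; omega
  · rfl

theorem minExp_of_eq (hk : ∀ i, 0 < k i) {i j : I} (h : k i = k j) :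
    minExp k i j = k i - 1 + 1 := by
  have := hk i
  rw [minExp, ← h, min_self]; omega

theorem minExp_comm (i j : I) : minExp k i j = minExp k j i := min_comm _ _

theorem subExp_of_eq {i j : I} (h : k i = k j) : subExp k i j = k i - 1 := if_pos h

theorem subExp_of_ne {i j : I} (h : k i ≠ k j) : subExp k i j = minExp k i j := if_neg h

theorem subExp_comm (i j : I) : subExp k i j = subExp k j i := by
  by_cases h : k i = k j
  · rw [subExp_of_eq h, subExp_of_eq h.symm, h]
  · rw [subExp_of_ne h, subExp_of_ne (Ne.symm h), minExp_comm]

theorem subExp_le (hN : ∀ i, k i ≤ N) (i j : I) : subExp k i j ≤ N :=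
  (subExp_le_minExp i j).trans ((min_le_left _ _).trans (hN i))

omit [FiniteDimensional K F] [Algebra.IsSeparable K F] in
theorem family_subExp_le : D.family (subExp k) ≤ D.family (minExp k) := fun _ hℓ i j =>
  D.ann_mono (subExp_le_minExp i j) (hℓ i j)

theorem blocks_eq_zero_iff [Fintype I] (hk : ∀ i, 0 < k i) {ℓ : I → I → Module.Dual K R}
    (hℓ : ℓ ∈ D.family (minExp k)) :
    D.blocks k ℓ = 0 ↔ ℓ ∈ D.family (subExp k) := by
  constructor
  · intro h i j
    by_cases hij : k i = k j
    · have htop : D.topCoef (k i - 1) (ℓ i j) = 0 := congrFun₂ (congrFun h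
        ⟨k i, Finset.mem_image_of_mem k (Finset.mem_univ i)⟩) ⟨i, rfl⟩ ⟨j, hij.symm⟩
      rw [subExp_of_eq hij]
      exact (D.topCoef_eq_zero_iff (minExp_of_eq hk hij ▸ hℓ i j)).1 htop
    · rw [subExp_of_ne hij]
      exact hℓ i j
  · intro h
    ext a i j
    exact D.topCoef_eq_zero (subExp_of_eq (i.2.trans j.2.symm) ▸ h i.1 j.1)

theorem exists_blocks_eq [Fintype I] (hk : ∀ i, 0 < k i) (hN : ∀ i, k i ≤ N)
    (B : ∀ a : Finset.univ.image k, Matrix {i // k i = a} {i // k i = a} F) :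
    ∃ ℓ ∈ D.family (minExp k), D.blocks k ℓ = B := by
  have h : ∀ i j, ∃ ℓ ∈ D.ann (minExp k i j), ∀ h : k j = k i, D.topCoef (k i - 1) ℓ =
      B ⟨k i, Finset.mem_image_of_mem k (Finset.mem_univ i)⟩ ⟨i, rfl⟩ ⟨j, h⟩ := by
    intro i j
    by_cases hij : k j = k i
    · obtain ⟨ℓ, hℓ, h⟩ := D.exists_topCoef_eq (a := k i - 1)
        (by have := hk i; have := hN i; omega)
        (B ⟨k i, Finset.mem_image_of_mem k (Finset.mem_univ i)⟩ ⟨i, rfl⟩ ⟨j, hij⟩)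
      refine ⟨ℓ, ?_, fun _ => h⟩
      rwa [minExp_of_eq hk hij.symm]
    · exact ⟨0, Submodule.zero_mem _, fun h => (hij h).elim⟩
  choose ℓ hℓ hB using h
  refine ⟨ℓ, hℓ, ?_⟩
  funext a
  ext ⟨i, hi⟩ ⟨j, hj⟩
  obtain ⟨a, ha⟩ := a
  change k i = a at hi
  subst hi
  exact hB i j hj

theorem mem_family_and_blocks_eq_zero [Fintype I] (hk : ∀ i, 0 < k i)
    (ℓ : I → I → Module.Dual K R) :
    ℓ ∈ D.family (minExp k) ∧ D.blocks k ℓ = 0 ↔ ℓ ∈ D.family (subExp k) :=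
  ⟨fun h => (D.blocks_eq_zero_iff hk h.1).1 h.2, fun h =>
    ⟨D.family_subExp_le h, (D.blocks_eq_zero_iff hk (D.family_subExp_le h)).2 h⟩⟩

omit [FiniteDimensional K F] [Algebra.IsSeparable K F] in
/-- A family of functionals, entry by entry. -/
def familyEquivPi (a : I → I → ℕ) : D.family a ≃ ∀ i j, D.ann (a i j) where
  toFun ℓ i j := ⟨ℓ.1 i j, ℓ.2 i j⟩
  invFun ℓ := ⟨fun i j => (ℓ i j).1, fun i j => (ℓ i j).2⟩
  left_inv _ := rfl
  right_inv _ := rfl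

theorem card_family [Fintype I] {a : I → I → ℕ} (ha : ∀ i j, a i j ≤ N) :
    Nat.card (D.family a) = Nat.card F ^ ∑ i, ∑ j, a i j := by
  rw [Nat.card_congr (D.familyEquivPi a), Nat.card_pi, ← Finset.prod_pow_eq_pow_sum]
  refine Finset.prod_congr rfl fun i _ => ?_
  rw [Nat.card_pi, ← Finset.prod_pow_eq_pow_sum]
  exact Finset.prod_congr rfl fun j _ => D.card_ann (ha i j)

theorem card_family_det_ne_zero [Fintype I] [DecidableEq I] (hk : ∀ i, 0 < k i)
    (hN : ∀ i, k i ≤ N) :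
    Nat.card {ℓ : I → I → Module.Dual K R // ℓ ∈ D.family (minExp k) ∧
      (D.coefMatrix k ℓ).det ≠ 0} =
    Nat.card F ^ (∑ i, ∑ j, subExp k i j) * ∏ a ∈ Finset.univ.image k,
      Nat.card {B : Matrix {i // k i = a} {i // k i = a} F // B.det ≠ 0} := by
  have hblocks := natCard_mem_and_map (D.blocks k) (D.family (minExp k)) ⊤ (fun _ _ => trivial)
    (fun B _ => D.exists_blocks_eq hk hN B) (fun B => ∀ a, (B a).det ≠ 0)
  have hdet (ℓ : I → I → Module.Dual K R) :
      ℓ ∈ D.family (minExp k) ∧ (D.coefMatrix k ℓ).det ≠ 0 ↔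
        ℓ ∈ D.family (minExp k) ∧ ∀ a, (D.blocks k ℓ a).det ≠ 0 :=
    and_congr_right D.det_coefMatrix_ne_zero
  rw [Nat.card_congr (Equiv.subtypeEquivRight hdet), hblocks,
    Nat.card_congr (Equiv.subtypeEquivRight (D.mem_family_and_blocks_eq_zero hk)),
    ← D.card_family (subExp_le hN), ← Finset.prod_coe_sort, ← Nat.card_pi]
  exact congrArg _ (Nat.card_congr ((Equiv.subtypeEquivRight fun B => and_iff_right trivial).trans
    (Equiv.subtypePiEquivPi (p := fun (a : Finset.univ.image k)
      (B : Matrix {i // k i = a.1} {i // k i = a.1} F) => B.det ≠ 0))))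

end Uniformized

/-! ### Symmetric families of functionals -/

/-- An involution `σ` of a uniformized algebra for which `π` is an eigenvector. -/
structure Uniformized.Involution {K R F : Type*} [Field K] [CommRing R] [Algebra K R] [Field F]
    [Algebra K F] {N : ℕ} (D : Uniformized K R F N) where
  σ : R →ₐ[K] R
  τ : F →ₐ[K] F
  δ : K
  invol : ∀ u, σ (σ u) = u
  compat : ∀ u, D.ρ (σ u) = τ (D.ρ u)
  map_pi : σ D.π = algebraMap K R δ * D.π
  sq : δ * δ = 1

namespace Uniformized.Involution

variable {K R F : Type*} [Field K] [CommRing R] [Algebra K R] [Field F] [Algebra K F] {N : ℕ}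
  {D : Uniformized K R F N} (S : D.Involution)

theorem invol_residue (c : F) : S.τ (S.τ c) = c := by
  obtain ⟨u, rfl⟩ := D.surj c
  rw [← S.compat, ← S.compat, S.invol]

/-- The sign `δ ^ a`, in `F`. -/
def sign (a : ℕ) : F := algebraMap K F (S.δ ^ a)

theorem sign_mul (a : ℕ) : S.sign a * S.τ (S.sign a) = 1 := by
  have h : S.δ ^ a * S.δ ^ a = 1 := by rw [← mul_pow, S.sq, one_pow]
  rw [sign, AlgHom.commutes, ← map_mul, h, map_one]

theorem map_pi_pow (a : ℕ) : S.σ (D.π ^ a) = algebraMap K R (S.δ ^ a) * D.π ^ a := by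
  rw [map_pow, S.map_pi, mul_pow, map_pow]

theorem pi_pow_dvd_map {a : ℕ} {u : R} (h : D.π ^ a ∣ u) : D.π ^ a ∣ S.σ u := by
  obtain ⟨v, rfl⟩ := h
  rw [map_mul, map_pi_pow, mul_assoc]
  exact (dvd_mul_right _ _).mul_left _

theorem pi_pow_dvd_map_iff {a : ℕ} {u : R} : D.π ^ a ∣ S.σ u ↔ D.π ^ a ∣ u :=
  ⟨fun h => S.invol u ▸ S.pi_pow_dvd_map h, S.pi_pow_dvd_map⟩

theorem comp_mem_ann {a : ℕ} {ℓ : Module.Dual K R} (h : ℓ ∈ D.ann a) :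
    ℓ ∘ₗ S.σ.toLinearMap ∈ D.ann a := fun _ =>
  D.apply_eq_zero h (S.pi_pow_dvd_map (dvd_mul_right _ _))

theorem trace_residue (c : F) : Algebra.trace K F (S.τ c) = Algebra.trace K F c :=
  Algebra.trace_eq_of_algEquiv (AlgEquiv.ofAlgHom S.τ S.τ (AlgHom.ext S.invol_residue)
    (AlgHom.ext S.invol_residue)) c

theorem comp_comp (ℓ : Module.Dual K R) :
    (ℓ ∘ₗ S.σ.toLinearMap) ∘ₗ S.σ.toLinearMap = ℓ :=
  LinearMap.ext fun u => congrArg ℓ (S.invol u)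

/-- The elements of `F` with `c = δ ^ a * τ c`. -/
def signFixed (a : ℕ) : AddSubgroup F where
  carrier := {c | c = S.sign a * S.τ c}
  add_mem' {c c'} h h' := by
    change c + c' = _
    rw [map_add, mul_add, ← h, ← h']
  zero_mem' := by simp
  neg_mem' {c} h := by
    change -c = _
    rw [map_neg, mul_neg, ← h]

/-- The residue field as a star ring, the star being the involution `τ`. -/
@[reducible]
def starRing : StarRing F where
  star := S.τ
  star_involutive := S.invol_residue
  star_mul c c' := (map_mul S.τ c c').trans (mul_comm _ _)
  star_add := map_add S.τ

/-- `B` is a `δ ^ a`-hermitian matrix. -/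
def IsSignHermitian (a : ℕ) {κ : Type*} (B : Matrix κ κ F) : Prop :=
  letI := S.starRing
  IsEpsHermitian (S.sign a) B

/-- The number of invertible `δ ^ a`-hermitian matrices with rows and columns indexed by `κ`. -/
noncomputable def signHermitianCount (a : ℕ) (κ : Type*) [Fintype κ] [DecidableEq κ] : ℕ :=
  Nat.card {B : Matrix κ κ F // S.IsSignHermitian a B ∧ B.det ≠ 0}

theorem isSignHermitian_iff {a : ℕ} {κ : Type*} {B : Matrix κ κ F} :
    S.IsSignHermitian a B ↔ ∀ i j, B i j = S.sign a * S.τ (B j i) :=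
  Matrix.ext_iff.symm

theorem signHermitianCount_eq_nondegSeq [Finite F] (a : ℕ) (κ : Type*) [Fintype κ]
    [DecidableEq κ] : (S.signHermitianCount a κ : ℤ) =
      nondegSeq (Nat.card (S.signFixed a) : ℤ) (Nat.card F) (Fintype.card κ) :=
  letI := S.starRing
  nondegCount_eq_nondegSeq (S.sign_mul a)

variable [FiniteDimensional K F] [Algebra.IsSeparable K F]

theorem topCoef_comp {a : ℕ} {ℓ : Module.Dual K R} (h : ℓ ∈ D.ann (a + 1)) :
    D.topCoef a (ℓ ∘ₗ S.σ.toLinearMap) = S.sign a * S.τ (D.topCoef a ℓ) := by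
  refine D.topCoef_eq fun u => ?_
  have hσ : (ℓ ∘ₗ S.σ.toLinearMap) (D.π ^ a * u) = S.δ ^ a • ℓ (D.π ^ a * S.σ u) := by
    rw [LinearMap.comp_apply, AlgHom.toLinearMap_apply, map_mul, map_pi_pow, mul_assoc,
      ← Algebra.smul_def, map_smul]
  rw [hσ, D.apply_eq_trace h, S.compat, ← S.trace_residue, map_mul, S.invol_residue, sign,
    ← Algebra.smul_def, smul_mul_assoc, map_smul]

/-- The functionals in `ann a` that are invariant under `σ`. -/
def fixedAnn (a : ℕ) : AddSubgroup (Module.Dual K R) where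
  carrier := {ℓ | ℓ ∈ D.ann a ∧ ℓ = ℓ ∘ₗ S.σ.toLinearMap}
  add_mem' h h' := ⟨Submodule.add_mem _ h.1 h'.1, by
    rw [LinearMap.add_comp, ← h.2, ← h'.2]⟩
  zero_mem' := ⟨Submodule.zero_mem _, by rw [LinearMap.zero_comp]⟩
  neg_mem' h := ⟨Submodule.neg_mem _ h.1, by rw [LinearMap.neg_comp, ← h.2]⟩

theorem half_add_self (h2 : (2 : K) ≠ 0) {V : Type*} [AddCommGroup V] [Module K V] (v : V) :
    (2 : K)⁻¹ • (v + v) = v := by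
  rw [← two_smul K v, smul_smul, inv_mul_cancel₀ h2, one_smul]

theorem exists_mem_fixedAnn_topCoef_eq (h2 : (2 : K) ≠ 0) {a : ℕ} (ha : a + 1 ≤ N) {c : F}
    (hc : c ∈ S.signFixed a) : ∃ ℓ ∈ S.fixedAnn (a + 1), D.topCoef a ℓ = c := by
  obtain ⟨ℓ, hℓ, rfl⟩ := D.exists_topCoef_eq ha c
  refine ⟨(2 : K)⁻¹ • (ℓ + ℓ ∘ₗ S.σ.toLinearMap), ⟨Submodule.smul_mem _ _
    (Submodule.add_mem _ hℓ (S.comp_mem_ann hℓ)), ?_⟩, ?_⟩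
  · rw [LinearMap.smul_comp, LinearMap.add_comp, comp_comp, add_comm]
  · rw [map_smul, map_add, S.topCoef_comp hℓ, ← hc, half_add_self h2]

theorem card_fixedAnn (h2 : (2 : K) ≠ 0) {a : ℕ} (ha : a ≤ N) :
    Nat.card (S.fixedAnn a) = ∏ b ∈ Finset.range a, Nat.card (S.signFixed b) := by
  induction a with
  | zero =>
    have hbot : S.fixedAnn 0 = ⊥ := (AddSubgroup.eq_bot_iff_forall _).2 fun _ h =>
      D.mem_ann_zero.1 h.1
    rw [hbot, Finset.prod_range_zero, Nat.card_unique]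
  | succ a ih =>
    have hker (ℓ : Module.Dual K R) :
        ℓ ∈ S.fixedAnn (a + 1) ∧ D.topCoef a ℓ = 0 ↔ ℓ ∈ S.fixedAnn a :=
      ⟨fun h => ⟨(D.topCoef_eq_zero_iff h.1.1).1 h.2, h.1.2⟩,
        fun h => ⟨⟨D.ann_mono (Nat.le_succ a) h.1, h.2⟩, D.topCoef_eq_zero h.1⟩⟩
    have h := natCard_mem_and_map (D.topCoef a).toAddMonoidHom (S.fixedAnn (a + 1))
      (S.signFixed a) (fun ℓ hℓ => (congrArg _ hℓ.2).trans (S.topCoef_comp hℓ.1))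
      (fun c hc => S.exists_mem_fixedAnn_topCoef_eq h2 ha hc) (fun _ => True)
    simpa [hker, ih (Nat.le_of_succ_le ha), Finset.prod_range_succ] using h

variable {I : Type*}

/-- The symmetric families of functionals that vanish to the orders `a i j`. -/
def symFamily (a : I → I → ℕ) : AddSubgroup (I → I → Module.Dual K R) where
  carrier := {ℓ | ℓ ∈ D.family a ∧ ∀ i j, ℓ j i = ℓ i j ∘ₗ S.σ.toLinearMap}
  add_mem' {ℓ ℓ'} h h' := ⟨AddSubgroup.add_mem _ h.1 h'.1, fun i j => by
    change ℓ j i + ℓ' j i = (ℓ i j + ℓ' i j) ∘ₗ _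
    rw [LinearMap.add_comp, ← h.2, ← h'.2]⟩
  zero_mem' := ⟨AddSubgroup.zero_mem _, fun i j => by
    change 0 = 0 ∘ₗ _
    rw [LinearMap.zero_comp]⟩
  neg_mem' {ℓ} h := ⟨AddSubgroup.neg_mem _ h.1, fun i j => by
    change -ℓ j i = (-ℓ i j) ∘ₗ _
    rw [LinearMap.neg_comp, ← h.2]⟩

section Triangle

variable [LinearOrder I] {a : I → I → ℕ}
  (x : (∀ p : Σ i : I, {j // j < i}, D.ann (a p.1 p.2)) × ∀ i, S.fixedAnn (a i i))

/-- The symmetric family with given entries on and below the diagonal. -/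
def symExtend (i j : I) : Module.Dual K R :=
  if h : j < i then (x.1 ⟨i, j, h⟩).1
  else if h : i < j then (x.1 ⟨j, i, h⟩).1 ∘ₗ S.σ.toLinearMap
  else (x.2 i).1

omit [FiniteDimensional K F] [Algebra.IsSeparable K F]

theorem symExtend_of_gt {i j : I} (h : j < i) : S.symExtend x i j = (x.1 ⟨i, j, h⟩).1 := dif_pos h

theorem symExtend_of_lt {i j : I} (h : i < j) :
    S.symExtend x i j = (x.1 ⟨j, i, h⟩).1 ∘ₗ S.σ.toLinearMap := by
  rw [symExtend, dif_neg h.not_gt, dif_pos h]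

theorem symExtend_self (i : I) : S.symExtend x i i = (x.2 i).1 := by
  rw [symExtend, dif_neg (lt_irrefl i), dif_neg (lt_irrefl i)]

theorem symExtend_mem (ha : ∀ i j, a i j = a j i) : S.symExtend x ∈ S.symFamily a := by
  refine ⟨fun i j => ?_, fun i j => ?_⟩
  · rcases lt_trichotomy i j with h | rfl | h
    · rw [symExtend_of_lt _ _ h, ha]
      exact S.comp_mem_ann (x.1 ⟨j, i, h⟩).2
    · rw [symExtend_self]
      exact (x.2 i).2.1
    · rw [symExtend_of_gt _ _ h]
      exact (x.1 ⟨i, j, h⟩).2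
  · rcases lt_trichotomy i j with h | rfl | h
    · rw [symExtend_of_lt _ _ h, symExtend_of_gt _ _ h, comp_comp]
    · rw [symExtend_self]
      exact (x.2 i).2.2
    · rw [symExtend_of_lt _ _ h, symExtend_of_gt _ _ h]

/-- A symmetric family is determined by its entries on and below the diagonal. -/
def symFamilyEquiv (ha : ∀ i j, a i j = a j i) : S.symFamily a ≃
    (∀ p : Σ i : I, {j // j < i}, D.ann (a p.1 p.2)) × ∀ i, S.fixedAnn (a i i) where
  toFun ℓ := (fun p => ⟨ℓ.1 p.1 p.2, ℓ.2.1 _ _⟩, fun i => ⟨ℓ.1 i i, ℓ.2.1 i i, ℓ.2.2 i i⟩)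
  invFun x := ⟨S.symExtend x, S.symExtend_mem x ha⟩
  left_inv ℓ := by
    ext1
    funext i j
    rcases lt_trichotomy i j with h | rfl | h
    · exact (S.symExtend_of_lt _ h).trans (ℓ.2.2 j i).symm
    · exact S.symExtend_self _ i
    · exact S.symExtend_of_gt _ h
  right_inv x := Prod.ext (funext fun p => Subtype.ext (S.symExtend_of_gt x p.2.2))
    (funext fun i => Subtype.ext (S.symExtend_self x i))

end Triangle

theorem card_symFamily [Fintype I] [LinearOrder I] (h2 : (2 : K) ≠ 0) {a : I → I → ℕ}
    (ha : ∀ i j, a i j = a j i) (hN : ∀ i j, a i j ≤ N) :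
    Nat.card (S.symFamily a) = Nat.card F ^ (∑ i, ∑ j with j < i, a i j) *
      ∏ i, ∏ b ∈ Finset.range (a i i), Nat.card (S.signFixed b) := by
  rw [Nat.card_congr (S.symFamilyEquiv ha), Nat.card_prod, Nat.card_pi, Nat.card_pi,
    Fintype.prod_sigma, ← Finset.prod_pow_eq_pow_sum]
  refine congrArg₂ _ (Finset.prod_congr rfl fun i _ => ?_)
    (Finset.prod_congr rfl fun i _ => S.card_fixedAnn h2 (hN i i))
  rw [← Finset.prod_pow_eq_pow_sum, Finset.prod_subtype _ (p := fun j => j < i) (by simp)]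
  exact Finset.prod_congr rfl fun j _ => D.card_ann (hN _ _)

variable {k : I → ℕ}

variable (k) in
/-- The families of `δ ^ (a - 1)`-hermitian blocks. -/
def hermitianBlocks [Fintype I] :
    AddSubgroup (∀ a : Finset.univ.image k, Matrix {i // k i = a} {i // k i = a} F) where
  carrier := {B | ∀ a : Finset.univ.image k, S.IsSignHermitian (a - 1) (B a)}
  add_mem' h h' a :=
    letI := S.starRing
    IsEpsHermitian.add (h a) (h' a)
  zero_mem' a :=
    letI := S.starRing
    IsEpsHermitian.zero
  neg_mem' {B} h a := by
    let := S.starRing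
    have hneg := IsEpsHermitian.zero.sub (h a)
    rwa [zero_sub] at hneg

theorem blocks_mem_hermitianBlocks [Fintype I] (hk : ∀ i, 0 < k i) {ℓ : I → I → Module.Dual K R}
    (hℓ : ℓ ∈ S.symFamily (minExp k)) : D.blocks k ℓ ∈ S.hermitianBlocks k := by
  rintro ⟨a, ha⟩
  refine S.isSignHermitian_iff.2 ?_
  rintro ⟨i, hi⟩ ⟨j, hj⟩
  obtain rfl : k i = a := hi
  change k j = k i at hj
  change D.topCoef (k i - 1) (ℓ i j) = S.sign (k i - 1) * S.τ (D.topCoef (k j - 1) (ℓ j i))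
  have hmem : ℓ j i ∈ D.ann (k i - 1 + 1) := by
    rw [← minExp_of_eq hk hj.symm, minExp_comm]
    exact hℓ.1 j i
  rw [hℓ.2 j i, hj, S.topCoef_comp hmem]

theorem exists_mem_symFamily_blocks_eq [Fintype I] (h2 : (2 : K) ≠ 0) (hk : ∀ i, 0 < k i)
    (hN : ∀ i, k i ≤ N)
    {B : ∀ a : Finset.univ.image k, Matrix {i // k i = a} {i // k i = a} F}
    (hB : B ∈ S.hermitianBlocks k) : ∃ ℓ ∈ S.symFamily (minExp k), D.blocks k ℓ = B := by
  obtain ⟨ℓ, hℓ, rfl⟩ := D.exists_blocks_eq hk hN B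
  have hcomp (i j : I) : ℓ j i ∘ₗ S.σ.toLinearMap ∈ D.ann (minExp k i j) := by
    rw [minExp_comm]
    exact S.comp_mem_ann (hℓ j i)
  refine ⟨fun i j => (2 : K)⁻¹ • (ℓ i j + ℓ j i ∘ₗ S.σ.toLinearMap), ⟨fun i j =>
    Submodule.smul_mem _ _ (Submodule.add_mem _ (hℓ i j) (hcomp i j)), fun i j => ?_⟩, ?_⟩
  · rw [LinearMap.smul_comp, LinearMap.add_comp, comp_comp, add_comm]
  · funext ⟨a, ha⟩
    ext ⟨i, hi⟩ ⟨j, hj⟩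
    obtain rfl : k i = a := hi
    change k j = k i at hj
    have hherm : D.topCoef (k i - 1) (ℓ i j) =
        S.sign (k i - 1) * S.τ (D.topCoef (k j - 1) (ℓ j i)) :=
      S.isSignHermitian_iff.1 (hB ⟨k i, ha⟩) ⟨i, rfl⟩ ⟨j, hj⟩
    have hmem : ℓ j i ∈ D.ann (k i - 1 + 1) := by
      rw [← minExp_of_eq hk hj.symm, minExp_comm]
      exact hℓ j i
    change D.topCoef (k i - 1) ((2 : K)⁻¹ • (ℓ i j + ℓ j i ∘ₗ S.σ.toLinearMap)) =
      D.topCoef (k i - 1) (ℓ i j)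
    rw [map_smul, map_add, S.topCoef_comp hmem, hherm, hj, half_add_self h2]

theorem mem_symFamily_and_blocks_eq_zero [Fintype I] (hk : ∀ i, 0 < k i)
    (ℓ : I → I → Module.Dual K R) :
    ℓ ∈ S.symFamily (minExp k) ∧ D.blocks k ℓ = 0 ↔ ℓ ∈ S.symFamily (subExp k) := by
  rw [symFamily, symFamily, AddSubgroup.mem_mk, AddSubgroup.mem_mk]
  exact and_right_comm.trans (and_congr_left' (D.mem_family_and_blocks_eq_zero hk ℓ))

theorem card_symFamily_det_ne_zero [Fintype I] [LinearOrder I] (h2 : (2 : K) ≠ 0)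
    (hk : ∀ i, 0 < k i) (hN : ∀ i, k i ≤ N) :
    Nat.card {ℓ : I → I → Module.Dual K R // ℓ ∈ S.symFamily (minExp k) ∧
      (D.coefMatrix k ℓ).det ≠ 0} =
    Nat.card F ^ (∑ i, ∑ j with j < i, subExp k i j) *
      (∏ i, ∏ b ∈ Finset.range (k i - 1), Nat.card (S.signFixed b)) *
      ∏ a ∈ Finset.univ.image k, S.signHermitianCount (a - 1) {i // k i = a} := by
  have hblocks := natCard_mem_and_map (D.blocks k) (S.symFamily (minExp k)) (S.hermitianBlocks k)
    (fun ℓ hℓ => S.blocks_mem_hermitianBlocks hk hℓ)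
    (fun B hB => S.exists_mem_symFamily_blocks_eq h2 hk hN hB) (fun B => ∀ a, (B a).det ≠ 0)
  have hdet (ℓ : I → I → Module.Dual K R) :
      ℓ ∈ S.symFamily (minExp k) ∧ (D.coefMatrix k ℓ).det ≠ 0 ↔
        ℓ ∈ S.symFamily (minExp k) ∧ ∀ a, (D.blocks k ℓ a).det ≠ 0 :=
    and_congr_right fun hℓ => D.det_coefMatrix_ne_zero hℓ.1
  have hcard := S.card_symFamily h2 (subExp_comm (k := k)) (subExp_le hN)
  simp only [subExp_of_eq (k := k) rfl] at hcard
  rw [Nat.card_congr (Equiv.subtypeEquivRight hdet), hblocks,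
    Nat.card_congr (Equiv.subtypeEquivRight (S.mem_symFamily_and_blocks_eq_zero hk)), ← hcard,
    ← Finset.prod_coe_sort]
  simp only [signHermitianCount]
  rw [← Nat.card_pi]
  exact congrArg _ (Nat.card_congr ((Equiv.subtypeEquivRight fun B => forall_and.symm).trans
    (Equiv.subtypePiEquivPi (p := fun (a : Finset.univ.image k)
      (B : Matrix {i // k i = a.1} {i // k i = a.1} F) =>
        S.IsSignHermitian (a - 1) B ∧ B.det ≠ 0))))

end Uniformized.Involution

/-! ### Invariant pairings as families of functionals -/

/-- Presentation of a `K`-space by `R ^ I` with relations `π ^ (k i) = 0`. -/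
structure Uniformized.Presentation {K R F : Type*} [Field K] [CommRing R] [Algebra K R] [Field F]
    [Algebra K F] {N : ℕ} (D : Uniformized K R F N) {I : Type*} (k : I → ℕ) (M : Type*)
    [AddCommGroup M] [Module K M] where
  map : (I → R) →ₗ[K] M
  surj : Function.Surjective map
  ker : ∀ x, map x = 0 ↔ ∀ i, D.π ^ k i ∣ x i

theorem exists_bilin_of_surjective {K V V' M M' : Type*} [Field K] [AddCommGroup V] [Module K V]
    [AddCommGroup V'] [Module K V'] [AddCommGroup M] [Module K M] [AddCommGroup M'] [Module K M']
    (B : V →ₗ[K] V' →ₗ[K] K) (p : V →ₗ[K] M) (p' : V' →ₗ[K] M') (hp : Function.Surjective p)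
    (hp' : Function.Surjective p') (h : ∀ x y, p x = 0 → B x y = 0)
    (h' : ∀ x y, p' y = 0 → B x y = 0) :
    ∃ γ : M →ₗ[K] M' →ₗ[K] K, ∀ x y, γ (p x) (p' y) = B x y := by
  obtain ⟨s, hs⟩ := LinearMap.exists_rightInverse_of_surjective p (LinearMap.range_eq_top.2 hp)
  obtain ⟨s', hs'⟩ := LinearMap.exists_rightInverse_of_surjective p' (LinearMap.range_eq_top.2 hp')
  refine ⟨B.compl₁₂ s s', fun x y => ?_⟩
  rw [LinearMap.compl₁₂_apply]
  have hleft : B (s (p x) - x) (s' (p' y)) = 0 := h _ _ (by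
    rw [map_sub, sub_eq_zero]; exact LinearMap.congr_fun hs (p x))
  have hright : B x (s' (p' y) - y) = 0 := h' _ _ (by
    rw [map_sub, sub_eq_zero]; exact LinearMap.congr_fun hs' (p' y))
  rw [map_sub, LinearMap.sub_apply, sub_eq_zero] at hleft
  rw [map_sub, sub_eq_zero] at hright
  rw [hleft, hright]

namespace Uniformized.Presentation

variable {K R F : Type*} [Field K] [CommRing R] [Algebra K R] [Field F] [Algebra K F] {N : ℕ}
  {D : Uniformized K R F N} {I : Type*} {k : I → ℕ} {M M' : Type*}
  [AddCommGroup M] [Module K M] [AddCommGroup M'] [Module K M']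
  (p : D.Presentation k M) (p' : D.Presentation k M')

/-- `R`-balanced pairings: those through which `M ⊗[R] M'` factors, with `R` acting through the
presentations. -/
def IsBalanced (γ : M →ₗ[K] M' →ₗ[K] K) : Prop :=
  ∀ (r : R) x y, γ (p.map (r • x)) (p'.map y) = γ (p.map x) (p'.map (r • y))

theorem isBalanced_iff {t : R} (ht : IsUnit t) (hadj : Algebra.adjoin K {t} = ⊤)
    {T : M →ₗ[K] M} {T' : M' →ₗ[K] M'} (hT : ∀ x, p.map (t • x) = T (p.map x))
    (hT' : ∀ y, T' (p'.map (t • y)) = p'.map y) (γ : M →ₗ[K] M' →ₗ[K] K) :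
    IsBalanced p p' γ ↔ ∀ m m', γ (T m) (T' m') = γ m m' := by
  constructor
  · intro h m m'
    obtain ⟨x, rfl⟩ := p.surj m
    obtain ⟨y, rfl⟩ := p'.surj m'
    obtain ⟨u, rfl⟩ := ht
    have hy : y = (u : R) • ((u⁻¹ : Rˣ) : R) • y := by
      rw [smul_smul, Units.mul_inv, one_smul]
    rw [hy, hT', ← hT, h]
  · intro h r
    have hr : r ∈ Algebra.adjoin K {t} := hadj ▸ Algebra.mem_top
    induction hr using Algebra.adjoin_induction with
    | mem r hr =>
      rw [Set.mem_singleton_iff] at hr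
      subst hr
      intro x y
      rw [hT, ← hT' y, h]
    | algebraMap c =>
      intro x y
      simp only [algebraMap_smul, map_smul, LinearMap.smul_apply]
    | add r s _ _ hr hs =>
      intro x y
      simp only [add_smul, map_add, LinearMap.add_apply, hr, hs]
    | mul r s _ _ hr hs =>
      intro x y
      rw [mul_smul, hr, hs, ← mul_smul, mul_comm]

/-- The bilinear form on `I → R` with matrix entries `(u, v) ↦ ℓ i j (u * v)`. -/
def ofFamily [Fintype I] (ℓ : I → I → Module.Dual K R) : (I → R) →ₗ[K] (I → R) →ₗ[K] K :=
  LinearMap.mk₂ K (fun x y => ∑ i, ∑ j, ℓ i j (x i * y j))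
    (fun x x' y => by simp only [Pi.add_apply, add_mul, map_add, Finset.sum_add_distrib])
    (fun c x y => by simp only [Pi.smul_apply, smul_mul_assoc, map_smul, Finset.smul_sum])
    (fun x y y' => by simp only [Pi.add_apply, mul_add, map_add, Finset.sum_add_distrib])
    (fun c x y => by simp only [Pi.smul_apply, mul_smul_comm, map_smul, Finset.smul_sum])

theorem ofFamily_apply [Fintype I] (ℓ : I → I → Module.Dual K R) (x y : I → R) :
    ofFamily ℓ x y = ∑ i, ∑ j, ℓ i j (x i * y j) := rfl

theorem ofFamily_single [Fintype I] [DecidableEq I] (ℓ : I → I → Module.Dual K R) (i j : I)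
    (u v : R) :
    ofFamily ℓ (Pi.single i u) (Pi.single j v) = ℓ i j (u * v) := by
  rw [ofFamily_apply, Fintype.sum_eq_single i, Fintype.sum_eq_single j, Pi.single_eq_same,
    Pi.single_eq_same]
  · intro j' hj'
    rw [Pi.single_eq_of_ne hj', mul_zero, map_zero]
  · intro i' hi'
    exact Finset.sum_eq_zero fun j _ => by rw [Pi.single_eq_of_ne hi', zero_mul, map_zero]

variable [DecidableEq I]

/-- The family of functionals `u ↦ γ (u e_i) e_j`. -/
def toFamily (γ : M →ₗ[K] M' →ₗ[K] K) (i j : I) : Module.Dual K R :=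
  γ.flip (p'.map (Pi.single j 1)) ∘ₗ p.map ∘ₗ LinearMap.single K (fun _ => R) i

theorem toFamily_apply (γ : M →ₗ[K] M' →ₗ[K] K) (i j : I) (u : R) :
    toFamily p p' γ i j u = γ (p.map (Pi.single i u)) (p'.map (Pi.single j 1)) := rfl

theorem map_single_eq_zero {i : I} {u : R} (h : D.π ^ k i ∣ u) :
    p.map (Pi.single i u) = 0 := by
  rw [p.ker]
  intro j
  by_cases hj : j = i
  · subst hj; rwa [Pi.single_eq_same]
  · rw [Pi.single_eq_of_ne hj]; exact dvd_zero _

variable {p p'}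

theorem IsBalanced.apply_single {γ : M →ₗ[K] M' →ₗ[K] K} (h : IsBalanced p p' γ) (i j : I)
    (u v : R) :
    γ (p.map (Pi.single i u)) (p'.map (Pi.single j v)) = toFamily p p' γ i j (u * v) := by
  have hv : (Pi.single j v : I → R) = v • Pi.single j 1 := by
    rw [← Pi.single_smul, smul_eq_mul, mul_one]
  rw [toFamily_apply, hv, ← h, ← Pi.single_smul, smul_eq_mul, mul_comm]

theorem IsBalanced.toFamily_mem {γ : M →ₗ[K] M' →ₗ[K] K} (h : IsBalanced p p' γ) :
    toFamily p p' γ ∈ D.family (minExp k) := by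
  intro i j u
  rcases min_choice (k i) (k j) with hmin | hmin
  · rw [toFamily_apply, map_single_eq_zero p, map_zero, LinearMap.zero_apply]
    rw [minExp, hmin]; exact dvd_mul_right _ _
  · rw [mul_comm, ← h.apply_single, map_single_eq_zero p', map_zero]
    rw [minExp, hmin]

variable (p p') in
theorem exists_toFamily_eq [Finite I] {ℓ : I → I → Module.Dual K R} (hℓ : ℓ ∈ D.family (minExp k)) :
    ∃ γ : M →ₗ[K] M' →ₗ[K] K, IsBalanced p p' γ ∧ toFamily p p' γ = ℓ := by
  cases nonempty_fintype I
  obtain ⟨γ, hγ⟩ := exists_bilin_of_surjective (ofFamily ℓ) p.map p'.map p.surj p'.surj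
    (fun x y hx => by
      rw [p.ker] at hx
      exact Finset.sum_eq_zero fun i _ => Finset.sum_eq_zero fun j _ => D.apply_eq_zero
        (D.ann_mono (min_le_left _ _) (hℓ i j)) ((hx i).mul_right _))
    (fun x y hy => by
      rw [p'.ker] at hy
      exact Finset.sum_eq_zero fun i _ => Finset.sum_eq_zero fun j _ => D.apply_eq_zero
        (D.ann_mono (min_le_right _ _) (hℓ i j)) ((hy j).mul_left _))
  refine ⟨γ, fun r x y => ?_, ?_⟩
  · rw [hγ, hγ, ofFamily_apply, ofFamily_apply]
    refine Finset.sum_congr rfl fun i _ => Finset.sum_congr rfl fun j _ => ?_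
    rw [Pi.smul_apply, Pi.smul_apply, smul_mul_assoc, mul_smul_comm]
  · funext i j
    ext u
    rw [toFamily_apply, hγ, ofFamily_single, mul_one]

variable [Fintype I]

theorem IsBalanced.apply_eq_sum {γ : M →ₗ[K] M' →ₗ[K] K} (h : IsBalanced p p' γ) (x y : I → R) :
    γ (p.map x) (p'.map y) = ∑ i, ∑ j, toFamily p p' γ i j (x i * y j) := by
  conv_lhs => rw [← Finset.univ_sum_single x, ← Finset.univ_sum_single y]
  rw [map_sum p.map, map_sum γ, LinearMap.sum_apply]
  refine Finset.sum_congr rfl fun i _ => ?_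
  rw [map_sum p'.map, map_sum]
  refine Finset.sum_congr rfl fun j _ => ?_
  exact h.apply_single _ _ _ _

variable (p p')

/-- Balanced pairings correspond to families of functionals, `ℓ i j` being killed by the smaller
of the two relations `π ^ k i` and `π ^ k j`. -/
noncomputable def balancedEquiv :
    {γ : M →ₗ[K] M' →ₗ[K] K // IsBalanced p p' γ} ≃ D.family (minExp k) :=
  Equiv.ofBijective (fun γ => ⟨toFamily p p' γ.1, γ.2.toFamily_mem⟩) <| by
    refine ⟨fun γ γ' h => Subtype.ext ?_, fun ℓ => ?_⟩
    · ext m m'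
      obtain ⟨x, rfl⟩ := p.surj m
      obtain ⟨y, rfl⟩ := p'.surj m'
      rw [γ.2.apply_eq_sum, γ'.2.apply_eq_sum, Subtype.mk.inj h]
    · obtain ⟨γ, hγ, h⟩ := exists_toFamily_eq p p' ℓ.2
      exact ⟨⟨γ, hγ⟩, Subtype.ext h⟩

variable {p p'} [FiniteDimensional K F] [Algebra.IsSeparable K F]

theorem IsBalanced.apply_pi_pow_mul_single {γ : M →ₗ[K] M' →ₗ[K] K} (h : IsBalanced p p' γ)
    (hk : ∀ i, 0 < k i) (z : I → R) (j : I) (u : R) :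
    γ (p.map fun i => D.π ^ (k i - 1) * z i) (p'.map (Pi.single j u)) =
      Algebra.trace K F
        (Matrix.vecMul (D.ρ ∘ z) (D.coefMatrix k (toFamily p p' γ)) j * D.ρ u) := by
  rw [h.apply_eq_sum]
  simp only [Matrix.vecMul, dotProduct]
  rw [Finset.sum_mul, map_sum]
  refine Finset.sum_congr rfl fun i _ => ?_
  have hmem : toFamily p p' γ i j ∈ D.ann (k i - 1 + 1) :=
    D.ann_mono ((min_le_left _ _).trans (Nat.sub_add_cancel (hk i)).ge) (h.toFamily_mem i j)
  rw [Fintype.sum_eq_single j fun j' hj' => by rw [Pi.single_eq_of_ne hj', mul_zero, map_zero],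
    Pi.single_eq_same, mul_assoc, D.apply_eq_trace hmem, map_mul D.ρ]
  simp only [coefMatrix, Matrix.of_apply, Function.comp_apply]
  ring_nf

theorem IsBalanced.det_coefMatrix_ne_zero {γ : M →ₗ[K] M' →ₗ[K] K} (h : IsBalanced p p' γ)
    (hk : ∀ i, 0 < k i) (hN : ∀ i, k i ≤ N) (hsep : γ.SeparatingLeft) :
    (D.coefMatrix k (toFamily p p' γ)).det ≠ 0 := by
  rw [ne_eq, ← Matrix.exists_vecMul_eq_zero_iff]
  rintro ⟨v, hv, hv0⟩
  choose z hz using fun i => D.surj (v i)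
  have hmap : p.map (fun i => D.π ^ (k i - 1) * z i) = 0 := by
    refine hsep _ fun m' => ?_
    obtain ⟨y, rfl⟩ := p'.surj m'
    rw [← Finset.univ_sum_single y, map_sum, map_sum]
    refine Finset.sum_eq_zero fun j _ => ?_
    rw [h.apply_pi_pow_mul_single hk, show D.ρ ∘ z = v from funext hz, hv0, Pi.zero_apply,
      zero_mul, map_zero]
  rw [p.ker] at hmap
  refine hv (funext fun i => ?_)
  have hki : 1 + (k i - 1) = k i := Nat.add_sub_cancel' (hk i)
  have hdvd := D.cancel 1 (k i - 1) (z i) (hki.trans_le (hN i)) (hki.symm ▸ hmap i)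
  rwa [pow_one, ← D.ker, hz] at hdvd

theorem IsBalanced.map_eq_zero_of_pi_smul {γ : M →ₗ[K] M' →ₗ[K] K} (h : IsBalanced p p' γ)
    (hk : ∀ i, 0 < k i) (hN : ∀ i, k i ≤ N)
    (hdet : (D.coefMatrix k (toFamily p p' γ)).det ≠ 0) {x : I → R}
    (hx : ∀ y, γ (p.map x) (p'.map y) = 0) (hπ : p.map (D.π • x) = 0) : p.map x = 0 := by
  rw [p.ker] at hπ
  have hdvd : ∀ i, D.π ^ (k i - 1) ∣ x i := fun i => by
    have hki : k i - 1 + 1 = k i := Nat.sub_add_cancel (hk i)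
    refine D.cancel (k i - 1) 1 (x i) (hki.trans_le (hN i)) ?_
    rw [hki, pow_one]
    exact hπ i
  choose z hz using hdvd
  obtain rfl : x = fun i => D.π ^ (k i - 1) * z i := funext hz
  have hvec : Matrix.vecMul (D.ρ ∘ z) (D.coefMatrix k (toFamily p p' γ)) = 0 := by
    funext j
    refine (traceForm_nondegenerate K F).1 _ fun c => ?_
    obtain ⟨u, rfl⟩ := D.surj c
    rw [Algebra.traceForm_apply, ← h.apply_pi_pow_mul_single hk]
    exact hx _
  have hρ : D.ρ ∘ z = 0 := Matrix.eq_zero_of_vecMul_eq_zero hdet hvec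
  rw [p.ker]
  intro i
  obtain ⟨w, hw⟩ := (D.ker _).1 (congrFun hρ i)
  rw [hw, ← mul_assoc, ← pow_succ, Nat.sub_add_cancel (hk i)]
  exact dvd_mul_right _ _

/-- The left radical has no `π`-torsion, and `π` acts nilpotently on it, so it vanishes. -/
theorem IsBalanced.separatingLeft {γ : M →ₗ[K] M' →ₗ[K] K} (h : IsBalanced p p' γ)
    (hk : ∀ i, 0 < k i) (hN : ∀ i, k i ≤ N)
    (hdet : (D.coefMatrix k (toFamily p p' γ)).det ≠ 0) : γ.SeparatingLeft := by
  have map_eq_zero : ∀ (a : ℕ) (x : I → R), (∀ y, γ (p.map x) (p'.map y) = 0) →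
      p.map (D.π ^ a • x) = 0 → p.map x = 0 := by
    intro a
    induction a with
    | zero => intro x _ hx; rwa [pow_zero, one_smul] at hx
    | succ a ih =>
      intro x hrad hx
      refine h.map_eq_zero_of_pi_smul hk hN hdet hrad (ih _ (fun y => ?_) ?_)
      · rw [h]; exact hrad _
      · rwa [smul_smul, ← pow_succ]
  intro m hm
  obtain ⟨x, rfl⟩ := p.surj m
  refine map_eq_zero (∑ i, k i) x (fun y => hm _) ((p.ker _).2 fun i => ?_)
  exact (pow_dvd_pow _ (Finset.single_le_sum (fun _ _ => Nat.zero_le _)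
    (Finset.mem_univ i))).mul_right _

theorem IsBalanced.separatingLeft_iff {γ : M →ₗ[K] M' →ₗ[K] K} (h : IsBalanced p p' γ)
    (hk : ∀ i, 0 < k i) (hN : ∀ i, k i ≤ N) :
    γ.SeparatingLeft ↔ (D.coefMatrix k (toFamily p p' γ)).det ≠ 0 :=
  ⟨h.det_coefMatrix_ne_zero hk hN, h.separatingLeft hk hN⟩

theorem card_separating_pairings (p : D.Presentation k M) (p' : D.Presentation k M')
    (hk : ∀ i, 0 < k i) (hN : ∀ i, k i ≤ N) {t : R} (ht : IsUnit t)
    (hadj : Algebra.adjoin K {t} = ⊤) {T : M →ₗ[K] M} {T' : M' →ₗ[K] M'}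
    (hT : ∀ x, p.map (t • x) = T (p.map x)) (hT' : ∀ y, T' (p'.map (t • y)) = p'.map y) :
    Nat.card {γ : M →ₗ[K] M' →ₗ[K] K // γ.SeparatingLeft ∧ ∀ m m', γ (T m) (T' m') = γ m m'} =
    Nat.card F ^ (∑ i, ∑ j, subExp k i j) * ∏ a ∈ Finset.univ.image k,
      Nat.card {B : Matrix {i // k i = a} {i // k i = a} F // B.det ≠ 0} := by
  rw [← D.card_family_det_ne_zero hk hN]
  simp only [← isBalanced_iff p p' ht hadj hT hT', and_comm (a := LinearMap.SeparatingLeft _)]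
  calc Nat.card {γ : M →ₗ[K] M' →ₗ[K] K // IsBalanced p p' γ ∧ γ.SeparatingLeft}
      = Nat.card {γ : {γ : M →ₗ[K] M' →ₗ[K] K // IsBalanced p p' γ} // γ.1.SeparatingLeft} :=
        Nat.card_congr (Equiv.subtypeSubtypeEquivSubtypeInter _ _).symm
    _ = Nat.card {ℓ : D.family (minExp k) // (D.coefMatrix k ℓ.1).det ≠ 0} :=
        Nat.card_congr ((balancedEquiv p p').subtypeEquiv fun γ => γ.2.separatingLeft_iff hk hN)
    _ = Nat.card {ℓ // ℓ ∈ D.family (minExp k) ∧ (D.coefMatrix k ℓ).det ≠ 0} :=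
        Nat.card_congr (Equiv.subtypeSubtypeEquivSubtypeInter _
          fun ℓ => (D.coefMatrix k ℓ).det ≠ 0)

end Uniformized.Presentation

namespace Uniformized.Involution

variable {K R F : Type*} [Field K] [CommRing R] [Algebra K R] [Field F] [Algebra K F] {N : ℕ}
  {D : Uniformized K R F N} (S : D.Involution) {I : Type*} {k : I → ℕ} {M : Type*}
  [AddCommGroup M] [Module K M] (p : D.Presentation k M)

/-- The presentation twisted by the involution. -/
def twist : D.Presentation k M where
  map := p.map ∘ₗ S.σ.toLinearMap.compLeft I
  surj m := by
    obtain ⟨x, rfl⟩ := p.surj m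
    refine ⟨fun i => S.σ (x i), ?_⟩
    rw [LinearMap.comp_apply]
    congr 1
    funext i
    exact S.invol (x i)
  ker x := by
    rw [LinearMap.comp_apply, p.ker]
    exact forall_congr' fun i => S.pi_pow_dvd_map_iff

theorem twist_map (x : I → R) : (S.twist p).map x = p.map fun i => S.σ (x i) := rfl

theorem map_eq_twist_map (x : I → R) : p.map x = (S.twist p).map fun i => S.σ (x i) := by
  rw [twist_map]
  simp only [S.invol]

theorem symmetric_iff [Finite I] [DecidableEq I] {β : M →ₗ[K] M →ₗ[K] K}
    (h : Presentation.IsBalanced p (S.twist p) β) :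
    (∀ m m', β m m' = β m' m) ↔ ∀ i j, Presentation.toFamily p (S.twist p) β j i =
      Presentation.toFamily p (S.twist p) β i j ∘ₗ S.σ.toLinearMap := by
  cases nonempty_fintype I
  constructor
  · intro hsymm i j
    ext u
    have hσ : (fun l => S.σ ((Pi.single j u : I → R) l)) = Pi.single j (S.σ u) :=
      funext fun l => Pi.apply_single (fun _ => S.σ) (fun _ => map_zero _) j u l
    have hone : (S.twist p).map (Pi.single i 1) = p.map (Pi.single i 1) := by
      rw [twist_map]
      congr 1
      funext l
      rw [Pi.apply_single (fun _ => S.σ) (fun _ => map_zero _) i 1 l, map_one]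
    rw [Presentation.toFamily_apply, hone, hsymm, S.map_eq_twist_map p (Pi.single j u), hσ,
      h.apply_single, one_mul, LinearMap.comp_apply, AlgHom.toLinearMap_apply]
  · intro hsymm m m'
    obtain ⟨x, rfl⟩ := p.surj m
    obtain ⟨y, rfl⟩ := p.surj m'
    rw [S.map_eq_twist_map p y, h.apply_eq_sum, ← S.map_eq_twist_map p y,
      S.map_eq_twist_map p x, h.apply_eq_sum, Finset.sum_comm]
    refine Finset.sum_congr rfl fun i _ => Finset.sum_congr rfl fun j _ => ?_
    rw [hsymm i j, LinearMap.comp_apply, AlgHom.toLinearMap_apply, map_mul, S.invol, mul_comm]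

variable [FiniteDimensional K F] [Algebra.IsSeparable K F]

theorem card_symmetric_forms [Fintype I] [LinearOrder I] (h2 : (2 : K) ≠ 0)
    (hk : ∀ i, 0 < k i) (hN : ∀ i, k i ≤ N) {t : R} (ht : t * S.σ t = 1)
    (hadj : Algebra.adjoin K {t} = ⊤) {T : M →ₗ[K] M}
    (hT : ∀ x, p.map (t • x) = T (p.map x)) :
    Nat.card {β : M →ₗ[K] M →ₗ[K] K // (∀ m m', β m m' = β m' m) ∧
      β.SeparatingLeft ∧ ∀ m m', β (T m) (T m') = β m m'} =
    Nat.card F ^ (∑ i, ∑ j with j < i, subExp k i j) *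
      (∏ i, ∏ b ∈ Finset.range (k i - 1), Nat.card (S.signFixed b)) *
      ∏ a ∈ Finset.univ.image k, S.signHermitianCount (a - 1) {i // k i = a} := by
  rw [← S.card_symFamily_det_ne_zero h2 hk hN]
  have hT' : ∀ y, T ((S.twist p).map (t • y)) = (S.twist p).map y := fun y => by
    rw [twist_map, twist_map, ← hT]
    congr 1
    funext i
    rw [Pi.smul_apply, Pi.smul_apply, smul_eq_mul, smul_eq_mul, map_mul, ← mul_assoc, ht, one_mul]
  simp only [← Presentation.isBalanced_iff p (S.twist p) (.of_mul_eq_one _ ht) hadj hT hT',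
    ← and_assoc, and_comm (b := Presentation.IsBalanced p (S.twist p) _)]
  simp only [and_assoc]
  calc Nat.card {β // Presentation.IsBalanced p (S.twist p) β ∧
        (∀ m m', β m m' = β m' m) ∧ β.SeparatingLeft}
      = Nat.card {β : {β // Presentation.IsBalanced p (S.twist p) β} //
          (∀ m m', β.1 m m' = β.1 m' m) ∧ β.1.SeparatingLeft} :=
        Nat.card_congr (Equiv.subtypeSubtypeEquivSubtypeInter _ fun β : M →ₗ[K] M →ₗ[K] K =>
          (∀ m m', β m m' = β m' m) ∧ β.SeparatingLeft).symm
    _ = Nat.card {ℓ : D.family (minExp k) //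
          (∀ i j, ℓ.1 j i = ℓ.1 i j ∘ₗ S.σ.toLinearMap) ∧ (D.coefMatrix k ℓ.1).det ≠ 0} :=
        Nat.card_congr ((Presentation.balancedEquiv p (S.twist p)).subtypeEquiv fun β =>
          and_congr (S.symmetric_iff p β.2) (β.2.separatingLeft_iff hk hN))
    _ = Nat.card {ℓ // ℓ ∈ S.symFamily (minExp k) ∧ (D.coefMatrix k ℓ).det ≠ 0} :=
        Nat.card_congr ((Equiv.subtypeSubtypeEquivSubtypeInter _
          fun ℓ => (∀ i j, ℓ j i = ℓ i j ∘ₗ S.σ.toLinearMap) ∧ (D.coefMatrix k ℓ).det ≠ 0).trans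
          (Equiv.subtypeEquivRight fun ℓ => and_assoc.symm))

end Uniformized.Involution

/-! ### The algebras `K[t] / (f ^ N)` -/

theorem reverse_pow_of_noZeroDivisors {R : Type*} [Semiring R] [NoZeroDivisors R] (p : R[X])
    (n : ℕ) :
    (p ^ n).reverse = p.reverse ^ n := by
  induction n with
  | zero => rw [pow_zero, pow_zero, ← C_1, reverse_C]
  | succ n ih => rw [pow_succ, pow_succ, reverse_mul_of_domain, ih]

namespace Phi

variable {K : Type*} [Field K]

instance (f : Phi K) : Fact (Irreducible f.1) := ⟨f.2.2.1⟩

instance (f : Phi K) : FiniteDimensional K (AdjoinRoot f.1) :=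
  (AdjoinRoot.powerBasis f.2.2.1.ne_zero).finite

theorem natCard_adjoinRoot (f : Phi K) : Nat.card (AdjoinRoot f.1) = Nat.card K ^ f.deg := by
  rw [Module.natCard_eq_pow_finrank (K := K), PowerBasis.finrank (AdjoinRoot.powerBasis
    f.2.2.1.ne_zero), AdjoinRoot.powerBasis_dim]
  rfl

theorem deg_pos (f : Phi K) : 0 < f.deg := f.2.2.1.natDegree_pos

theorem reverse_eq (f : Phi K) : f.1.reverse = C (f.1.coeff 0) * f.star.1 := by
  rw [star, ← mul_assoc, ← C_mul, mul_inv_cancel₀ f.2.2.2, C_1, one_mul]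

theorem star_star (f : Phi K) : f.star.star = f := by
  have hrev : f.star.1.reverse = C (f.1.coeff 0)⁻¹ * f.1 := by
    change (C (f.1.coeff 0)⁻¹ * f.1.reverse).reverse = _
    rw [reverse_mul_of_domain, reverse_C, reverse_reverse_of_coeff_zero f.2.2.2]
  have hcoeff : f.star.1.coeff 0 = (f.1.coeff 0)⁻¹ := by
    change (C (f.1.coeff 0)⁻¹ * f.1.reverse).coeff 0 = _
    rw [coeff_C_mul, coeff_zero_reverse, f.2.1.leadingCoeff, mul_one]
  apply Subtype.ext
  change C (f.star.1.coeff 0)⁻¹ * f.star.1.reverse = f.1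
  rw [hrev, hcoeff, inv_inv, ← mul_assoc, ← C_mul, mul_inv_cancel₀ f.2.2.2, C_1, one_mul]

theorem star_deg (f : Phi K) : f.star.deg = f.deg := by
  have h : f.1.natTrailingDegree = 0 := natTrailingDegree_eq_zero.2 (Or.inr f.2.2.2)
  change (C (f.1.coeff 0)⁻¹ * f.1.reverse).natDegree = f.1.natDegree
  rw [natDegree_C_mul (inv_ne_zero f.2.2.2), reverse_natDegree, h, Nat.sub_zero]

theorem coeff_zero_pow_ne_zero (f : Phi K) (N : ℕ) : (f.1 ^ N).coeff 0 ≠ 0 := by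
  rw [coeff_zero_eq_eval_zero, eval_pow, ← coeff_zero_eq_eval_zero]
  exact pow_ne_zero _ f.2.2.2

theorem star_pow_dvd_reverse_of_dvd (f : Phi K) {k : ℕ} {p : K[X]} (h : f.1 ^ k ∣ p) :
    f.star.1 ^ k ∣ p.reverse := by
  obtain ⟨q, rfl⟩ := h
  rw [reverse_mul_of_domain, reverse_pow_of_noZeroDivisors, reverse_eq, mul_pow, mul_assoc]
  exact (dvd_mul_right _ _).mul_left _

theorem star_pow_dvd_reverse_iff (f : Phi K) {k : ℕ} {p : K[X]} :
    f.star.1 ^ k ∣ p.reverse ↔ f.1 ^ k ∣ p := by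
  refine ⟨fun h => ?_, f.star_pow_dvd_reverse_of_dvd⟩
  by_cases hp : p = 0
  · rw [hp]; exact dvd_zero _
  obtain ⟨q, hq, hX⟩ := (Polynomial.finiteMultiplicity_X_sub_C 0 hp).exists_eq_pow_mul_and_not_dvd
  rw [C_0, sub_zero] at hq hX
  rw [X_dvd_iff] at hX
  have hrev := f.star.star_pow_dvd_reverse_of_dvd h
  rw [star_star, hq, reverse_X_pow_mul, reverse_reverse_of_coeff_zero hX] at hrev
  rw [hq]
  exact hrev.mul_left _

end Phi

section RootInversion

open AdjoinRoot

variable {K : Type*} [Field K]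

theorem isUnit_root_of_coeff_zero_ne_zero {g : K[X]} (h : g.coeff 0 ≠ 0) : IsUnit (root g) := by
  have hmul : root g * mk g g.divX = -algebraMap K (AdjoinRoot g) (g.coeff 0) := by
    rw [eq_neg_iff_add_eq_zero, ← mk_X, ← map_mul, AdjoinRoot.algebraMap_eq, ← mk_C, ← map_add,
      X_mul_divX_add, mk_self]
  refine isUnit_of_mul_isUnit_left (y := mk g g.divX) ?_
  rw [hmul]
  exact ((isUnit_iff_ne_zero.2 h).map _).neg

/-- The inverse of the root in `K[X] / (g)`; junk unless `g` has nonzero constant coefficient. -/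
noncomputable def invRoot (g : K[X]) : AdjoinRoot g := Ring.inverse (root g)

theorem root_mul_invRoot {g : K[X]} (h : g.coeff 0 ≠ 0) : root g * invRoot g = 1 :=
  Ring.mul_inverse_cancel _ (isUnit_root_of_coeff_zero_ne_zero h)

theorem aeval_invRoot {h : K[X]} (hh : h.coeff 0 ≠ 0) (p : K[X]) :
    aeval (invRoot h) p = mk h p.reverse * invRoot h ^ p.natDegree := by
  let _ : Invertible (invRoot h) := ⟨root h, root_mul_invRoot hh, by
    rw [mul_comm]; exact root_mul_invRoot hh⟩
  rw [aeval_def, ← eval₂_reverse_mul_pow, ← aeval_eq]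
  rfl

/-- The homomorphism `K[X] / (g) → K[X] / (h)`, `X ↦ X⁻¹`, for `h` dividing the reverse of `g`. -/
noncomputable def invRootHom (g h : K[X]) (hh : h.coeff 0 ≠ 0) (hd : h ∣ g.reverse) :
    AdjoinRoot g →ₐ[K] AdjoinRoot h :=
  liftAlgHom g (Algebra.ofId K _) (invRoot h) <| by
    have haeval := aeval_invRoot hh g
    rwa [mk_eq_zero.2 hd, zero_mul] at haeval

variable {g h : K[X]} {hh : h.coeff 0 ≠ 0} {hd : h ∣ g.reverse}

theorem invRootHom_root : invRootHom g h hh hd (root g) = invRoot h := liftAlgHom_root _ _ _ _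

theorem root_mul_invRootHom_root : root h * invRootHom g h hh hd (root g) = 1 := by
  rw [invRootHom_root, root_mul_invRoot hh]

theorem invRootHom_mk (p : K[X]) :
    invRootHom g h hh hd (mk g p) = mk h p.reverse * invRoot h ^ p.natDegree := by
  rw [← aeval_eq, ← aeval_algHom_apply, invRootHom_root, aeval_invRoot hh]

theorem invRootHom_mk_eq_zero_iff (p : K[X]) :
    invRootHom g h hh hd (mk g p) = 0 ↔ h ∣ p.reverse := by
  have hu : IsUnit (invRoot h ^ p.natDegree) :=
    (IsUnit.of_mul_eq_one_right _ (root_mul_invRoot hh)).pow _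
  rw [invRootHom_mk, hu.mul_left_eq_zero, mk_eq_zero]

theorem invRootHom_invRoot (hg : g.coeff 0 ≠ 0) : invRootHom g h hh hd (invRoot g) = root h := by
  have hinv : invRoot h * invRootHom g h hh hd (invRoot g) = 1 := by
    rw [← invRootHom_root (hd := hd) (hh := hh), ← map_mul, root_mul_invRoot hg, map_one]
  calc invRootHom g h hh hd (invRoot g)
      = root h * invRoot h * invRootHom g h hh hd (invRoot g) := by
        rw [root_mul_invRoot hh, one_mul]
    _ = root h := by rw [mul_assoc, hinv, mul_one]

theorem invRootHom_surjective (hg : g.coeff 0 ≠ 0) :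
    Function.Surjective (invRootHom g h hh hd) := by
  rw [← AlgHom.range_eq_top, eq_top_iff, ← adjoinRoot_eq_top, Algebra.adjoin_le_iff,
    Set.singleton_subset_iff]
  exact ⟨invRoot g, invRootHom_invRoot hg⟩

theorem invRootHom_invRootHom (hg : g.coeff 0 ≠ 0) (hd : g ∣ g.reverse) (u : AdjoinRoot g) :
    invRootHom g g hg hd (invRootHom g g hg hd u) = u := by
  have hcomp : (invRootHom g g hg hd).comp (invRootHom g g hg hd) = AlgHom.id K _ :=
    algHom_ext <| by
      rw [AlgHom.comp_apply, AlgHom.id_apply, invRootHom_root, invRootHom_invRoot hg]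
  exact DFunLike.congr_fun hcomp u

theorem algHomOfDvd_mk {hd : h ∣ g} (p : K[X]) : algHomOfDvd K g h hd (mk g p) = mk h p := by
  rw [← aeval_eq, ← aeval_algHom_apply, algHomOfDvd_root, aeval_eq]

theorem algHomOfDvd_surjective {hd : h ∣ g} : Function.Surjective (algHomOfDvd K g h hd) :=
  fun y => by
    obtain ⟨p, rfl⟩ := mk_surjective y
    exact ⟨mk g p, algHomOfDvd_mk p⟩

theorem algHomOfDvd_invRoot (hg : g.coeff 0 ≠ 0) (hh : h.coeff 0 ≠ 0) {hd : h ∣ g} :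
    algHomOfDvd K g h hd (invRoot g) = invRoot h := by
  have hone := congrArg (algHomOfDvd K g h hd) (root_mul_invRoot hg)
  rw [map_mul, map_one, algHomOfDvd_root] at hone
  exact (isUnit_root_of_coeff_zero_ne_zero hh).mul_left_cancel
    (hone.trans (root_mul_invRoot hh).symm)

theorem algHomOfDvd_invRootHom (hg : g.coeff 0 ≠ 0) (hgd : g ∣ g.reverse) (hh : h.coeff 0 ≠ 0)
    (hhd : h ∣ h.reverse) {hd : h ∣ g} (u : AdjoinRoot g) :
    algHomOfDvd K g h hd (invRootHom g g hg hgd u) =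
      invRootHom h h hh hhd (algHomOfDvd K g h hd u) := by
  have hcomp : (algHomOfDvd K g h hd).comp (invRootHom g g hg hgd) =
      (invRootHom h h hh hhd).comp (algHomOfDvd K g h hd) := algHom_ext <| by
    rw [AlgHom.comp_apply, AlgHom.comp_apply, algHomOfDvd_root, invRootHom_root, invRootHom_root,
      algHomOfDvd_invRoot hg hh]
  exact DFunLike.congr_fun hcomp u

theorem mk_dvd_mk_iff_of_dvd (hd : h ∣ g) {p : K[X]} : mk g h ∣ mk g p ↔ h ∣ p := by
  refine ⟨fun ⟨q, hq⟩ => ?_, map_dvd _⟩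
  obtain ⟨q, rfl⟩ := mk_surjective q
  rw [← map_mul, mk_eq_mk] at hq
  simpa only [sub_add_cancel] using (hd.trans hq).add (dvd_mul_right h q)

end RootInversion

namespace Phi

open AdjoinRoot

variable {K : Type*} [Field K] (f : Phi K) {N : ℕ}

/-- Reduction modulo `f` on `K[t] / (f ^ N)`. -/
noncomputable def residue (hN : 0 < N) : AdjoinRoot (f.1 ^ N) →ₐ[K] AdjoinRoot f.1 :=
  algHomOfDvd K _ _ (dvd_pow_self _ hN.ne')

theorem residue_mk (hN : 0 < N) (p : K[X]) : f.residue hN (mk _ p) = mk _ p := algHomOfDvd_mk p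

theorem isUnit_of_residue_ne_zero (hN : 0 < N) {u : AdjoinRoot (f.1 ^ N)}
    (hu : f.residue hN u ≠ 0) : IsUnit u := by
  obtain ⟨p, rfl⟩ := mk_surjective u
  rw [residue_mk, ne_eq, mk_eq_zero] at hu
  obtain ⟨a, b, hab⟩ := ((f.2.2.1.coprime_iff_not_dvd).2 hu).pow_left (m := N)
  refine IsUnit.of_mul_eq_one_right (mk _ b) ?_
  rw [← map_mul, ← map_one (mk (f.1 ^ N)), mk_eq_mk]
  exact ⟨-a, by linear_combination hab⟩

/-- The algebra `K[t] / (f ^ N)`, with the uniformizer `v * f` for a unit `v`. -/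
noncomputable def uniformized (hN : 0 < N) {v : AdjoinRoot (f.1 ^ N)} (hv : IsUnit v) :
    Uniformized K (AdjoinRoot (f.1 ^ N)) (AdjoinRoot f.1) N where
  ρ := f.residue hN
  π := v * mk _ f.1
  surj := algHomOfDvd_surjective
  ker u := by
    obtain ⟨p, rfl⟩ := mk_surjective u
    rw [hv.mul_left_dvd, mk_dvd_mk_iff_of_dvd (dvd_pow_self _ hN.ne'), residue_mk, mk_eq_zero]
  cancel a b u hab h := by
    obtain ⟨p, rfl⟩ := mk_surjective u
    rw [mul_pow, mul_pow, (hv.pow _).mul_left_dvd, mul_assoc, (hv.pow _).dvd_mul_left, ← map_pow,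
      ← map_pow, ← map_mul, mk_dvd_mk_iff_of_dvd (pow_dvd_pow _ hab), add_comm, pow_add,
      mul_dvd_mul_iff_left (pow_ne_zero _ f.2.2.1.ne_zero)] at h
    rw [mul_pow, (hv.pow _).mul_left_dvd, ← map_pow]
    exact map_dvd _ h

theorem uniformized_pi_pow_dvd_iff (hN : 0 < N) {v : AdjoinRoot (f.1 ^ N)} (hv : IsUnit v)
    {a : ℕ} (ha : a ≤ N) (p : K[X]) :
    (f.uniformized hN hv).π ^ a ∣ mk (f.1 ^ N) p ↔ f.1 ^ a ∣ p := by
  change (v * mk _ f.1) ^ a ∣ _ ↔ _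
  rw [mul_pow, (hv.pow _).mul_left_dvd, ← map_pow, mk_dvd_mk_iff_of_dvd (pow_dvd_pow _ ha)]

theorem root_eq_algebraMap (hdeg : f.deg = 1) :
    root f.1 = algebraMap K _ (-f.1.coeff 0) := by
  have hroot := (congrArg (mk f.1) (f.2.1.eq_X_add_C hdeg)).symm.trans mk_self
  rw [map_add, mk_X, mk_C] at hroot
  rw [map_neg, AdjoinRoot.algebraMap_eq, ← eq_neg_iff_add_eq_zero.2 hroot]

section SelfDual

variable {f} (hf : f.star = f)
include hf

theorem pow_dvd_reverse_pow (k : ℕ) : f.1 ^ k ∣ (f.1 ^ k).reverse := by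
  have h := f.star_pow_dvd_reverse_of_dvd (dvd_refl (f.1 ^ k))
  rwa [hf] at h

theorem dvd_reverse : f.1 ∣ f.1.reverse := by
  simpa only [pow_one] using pow_dvd_reverse_pow hf 1

theorem invRootHom_mk_self (N : ℕ) :
    invRootHom _ _ (f.coeff_zero_pow_ne_zero N) (pow_dvd_reverse_pow hf N) (mk _ f.1) =
      algebraMap K _ (f.1.coeff 0) * invRoot _ ^ f.deg * mk _ f.1 := by
  rw [invRootHom_mk, reverse_eq, hf, map_mul, mk_C, AdjoinRoot.algebraMap_eq, deg]
  ring

variable (hN : 0 < N) {δ : K} (hδ : δ * δ = 1)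
    (hv : IsUnit (1 + algebraMap K (AdjoinRoot (f.1 ^ N)) δ *
      (algebraMap K _ (f.1.coeff 0) * invRoot _ ^ f.deg)))

/-- The involution `t ↦ t⁻¹` of `K[t] / (f ^ N)` for `f = f*`. With `w = σ f / f`, the uniformizer
`(1 + δ * w) * f = f + δ * σ f` is multiplied by the sign `δ`. -/
noncomputable def involution :
    (f.uniformized hN hv).Involution where
  σ := invRootHom _ _ (f.coeff_zero_pow_ne_zero N) (pow_dvd_reverse_pow hf N)
  τ := invRootHom _ _ f.2.2.2 (dvd_reverse hf)
  δ := δ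
  invol := invRootHom_invRootHom _ _
  compat := algHomOfDvd_invRootHom (hd := dvd_pow_self _ hN.ne') _ _ _ _
  map_pi := by
    change invRootHom _ _ _ _ ((1 + _) * mk _ f.1) = _ * ((1 + _) * mk _ f.1)
    rw [add_mul, one_mul, mul_assoc, ← invRootHom_mk_self hf N, map_add, map_mul, AlgHom.commutes,
      invRootHom_invRootHom, mul_add, ← mul_assoc, ← map_mul, hδ, map_one, one_mul, add_comm]
  sq := hδ

theorem root_mul_involution_σ : root _ * (involution hf hN hδ hv).σ (root _) = 1 :=
  root_mul_invRootHom_root (hh := f.coeff_zero_pow_ne_zero N) (hd := pow_dvd_reverse_pow hf N)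

theorem root_mul_involution_τ : root _ * (involution hf hN hδ hv).τ (root _) = 1 :=
  root_mul_invRootHom_root (hh := f.2.2.2) (hd := dvd_reverse hf)

omit hδ hv in
theorem exists_involution (h2 : (2 : K) ≠ 0) :
    ∃ (v : AdjoinRoot (f.1 ^ N)) (hv : IsUnit v) (S : (f.uniformized hN hv).Involution),
      root _ * S.σ (root _) = 1 ∧ root _ * S.τ (root _) = 1 ∧ (S.δ = 1 ∨ S.δ = -1) ∧
      (f.deg = 1 → S.δ = -1) := by
  set w : AdjoinRoot (f.1 ^ N) := algebraMap K _ (f.1.coeff 0) * invRoot _ ^ f.deg with hw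
  by_cases hres : f.residue hN (1 + w) = 0
  · have hunit : IsUnit (1 + algebraMap K _ (-1) * w) := by
      refine f.isUnit_of_residue_ne_zero hN fun hres' => ?_
      have htwo : (2 : AdjoinRoot f.1) ≠ 0 := by
        simpa only [map_ofNat] using (map_ne_zero (algebraMap K (AdjoinRoot f.1))).2 h2
      rw [map_add, map_one] at hres
      rw [map_neg, map_one, neg_one_mul, map_add, map_neg, map_one] at hres'
      exact htwo (by linear_combination hres + hres')
    exact ⟨_, hunit, involution hf hN (by ring) hunit, root_mul_involution_σ hf hN _ hunit,
      root_mul_involution_τ hf hN _ hunit, Or.inr rfl, fun _ => rfl⟩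
  · have hunit : IsUnit (1 + algebraMap K _ 1 * w) := by
      rw [map_one, one_mul]
      exact f.isUnit_of_residue_ne_zero hN hres
    refine ⟨_, hunit, involution hf hN (one_mul 1) hunit, root_mul_involution_σ hf hN _ hunit,
      root_mul_involution_τ hf hN _ hunit, Or.inl rfl, fun hdeg => (hres ?_).elim⟩
    have hinv : f.residue hN (invRoot _) = invRoot _ :=
      algHomOfDvd_invRoot (f.coeff_zero_pow_ne_zero N) f.2.2.2
    have hroot := root_mul_invRoot f.2.2.2
    rw [f.root_eq_algebraMap hdeg, map_neg] at hroot
    rw [hw, hdeg, pow_one, map_add, map_one, map_mul, AlgHom.commutes, hinv]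
    linear_combination -hroot

end SelfDual

end Phi

/-! ### Invariant forms on the primary components -/

/-- The number of nondegenerate symmetric bilinear forms preserved by `T`. -/
noncomputable def invFormCount {K V : Type*} [Field K] [AddCommGroup V] [Module K V]
    (T : V →ₗ[K] V) : ℕ :=
  Nat.card {β : V →ₗ[K] V →ₗ[K] K // (∀ m m', β m m' = β m' m) ∧
    β.SeparatingLeft ∧ ∀ m m', β (T m) (T m') = β m m'}

/-- The number of left separating pairings preserved by `(T, T')`. -/
noncomputable def invPairingCount {K V V' : Type*} [Field K] [AddCommGroup V] [Module K V]
    [AddCommGroup V'] [Module K V'] (T : V →ₗ[K] V) (T' : V' →ₗ[K] V') : ℕ :=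
  Nat.card {γ : V →ₗ[K] V' →ₗ[K] K // γ.SeparatingLeft ∧ ∀ m m', γ (T m) (T' m') = γ m m'}

namespace Phi

open AdjoinRoot

variable {K : Type*} [Field K] (f : Phi K) {I : Type*} (k : I → ℕ)

/-- Multiplication by `t` on the sum of the `K[t] / (f ^ (k i))`. -/
noncomputable def mulRoot :
    (∀ i, AdjoinRoot (f.1 ^ k i)) →ₗ[K] ∀ i, AdjoinRoot (f.1 ^ k i) :=
  LinearMap.piMap fun _ => LinearMap.mulLeft K (root _)

variable {k} {N : ℕ}

/-- The canonical presentation of the sum of the `K[t] / (f ^ (k i))`. -/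
noncomputable def presentation (hk : ∀ i, k i ≤ N) (hN : 0 < N) {v : AdjoinRoot (f.1 ^ N)}
    (hv : IsUnit v) :
    (f.uniformized hN hv).Presentation k (∀ i, AdjoinRoot (f.1 ^ k i)) where
  map := LinearMap.pi fun i =>
    (algHomOfDvd K _ _ (pow_dvd_pow f.1 (hk i))).toLinearMap ∘ₗ LinearMap.proj i
  surj y := by
    choose x hx using fun i => algHomOfDvd_surjective (hd := pow_dvd_pow f.1 (hk i)) (y i)
    exact ⟨x, funext hx⟩
  ker x := by
    rw [funext_iff]
    refine forall_congr' fun i => ?_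
    obtain ⟨p, hp⟩ := mk_surjective (x i)
    change algHomOfDvd K _ _ (pow_dvd_pow f.1 (hk i)) (x i) = 0 ↔ _
    rw [← hp, algHomOfDvd_mk, mk_eq_zero, f.uniformized_pi_pow_dvd_iff hN hv (hk i)]

/-- The homomorphism `K[t] / (f ^ N) → K[t] / (f* ^ k)` that inverts `t`. -/
noncomputable def starHom {k : ℕ} (hk : k ≤ N) :
    AdjoinRoot (f.1 ^ N) →ₐ[K] AdjoinRoot (f.star.1 ^ k) :=
  invRootHom _ _ (f.star.coeff_zero_pow_ne_zero k)
    (f.star_pow_dvd_reverse_of_dvd (pow_dvd_pow f.1 hk))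

/-- The presentation of the sum of the `K[t] / (f* ^ (k i))` on which `t` acts by the inverse. -/
noncomputable def starPresentation (hk : ∀ i, k i ≤ N) (hN : 0 < N) {v : AdjoinRoot (f.1 ^ N)}
    (hv : IsUnit v) :
    (f.uniformized hN hv).Presentation k (∀ i, AdjoinRoot (f.star.1 ^ k i)) where
  map := LinearMap.pi fun i => (f.starHom (hk i)).toLinearMap ∘ₗ LinearMap.proj i
  surj y := by
    choose x hx using fun i => invRootHom_surjective (hh := f.star.coeff_zero_pow_ne_zero (k i))
      (hd := f.star_pow_dvd_reverse_of_dvd (pow_dvd_pow _ (hk i)))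
      (f.coeff_zero_pow_ne_zero N) (y i)
    exact ⟨x, funext hx⟩
  ker x := by
    rw [funext_iff]
    refine forall_congr' fun i => ?_
    obtain ⟨p, hp⟩ := mk_surjective (x i)
    change f.starHom (hk i) (x i) = 0 ↔ _
    rw [← hp, starHom, invRootHom_mk_eq_zero_iff, f.uniformized_pi_pow_dvd_iff hN hv (hk i),
      star_pow_dvd_reverse_iff]

theorem presentation_root_smul (hk : ∀ i, k i ≤ N) (hN : 0 < N) {v : AdjoinRoot (f.1 ^ N)}
    (hv : IsUnit v) (x : I → AdjoinRoot (f.1 ^ N)) :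
    (f.presentation hk hN hv).map (root (f.1 ^ N) • x) =
      f.mulRoot k ((f.presentation hk hN hv).map x) := by
  funext i
  change algHomOfDvd K _ _ (pow_dvd_pow f.1 (hk i)) (root (f.1 ^ N) * x i) =
    root _ * algHomOfDvd K _ _ (pow_dvd_pow f.1 (hk i)) (x i)
  rw [map_mul, algHomOfDvd_root]

theorem mulRoot_starPresentation (hk : ∀ i, k i ≤ N) (hN : 0 < N) {v : AdjoinRoot (f.1 ^ N)}
    (hv : IsUnit v) (x : I → AdjoinRoot (f.1 ^ N)) :
    f.star.mulRoot k ((f.starPresentation hk hN hv).map (root (f.1 ^ N) • x)) =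
      (f.starPresentation hk hN hv).map x := by
  funext i
  change root _ * f.starHom (hk i) (root (f.1 ^ N) * x i) = f.starHom (hk i) (x i)
  rw [map_mul, ← mul_assoc, starHom, root_mul_invRootHom_root, one_mul]

theorem algHom_eq_id (hdeg : f.deg = 1) (τ : AdjoinRoot f.1 →ₐ[K] AdjoinRoot f.1) :
    τ = AlgHom.id K _ :=
  AdjoinRoot.algHom_ext <| by
    rw [f.root_eq_algebraMap hdeg, AlgHom.commutes, AlgHom.commutes]

section Conjugation

variable {f} {τ : AdjoinRoot f.1 →ₐ[K] AdjoinRoot f.1} (hτ : root _ * τ (root _) = 1)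
include hτ

theorem conj_conj (c : AdjoinRoot f.1) : τ (τ c) = c := by
  have hcomp : τ.comp τ = AlgHom.id K _ := AdjoinRoot.algHom_ext <| by
    have hmap := congrArg τ hτ
    rw [map_mul, map_one] at hmap
    rw [AlgHom.comp_apply, AlgHom.id_apply]
    linear_combination (root f.1) * hmap - τ (τ (root f.1)) * hτ
  exact DFunLike.congr_fun hcomp c

/-- A root fixed by inversion is `1` or `-1`, hence rational. -/
theorem root_sub_conj_ne_zero (hdeg : f.deg ≠ 1) : root f.1 - τ (root f.1) ≠ 0 := by
  intro hfix
  have root_ne : ∀ c : K, root f.1 + algebraMap K _ c ≠ 0 := by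
    intro c hc
    rw [AdjoinRoot.algebraMap_eq, ← mk_X, ← mk_C, ← map_add, mk_eq_zero] at hc
    have hle := natDegree_le_of_dvd hc (X_add_C_ne_zero c)
    rw [natDegree_X_add_C] at hle
    exact hdeg (le_antisymm hle f.deg_pos)
  have hsq : (root f.1 + algebraMap K _ (-1)) * (root f.1 + algebraMap K _ 1) = 0 := by
    rw [map_neg, map_one]
    linear_combination root f.1 * hfix + hτ
  exact (mul_eq_zero.1 hsq).elim (root_ne _) (root_ne _)

omit hτ in
/-- The elements `c` with `τ c = ε * c`, for a sign `ε`. -/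
noncomputable def conjEigenspace (τ : AdjoinRoot f.1 →ₐ[K] AdjoinRoot f.1) (ε : K) :
    Submodule K (AdjoinRoot f.1) :=
  LinearMap.eqLocus LinearMap.id (ε • τ.toLinearMap)

omit hτ in
theorem mem_conjEigenspace {ε : K} {c : AdjoinRoot f.1} :
    c ∈ conjEigenspace τ ε ↔ c = algebraMap K _ ε * τ c := by
  rw [conjEigenspace, LinearMap.mem_eqLocus, LinearMap.smul_apply, Algebra.smul_def]
  rfl

theorem card_conjEigenspace_neg_one (hdeg : f.deg ≠ 1) :
    Nat.card (conjEigenspace τ 1) = Nat.card (conjEigenspace τ (-1)) := by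
  have hθ := root_sub_conj_ne_zero hτ hdeg
  refine Nat.card_congr ((Equiv.mulLeft₀ _ hθ).subtypeEquiv fun c => ?_)
  rw [mem_conjEigenspace, mem_conjEigenspace, Equiv.mulLeft₀_apply, map_mul, map_sub,
    conj_conj hτ, map_neg, map_one]
  constructor
  · intro h
    linear_combination (root f.1 - τ (root f.1)) * h
  · intro h
    refine mul_left_cancel₀ hθ ?_
    linear_combination h

/-- The splitting of an element into its symmetric and antisymmetric parts. -/
noncomputable def conjEigenspaceProdEquiv (h2 : (2 : K) ≠ 0) :
    AdjoinRoot f.1 ≃ conjEigenspace τ 1 × conjEigenspace τ (-1) where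
  toFun c := (⟨(2 : K)⁻¹ • (c + τ c), mem_conjEigenspace.2 (by
      rw [map_smul, map_add, conj_conj hτ, map_one, one_mul, add_comm])⟩,
    ⟨(2 : K)⁻¹ • (c - τ c), mem_conjEigenspace.2 (by
      rw [map_smul, map_sub, conj_conj hτ, map_neg, map_one, neg_one_mul, ← smul_neg, neg_sub])⟩)
  invFun x := x.1.1 + x.2.1
  left_inv c := by
    change (2 : K)⁻¹ • (c + τ c) + (2 : K)⁻¹ • (c - τ c) = c
    rw [← smul_add, add_add_sub_cancel, Uniformized.Involution.half_add_self h2]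
  right_inv x := by
    have hsymm := mem_conjEigenspace.1 x.1.2
    have hanti := mem_conjEigenspace.1 x.2.2
    rw [map_one, one_mul, eq_comm] at hsymm
    rw [map_neg, map_one, neg_one_mul, eq_comm, neg_eq_iff_eq_neg] at hanti
    refine Prod.ext (Subtype.ext ?_) (Subtype.ext ?_)
    · change (2 : K)⁻¹ • (x.1.1 + x.2.1 + τ (x.1.1 + x.2.1)) = x.1.1
      rw [map_add, hsymm, hanti, add_add_add_comm, add_neg_cancel, add_zero,
        Uniformized.Involution.half_add_self h2]
    · change (2 : K)⁻¹ • (x.1.1 + x.2.1 - τ (x.1.1 + x.2.1)) = x.2.1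
      rw [map_add, hsymm, hanti, add_sub_add_left_eq_sub, sub_neg_eq_add,
        Uniformized.Involution.half_add_self h2]

end Conjugation

theorem exists_pos_forall_le [Finite I] (k : I → ℕ) : ∃ N, 0 < N ∧ ∀ i, k i ≤ N := by
  obtain ⟨N, hN⟩ := Finite.bddAbove_range k
  exact ⟨N + 1, N.succ_pos, fun i => (hN ⟨i, rfl⟩).trans N.le_succ⟩

variable [Finite K] [Fintype I]

instance : Finite (AdjoinRoot f.1) := Module.finite_of_finite K

theorem card_matrix_det_ne_zero {F : Type*} [Field F] [Finite F] (ι : Type*) [Fintype ι]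
    [DecidableEq ι] :
    Nat.card {B : Matrix ι ι F // B.det ≠ 0} =
      ∏ i : Fin (Fintype.card ι), (Nat.card F ^ Fintype.card ι - Nat.card F ^ (i : ℕ)) := by
  have := Fintype.ofFinite F
  rw [Nat.card_eq_fintype_card (α := F), ← Matrix.card_GL_field]
  refine Nat.card_congr (((Matrix.reindex (Fintype.equivFin ι) (Fintype.equivFin ι)).subtypeEquiv
    (q := fun B => B.det ≠ 0) fun B => by rw [Matrix.det_reindex_self]).trans ?_)
  exact
    { toFun := fun B => Matrix.GeneralLinearGroup.mkOfDetNeZero B.1 B.2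
      invFun := fun B => ⟨B.1, (Matrix.isUnit_iff_isUnit_det B.1).1 B.isUnit |>.ne_zero⟩
      left_inv := fun B => rfl
      right_inv := fun B => Units.ext rfl }

theorem invPairingCount_mulRoot (hk : ∀ i, 0 < k i) :
    invPairingCount (f.mulRoot k) (f.star.mulRoot k) =
      (Nat.card K ^ f.deg) ^ (∑ i, ∑ j, Uniformized.subExp k i j) * ∏ a ∈ Finset.univ.image k,
        ∏ i : Fin (Fintype.card {i // k i = a}),
          ((Nat.card K ^ f.deg) ^ Fintype.card {i // k i = a} -
            (Nat.card K ^ f.deg) ^ (i : ℕ)) := by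
  classical
  obtain ⟨N, hN, hkN⟩ := exists_pos_forall_le k
  rw [invPairingCount, Uniformized.Presentation.card_separating_pairings
    (f.presentation hkN hN isUnit_one) (f.starPresentation hkN hN isUnit_one) hk hkN
    (isUnit_root_of_coeff_zero_ne_zero (f.coeff_zero_pow_ne_zero N)) adjoinRoot_eq_top
    (f.presentation_root_smul hkN hN isUnit_one) (f.mulRoot_starPresentation hkN hN isUnit_one),
    natCard_adjoinRoot]
  congr 1
  exact Finset.prod_congr rfl fun a _ => by rw [card_matrix_det_ne_zero, natCard_adjoinRoot]

theorem exists_invFormCount_mulRoot [LinearOrder I] (h2 : (2 : K) ≠ 0) (hf : f.star = f)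
    (hk : ∀ i, 0 < k i) :
    ∃ (τ : AdjoinRoot f.1 →ₐ[K] AdjoinRoot f.1) (δ : K), root _ * τ (root _) = 1 ∧
      (δ = 1 ∨ δ = -1) ∧ (f.deg = 1 → δ = -1) ∧
      ∀ s : ℕ → ℕ, (∀ b, Nat.card {c // c = algebraMap K _ (δ ^ b) * τ c} = s b) →
      (invFormCount (f.mulRoot k) : ℤ) =
        ((Nat.card K : ℤ) ^ f.deg) ^ (∑ i, ∑ j with j < i, Uniformized.subExp k i j) *
        (∏ i, ∏ b ∈ Finset.range (k i - 1), (s b : ℤ)) *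
        ∏ a ∈ Finset.univ.image k, nondegSeq (s (a - 1) : ℤ) ((Nat.card K : ℤ) ^ f.deg)
          (Fintype.card {i // k i = a}) := by
  obtain ⟨N, hN, hkN⟩ := exists_pos_forall_le k
  obtain ⟨v, hv, S, hσ, hτ, hδ, hlin⟩ := exists_involution hf hN h2
  refine ⟨S.τ, S.δ, hτ, hδ, hlin, fun s hs => ?_⟩
  have hfixed : ∀ b, Nat.card (S.signFixed b) = s b := hs
  rw [invFormCount, S.card_symmetric_forms (f.presentation hkN hN hv) h2 hk hkN hσ
    adjoinRoot_eq_top (f.presentation_root_smul hkN hN hv)]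
  push_cast
  simp only [S.signHermitianCount_eq_nondegSeq, hfixed, natCard_adjoinRoot, Nat.cast_pow]

theorem prod_range_ite_even (q : ℤ) (n : ℕ) :
    ∏ b ∈ Finset.range (n - 1), (if Even b then q else 1) = q ^ (n / 2) := by
  rcases n with _ | n
  · simp
  rw [Nat.add_sub_cancel]
  induction n with
  | zero => simp
  | succ n ih =>
    rw [Finset.prod_range_succ, ih]
    rcases Nat.even_or_odd n with h | h
    · rw [if_pos h, ← pow_succ]
      congr 1
      obtain ⟨m, rfl⟩ := h
      omega
    · rw [if_neg (Nat.not_even_iff_odd.2 h), mul_one]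
      congr 1
      obtain ⟨m, rfl⟩ := h
      omega

theorem card_eq_neg_one_pow_mul (h2 : (2 : K) ≠ 0) (hdeg : f.deg = 1) (b : ℕ) :
    Nat.card {c : AdjoinRoot f.1 // c = algebraMap K _ ((-1) ^ b) * c} =
      if Even b then Nat.card K else 1 := by
  split_ifs with hb
  · rw [hb.neg_one_pow, ← pow_one (Nat.card K), ← hdeg, ← natCard_adjoinRoot]
    exact Nat.card_congr (Equiv.subtypeUnivEquiv fun c => by rw [map_one, one_mul])
  · rw [(Nat.not_even_iff_odd.1 hb).neg_one_pow, Nat.card_eq_one_iff_unique]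
    have eq_zero : ∀ c : AdjoinRoot f.1, c = algebraMap K _ (-1) * c → c = 0 := by
      intro c hc
      rw [map_neg, map_one] at hc
      have htwo : (2 : K) • c = 0 := by rw [two_smul]; linear_combination hc
      exact (smul_eq_zero.1 htwo).resolve_left h2
    exact ⟨⟨fun x y => Subtype.ext ((eq_zero _ x.2).trans (eq_zero _ y.2).symm)⟩,
      ⟨⟨0, (mul_zero _).symm⟩⟩⟩

theorem invFormCount_mulRoot_linear [LinearOrder I] (h2 : (2 : K) ≠ 0) (hf : f.star = f)
    (hdeg : f.deg = 1) (hk : ∀ i, 0 < k i) :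
    (invFormCount (f.mulRoot k) : ℤ) =
      (Nat.card K : ℤ) ^ (∑ i, ∑ j with j < i, Uniformized.subExp k i j) *
      (∏ i, (Nat.card K : ℤ) ^ (k i / 2)) *
      ∏ a ∈ Finset.univ.image k, nondegSeq (if Odd a then (Nat.card K : ℤ) else 1) (Nat.card K : ℤ)
        (Fintype.card {i // k i = a}) := by
  obtain ⟨τ, δ, -, -, hδ, h⟩ := f.exists_invFormCount_mulRoot h2 hf hk
  rw [h (fun b => if Even b then Nat.card K else 1) fun b => by
    rw [hδ hdeg, f.algHom_eq_id hdeg τ]; exact f.card_eq_neg_one_pow_mul h2 hdeg b, hdeg, pow_one]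
  push_cast
  simp only [prod_range_ite_even]
  congr 1
  refine Finset.prod_congr rfl fun a ha => ?_
  obtain ⟨i, -, rfl⟩ := Finset.mem_image.1 ha
  have hparity : Even (k i - 1) ↔ Odd (k i) :=
    (Nat.even_sub' (hk i)).trans (iff_true_right odd_one)
  simp only [hparity]

section FixedCount

variable {f} {τ : AdjoinRoot f.1 →ₐ[K] AdjoinRoot f.1} (hτ : root _ * τ (root _) = 1)
include hτ

theorem exists_card_fixed (h2 : (2 : K) ≠ 0) (hdeg : f.deg ≠ 1) :
    ∃ d, f.deg = 2 * d ∧ ∀ ε : K, (ε = 1 ∨ ε = -1) →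
      Nat.card {c // c = algebraMap K _ ε * τ c} = Nat.card K ^ d := by
  have hcard := Nat.card_congr (conjEigenspaceProdEquiv hτ h2)
  have hrank := Module.natCard_eq_pow_finrank (K := K) (V := conjEigenspace τ 1)
  rw [Nat.card_prod, ← card_conjEigenspace_neg_one hτ hdeg, hrank, natCard_adjoinRoot,
    ← pow_add] at hcard
  refine ⟨Module.finrank K (conjEigenspace τ 1),
    (Nat.pow_right_injective Finite.one_lt_card hcard).trans (two_mul _).symm, ?_⟩
  simp only [← mem_conjEigenspace]
  rintro ε (rfl | rfl)
  · exact hrank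
  · exact (card_conjEigenspace_neg_one hτ hdeg).symm.trans hrank

end FixedCount

theorem even_deg_of_selfDual (h2 : (2 : K) ≠ 0) (hf : f.star = f) (hdeg : f.deg ≠ 1) :
    ∃ d, f.deg = 2 * d := by
  obtain ⟨v, hv, S, -, hτ, -⟩ := exists_involution hf (N := 1) one_pos h2
  obtain ⟨d, hd, -⟩ := exists_card_fixed hτ h2 hdeg
  exact ⟨d, hd⟩

theorem invFormCount_mulRoot_selfDual [LinearOrder I] (h2 : (2 : K) ≠ 0) (hf : f.star = f)
    {d : ℕ} (hd : f.deg = 2 * d) (hk : ∀ i, 0 < k i) :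
    (invFormCount (f.mulRoot k) : ℤ) =
      (((Nat.card K : ℤ) ^ d) ^ 2) ^ (∑ i, ∑ j with j < i, Uniformized.subExp k i j) *
      (∏ i, ((Nat.card K : ℤ) ^ d) ^ (k i - 1)) *
      ∏ a ∈ Finset.univ.image k, nondegSeq ((Nat.card K : ℤ) ^ d) (((Nat.card K : ℤ) ^ d) ^ 2)
        (Fintype.card {i // k i = a}) := by
  obtain ⟨τ, δ, hτ, hδ, -, h⟩ := f.exists_invFormCount_mulRoot h2 hf hk
  obtain ⟨d', hd', hcard⟩ := exists_card_fixed hτ h2 (by omega)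
  obtain rfl : d' = d := by omega
  rw [h (fun _ => Nat.card K ^ d'), hd, mul_comm 2 d', pow_mul]
  · push_cast
    simp only [Finset.prod_const, Finset.card_range]
  · intro b
    refine hcard _ ?_
    rcases hδ with rfl | rfl
    · exact Or.inl (one_pow b)
    · exact neg_one_pow_eq_or K b

end Phi

/-! ### Invariant forms on direct sums -/

section Pairings

variable {K V V' : Type*} [Field K] [AddCommGroup V] [Module K V] [AddCommGroup V'] [Module K V']

theorem pairing_aeval_apply {T : V →ₗ[K] V} {T' : V' →ₗ[K] V'} {γ : V →ₗ[K] V' →ₗ[K] K}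
    (hγ : ∀ m m', γ (T m) (T' m') = γ m m') (p : K[X]) (x : V) (y : V') :
    γ (aeval T p x) ((T' ^ p.natDegree) y) = γ x (aeval T' p.reverse y) := by
  have hpow : ∀ (i : ℕ) x y, γ ((T ^ i) x) ((T' ^ i) y) = γ x y := by
    intro i
    induction i with
    | zero => intro x y; rfl
    | succ i ih =>
      intro x y
      rw [pow_succ', pow_succ', Module.End.mul_apply, Module.End.mul_apply, hγ, ih]
  rw [aeval_eq_sum_range, aeval_eq_sum_range' (n := p.natDegree + 1)
    (Nat.lt_succ_of_le (reverse_natDegree_le p)), LinearMap.sum_apply, LinearMap.sum_apply,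
    map_sum, map_sum, LinearMap.sum_apply, ← Finset.sum_range_reflect]
  refine Finset.sum_congr rfl fun i hi => ?_
  have hi : i ≤ p.natDegree := Nat.lt_succ_iff.1 (Finset.mem_range.1 hi)
  have hsplit : p.natDegree = (p.natDegree - i) + i := (Nat.sub_add_cancel hi).symm
  rw [Nat.add_sub_cancel, coeff_reverse, revAt_le hi, LinearMap.smul_apply, LinearMap.smul_apply,
    map_smul, map_smul, LinearMap.smul_apply]
  congr 1
  conv_lhs => rw [hsplit, pow_add]
  rw [Module.End.mul_apply, Nat.add_sub_cancel, hpow]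

theorem pairing_eq_zero {T : V →ₗ[K] V} {T' : V' →ₗ[K] V'} {γ : V →ₗ[K] V' →ₗ[K] K}
    (hγ : ∀ m m', γ (T m) (T' m') = γ m m') {p q : K[X]} (hp : aeval T p = 0)
    (hq : aeval T' q = 0) (hpq : IsCoprime p.reverse q) (x : V) (y : V') : γ x y = 0 := by
  obtain ⟨u, v, huv⟩ := hpq
  have hy : y = aeval T' p.reverse (aeval T' u y) := by
    have hone := LinearMap.congr_fun (congrArg (aeval T') huv) y
    rw [map_add, map_mul, map_mul, hq, mul_zero, add_zero, map_one, Module.End.one_apply,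
      ← map_mul, mul_comm, map_mul, Module.End.mul_apply] at hone
    exact hone.symm
  rw [hy, ← pairing_aeval_apply hγ, hp, LinearMap.zero_apply, map_zero, LinearMap.zero_apply]

theorem invFormCount_congr {T : V →ₗ[K] V} {T' : V' →ₗ[K] V'} (e : V ≃ₗ[K] V')
    (he : ∀ x, e (T x) = T' (e x)) : invFormCount T = invFormCount T' := by
  refine (Nat.card_congr ((e.symm.arrowCongr (e.symm.arrowCongr (LinearEquiv.refl K K))).toEquiv
    |>.subtypeEquiv fun β => ?_)).symm
  refine and_congr ?_ (and_congr (LinearMap.separatingLeft_congr_iff _ _).symm ?_)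
  · exact e.symm.toEquiv.forall_congr fun x => e.symm.toEquiv.forall_congr fun y => by
      change _ ↔ β (e (e.symm x)) (e (e.symm y)) = β (e (e.symm y)) (e (e.symm x))
      rw [e.apply_symm_apply, e.apply_symm_apply]
  · exact e.symm.toEquiv.forall_congr fun x => e.symm.toEquiv.forall_congr fun y => by
      change _ ↔ β (e (T (e.symm x))) (e (T (e.symm y))) = β (e (e.symm x)) (e (e.symm y))
      rw [he, he, e.apply_symm_apply, e.apply_symm_apply]

theorem separatingRight_of_finrank_eq [FiniteDimensional K V] [FiniteDimensional K V']
    (hrank : Module.finrank K V = Module.finrank K V') {γ : V →ₗ[K] V' →ₗ[K] K}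
    (hγ : γ.SeparatingLeft) : γ.SeparatingRight := by
  intro m' hm'
  have hinj : Function.Injective γ :=
    LinearMap.ker_eq_bot.1 (LinearMap.separatingLeft_iff_ker_eq_bot.1 hγ)
  have hsurj := (LinearMap.injective_iff_surjective_of_finrank_eq_finrank
    (hrank.trans Subspace.dual_finrank_eq.symm)).1 hinj
  refine (Module.forall_dual_apply_eq_zero_iff K m').1 fun φ => ?_
  obtain ⟨m, rfl⟩ := hsurj φ
  exact hm' m

/-- The symmetric form on `V × V'` for which both factors are isotropic and `γ` is the pairing
between them. -/
def hyperbolicForm (γ : V →ₗ[K] V' →ₗ[K] K) : V × V' →ₗ[K] V × V' →ₗ[K] K :=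
  γ.compl₁₂ (LinearMap.fst K V V') (LinearMap.snd K V V') +
    γ.flip.compl₁₂ (LinearMap.snd K V V') (LinearMap.fst K V V')

theorem hyperbolicForm_apply (γ : V →ₗ[K] V' →ₗ[K] K) (m m' : V × V') :
    hyperbolicForm γ m m' = γ m.1 m'.2 + γ m'.1 m.2 := rfl

theorem hyperbolicForm_injective :
    Function.Injective (hyperbolicForm : (V →ₗ[K] V' →ₗ[K] K) → _) := by
  intro γ γ' h
  ext x y
  have hxy := LinearMap.congr_fun (LinearMap.congr_fun h (x, 0)) (0, y)
  simpa only [hyperbolicForm_apply, map_zero, add_zero] using hxy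

theorem separatingLeft_hyperbolicForm_iff [FiniteDimensional K V] [FiniteDimensional K V']
    (hrank : Module.finrank K V = Module.finrank K V') {γ : V →ₗ[K] V' →ₗ[K] K} :
    (hyperbolicForm γ).SeparatingLeft ↔ γ.SeparatingLeft := by
  refine ⟨fun h m hm => ?_, fun h m hm => ?_⟩
  · refine (Prod.mk.inj (h (m, 0) fun m' => ?_)).1
    rw [hyperbolicForm_apply, hm, map_zero, add_zero]
  · refine Prod.ext (h _ fun y => ?_) (separatingRight_of_finrank_eq hrank h _ fun x => ?_)
    · simpa only [hyperbolicForm_apply, map_zero, LinearMap.zero_apply, add_zero] using hm (0, y)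
    · simpa only [hyperbolicForm_apply, map_zero, zero_add] using hm (x, 0)

theorem hyperbolicForm_prodMap_iff {T : V →ₗ[K] V} {T' : V' →ₗ[K] V'} {γ : V →ₗ[K] V' →ₗ[K] K} :
    (∀ m m', hyperbolicForm γ (T.prodMap T' m) (T.prodMap T' m') = hyperbolicForm γ m m') ↔
      ∀ x y, γ (T x) (T' y) = γ x y := by
  refine ⟨fun h x y => ?_, fun h m m' => ?_⟩
  · simpa only [hyperbolicForm_apply, LinearMap.prodMap_apply, map_zero, add_zero]
      using h (x, 0) (0, y)
  · simp only [hyperbolicForm_apply, LinearMap.prodMap_apply, h]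

theorem exists_hyperbolicForm_eq {T : V →ₗ[K] V} {T' : V' →ₗ[K] V'}
    (hT : ∀ γ : V →ₗ[K] V →ₗ[K] K, (∀ m m', γ (T m) (T m') = γ m m') → γ = 0)
    (hT' : ∀ γ : V' →ₗ[K] V' →ₗ[K] K, (∀ m m', γ (T' m) (T' m') = γ m m') → γ = 0)
    {β : V × V' →ₗ[K] V × V' →ₗ[K] K} (hsymm : ∀ m m', β m m' = β m' m)
    (hβ : ∀ m m', β (T.prodMap T' m) (T.prodMap T' m') = β m m') :
    ∃ γ, hyperbolicForm γ = β := by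
  have hleft : β.compl₁₂ (LinearMap.inl K V V') (LinearMap.inl K V V') = 0 :=
    hT _ fun x y => by simpa using hβ (x, 0) (y, 0)
  have hright : β.compl₁₂ (LinearMap.inr K V V') (LinearMap.inr K V V') = 0 :=
    hT' _ fun x y => by simpa using hβ (0, x) (0, y)
  refine ⟨β.compl₁₂ (LinearMap.inl K V V') (LinearMap.inr K V V'), ?_⟩
  refine LinearMap.ext₂ fun ⟨x, y⟩ ⟨x', y'⟩ => ?_
  have hx : β (x, 0) (x', 0) = 0 := LinearMap.congr_fun₂ hleft x x'
  have hy : β (0, y) (0, y') = 0 := LinearMap.congr_fun₂ hright y y'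
  have hsplit : ∀ (x : V) (y : V'), (x, y) = (x, 0) + (0, y) := fun x y => by simp
  change β (x, 0) (0, y') + β (x', 0) (0, y) = β (x, y) (x', y')
  rw [hsplit x y, hsplit x' y', map_add β, LinearMap.add_apply, map_add, map_add, hx, hy,
    hsymm (0, y) (x', 0), zero_add, add_zero]

theorem invFormCount_prodMap [FiniteDimensional K V] [FiniteDimensional K V']
    (hrank : Module.finrank K V = Module.finrank K V') {T : V →ₗ[K] V} {T' : V' →ₗ[K] V'}
    (hT : ∀ γ : V →ₗ[K] V →ₗ[K] K, (∀ m m', γ (T m) (T m') = γ m m') → γ = 0)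
    (hT' : ∀ γ : V' →ₗ[K] V' →ₗ[K] K, (∀ m m', γ (T' m) (T' m') = γ m m') → γ = 0) :
    invFormCount (T.prodMap T') = invPairingCount T T' := by
  refine (Nat.card_congr (Equiv.ofBijective (fun γ => ⟨hyperbolicForm γ.1,
    fun m m' => add_comm _ _, (separatingLeft_hyperbolicForm_iff hrank).2 γ.2.1,
    hyperbolicForm_prodMap_iff.2 γ.2.2⟩) ⟨fun γ γ' h => ?_, fun β => ?_⟩)).symm
  · exact Subtype.ext (hyperbolicForm_injective (congrArg Subtype.val h))
  · obtain ⟨γ, hγ⟩ := exists_hyperbolicForm_eq hT hT' β.2.1 β.2.2.2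
    have hβ := β.2.2
    rw [← hγ, separatingLeft_hyperbolicForm_iff hrank, hyperbolicForm_prodMap_iff] at hβ
    exact ⟨⟨γ, hβ⟩, Subtype.ext hγ⟩

end Pairings

section Pi

variable {K ι : Type*} [Field K] {V : ι → Type*} [∀ i, AddCommGroup (V i)] [∀ i, Module K (V i)]

theorem piMap_single [DecidableEq ι] (T : ∀ i, V i →ₗ[K] V i) (i : ι) (x : V i) :
    LinearMap.piMap T (Pi.single i x) = Pi.single i (T i x) :=
  funext fun j => Pi.apply_single (fun i => T i) (fun _ => map_zero _) i x j

variable {Ω : Type*} (r : ι → Ω)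

variable (K V) in
/-- Restriction of vectors to a fibre. -/
def fiberRestrict (ω : Ω) : (∀ i, V i) →ₗ[K] ∀ i : {i // r i = ω}, V i where
  toFun x i := x i
  map_add' _ _ := rfl
  map_smul' _ _ := rfl

variable {r} in
theorem fiberRestrict_piMap (T : ∀ i, V i →ₗ[K] V i) {ω : Ω} (x : ∀ i, V i) :
    fiberRestrict K V r ω (LinearMap.piMap T x) =
      LinearMap.piMap (fun i : {i // r i = ω} => T i) (fiberRestrict K V r ω x) := rfl

variable [DecidableEq Ω]

variable (K V) in
/-- Extension by zero of vectors supported on a fibre. -/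
def fiberExtend (ω : Ω) : (∀ i : {i // r i = ω}, V i) →ₗ[K] ∀ i, V i where
  toFun x i := if h : r i = ω then x ⟨i, h⟩ else 0
  map_add' x y := by
    funext i
    by_cases h : r i = ω <;> simp [h]
  map_smul' c x := by
    funext i
    by_cases h : r i = ω <;> simp [h]

variable {r}

theorem fiberExtend_apply_of_eq {ω : Ω} (x : ∀ i : {i // r i = ω}, V i) {i : ι} (h : r i = ω) :
    fiberExtend K V r ω x i = x ⟨i, h⟩ := dif_pos h

theorem fiberExtend_apply_of_ne {ω : Ω} (x : ∀ i : {i // r i = ω}, V i) {i : ι} (h : r i ≠ ω) :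
    fiberExtend K V r ω x i = 0 := dif_neg h

theorem fiberRestrict_fiberExtend {ω : Ω} (x : ∀ i : {i // r i = ω}, V i) :
    fiberRestrict K V r ω (fiberExtend K V r ω x) = x :=
  funext fun i => fiberExtend_apply_of_eq (K := K) x i.2

theorem fiberRestrict_fiberExtend_of_ne {ω ω' : Ω} (h : ω ≠ ω') (x : ∀ i : {i // r i = ω}, V i) :
    fiberRestrict K V r ω' (fiberExtend K V r ω x) = 0 :=
  funext fun i => fiberExtend_apply_of_ne (K := K) x fun hi => h (hi.symm.trans i.2)

theorem fiberExtend_piMap (T : ∀ i, V i →ₗ[K] V i) {ω : Ω} (x : ∀ i : {i // r i = ω}, V i) :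
    fiberExtend K V r ω (LinearMap.piMap (fun i : {i // r i = ω} => T i) x) =
      LinearMap.piMap T (fiberExtend K V r ω x) := by
  funext i
  change _ = T i (fiberExtend K V r ω x i)
  by_cases h : r i = ω
  · rw [fiberExtend_apply_of_eq _ h, fiberExtend_apply_of_eq _ h]; rfl
  · rw [fiberExtend_apply_of_ne _ h, fiberExtend_apply_of_ne _ h, map_zero]

variable {T : ∀ i, V i →ₗ[K] V i} {β : (∀ i, V i) →ₗ[K] (∀ i, V i) →ₗ[K] K}

theorem apply_fiberExtend_eq_zero [Finite ι]
    (hT : ∀ i j, r i ≠ r j → ∀ γ : V i →ₗ[K] V j →ₗ[K] K,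
      (∀ m m', γ (T i m) (T j m') = γ m m') → γ = 0)
    (hβ : ∀ x y, β (LinearMap.piMap T x) (LinearMap.piMap T y) = β x y) {ω ω' : Ω} (hω : ω ≠ ω')
    (x : ∀ i : {i // r i = ω}, V i) (y : ∀ i : {i // r i = ω'}, V i) :
    β (fiberExtend K V r ω x) (fiberExtend K V r ω' y) = 0 := by
  classical
  have := Fintype.ofFinite ι
  rw [← Finset.univ_sum_single (fiberExtend K V r ω x),
    ← Finset.univ_sum_single (fiberExtend K V r ω' y), map_sum β, LinearMap.sum_apply]
  simp only [map_sum]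
  refine Finset.sum_eq_zero fun i _ => Finset.sum_eq_zero fun j _ => ?_
  by_cases hi : r i = ω
  · by_cases hj : r j = ω'
    · have hij := hT i j (hi.trans_ne (hω.trans_eq hj.symm))
        (β.compl₁₂ (LinearMap.single K V i) (LinearMap.single K V j)) fun m m' => by
          simp only [LinearMap.compl₁₂_apply, LinearMap.single_apply, ← piMap_single, hβ]
      exact LinearMap.congr_fun (LinearMap.congr_fun hij _) _
    · rw [fiberExtend_apply_of_ne _ hj, Pi.single_zero, map_zero]
  · rw [fiberExtend_apply_of_ne _ hi, Pi.single_zero, map_zero, LinearMap.zero_apply]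

variable [Fintype ι]

theorem sum_fiberExtend (x : ∀ i, V i) :
    ∑ ω : Finset.univ.image r, fiberExtend K V r ω.1 (fiberRestrict K V r ω.1 x) = x := by
  funext i
  rw [Finset.sum_apply, Finset.sum_eq_single ⟨r i, Finset.mem_image_of_mem r (Finset.mem_univ i)⟩]
  · exact fiberExtend_apply_of_eq _ rfl
  · intro ω _ hω
    exact fiberExtend_apply_of_ne _ fun h => hω (Subtype.ext h.symm)
  · intro h
    exact (h (Finset.mem_univ _)).elim

/-- The orthogonal sum of forms on the fibres. -/
def fiberSum (B : ∀ ω : Finset.univ.image r, (∀ i : {i // r i = ω.1}, V i) →ₗ[K]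
    (∀ i : {i // r i = ω.1}, V i) →ₗ[K] K) : (∀ i, V i) →ₗ[K] (∀ i, V i) →ₗ[K] K :=
  ∑ ω, (B ω).compl₁₂ (fiberRestrict K V r ω.1) (fiberRestrict K V r ω.1)

section FiberSum

variable {B : ∀ ω : Finset.univ.image r, (∀ i : {i // r i = ω.1}, V i) →ₗ[K]
  (∀ i : {i // r i = ω.1}, V i) →ₗ[K] K}

theorem fiberSum_apply (x y : ∀ i, V i) :
    fiberSum B x y = ∑ ω, B ω (fiberRestrict K V r ω.1 x) (fiberRestrict K V r ω.1 y) := by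
  simp only [fiberSum, LinearMap.sum_apply, LinearMap.compl₁₂_apply]

theorem fiberSum_apply_fiberExtend (x : ∀ i, V i) (ω : Finset.univ.image r)
    (y : ∀ i : {i // r i = ω.1}, V i) :
    fiberSum B x (fiberExtend K V r ω.1 y) = B ω (fiberRestrict K V r ω.1 x) y := by
  rw [fiberSum_apply, Fintype.sum_eq_single ω, fiberRestrict_fiberExtend]
  intro ω' hω'
  rw [fiberRestrict_fiberExtend_of_ne fun h => hω' (Subtype.ext h.symm), map_zero]

theorem fiberSum_injective :
    Function.Injective (fiberSum : (∀ ω : Finset.univ.image r, (∀ i : {i // r i = ω.1}, V i) →ₗ[K]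
      (∀ i : {i // r i = ω.1}, V i) →ₗ[K] K) → _) := by
  intro B B' h
  funext ω
  refine LinearMap.ext fun x => LinearMap.ext fun y => ?_
  rw [← fiberRestrict_fiberExtend (K := K) x, ← fiberSum_apply_fiberExtend, h,
    fiberSum_apply_fiberExtend]

theorem fiberSum_symmetric_iff :
    (∀ x y, fiberSum B x y = fiberSum B y x) ↔ ∀ ω x y, B ω x y = B ω y x := by
  refine ⟨fun h ω x y => ?_, fun h x y => ?_⟩
  · have hxy := h (fiberExtend K V r ω.1 x) (fiberExtend K V r ω.1 y)
    rwa [fiberSum_apply_fiberExtend, fiberSum_apply_fiberExtend, fiberRestrict_fiberExtend,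
      fiberRestrict_fiberExtend] at hxy
  · rw [fiberSum_apply, fiberSum_apply]
    exact Finset.sum_congr rfl fun ω _ => h ω _ _

theorem separatingLeft_fiberSum_iff :
    (fiberSum B).SeparatingLeft ↔ ∀ ω, (B ω).SeparatingLeft := by
  refine ⟨fun h ω x hx => ?_, fun h x hx => ?_⟩
  · have hzero : fiberExtend K V r ω.1 x = 0 := h _ fun y => ?_
    · rw [← fiberRestrict_fiberExtend (K := K) x, hzero, map_zero]
    rw [fiberSum_apply, Fintype.sum_eq_single ω, fiberRestrict_fiberExtend, hx]
    intro ω' hω'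
    rw [fiberRestrict_fiberExtend_of_ne fun h => hω' (Subtype.ext h.symm), map_zero,
      LinearMap.zero_apply]
  · rw [← sum_fiberExtend (K := K) (r := r) x]
    refine Finset.sum_eq_zero fun ω _ => ?_
    have hzero : fiberRestrict K V r ω.1 x = 0 := h ω _ fun y => by
      rw [← fiberSum_apply_fiberExtend, hx]
    rw [hzero, map_zero]

theorem fiberSum_piMap_iff {T : ∀ i, V i →ₗ[K] V i} :
    (∀ x y, fiberSum B (LinearMap.piMap T x) (LinearMap.piMap T y) = fiberSum B x y) ↔ ∀ ω x y,
      B ω (LinearMap.piMap (fun i : {i // r i = ω.1} => T i) x)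
        (LinearMap.piMap (fun i : {i // r i = ω.1} => T i) y) = B ω x y := by
  refine ⟨fun h ω x y => ?_, fun h x y => ?_⟩
  · have hxy := h (fiberExtend K V r ω.1 x) (fiberExtend K V r ω.1 y)
    rwa [← fiberExtend_piMap, ← fiberExtend_piMap, fiberSum_apply_fiberExtend,
      fiberSum_apply_fiberExtend, fiberRestrict_fiberExtend, fiberRestrict_fiberExtend] at hxy
  · rw [fiberSum_apply, fiberSum_apply]
    refine Finset.sum_congr rfl fun ω _ => ?_
    rw [fiberRestrict_piMap, fiberRestrict_piMap, h]

end FiberSum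

theorem exists_fiberSum_eq
    (hT : ∀ i j, r i ≠ r j → ∀ γ : V i →ₗ[K] V j →ₗ[K] K,
      (∀ m m', γ (T i m) (T j m') = γ m m') → γ = 0)
    (hβ : ∀ x y, β (LinearMap.piMap T x) (LinearMap.piMap T y) = β x y) :
    ∃ B, fiberSum (r := r) B = β := by
  refine ⟨fun ω => β.compl₁₂ (fiberExtend K V r ω.1) (fiberExtend K V r ω.1),
    LinearMap.ext fun x => LinearMap.ext fun y => ?_⟩
  conv_rhs => rw [← sum_fiberExtend (K := K) (r := r) x, map_sum, LinearMap.sum_apply]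
  rw [fiberSum_apply]
  refine Finset.sum_congr rfl fun ω _ => ?_
  conv_rhs => rw [← sum_fiberExtend (K := K) (r := r) y, map_sum]
  rw [Fintype.sum_eq_single ω, LinearMap.compl₁₂_apply]
  exact fun ω' hω' => apply_fiberExtend_eq_zero hT hβ (fun h => hω' (Subtype.ext h.symm)) _ _

theorem invFormCount_piMap (T : ∀ i, V i →ₗ[K] V i) (r : ι → Ω)
    (hT : ∀ i j, r i ≠ r j → ∀ γ : V i →ₗ[K] V j →ₗ[K] K,
      (∀ m m', γ (T i m) (T j m') = γ m m') → γ = 0) :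
    invFormCount (LinearMap.piMap T) = ∏ ω ∈ Finset.univ.image r,
      invFormCount (LinearMap.piMap fun i : {i // r i = ω} => T i) := by
  rw [← Finset.prod_coe_sort]
  unfold invFormCount
  rw [← Nat.card_pi]
  refine (Nat.card_congr (Equiv.ofBijective (fun B => ⟨fiberSum fun ω => (B ω).1,
    fiberSum_symmetric_iff.2 fun ω => (B ω).2.1, separatingLeft_fiberSum_iff.2 fun ω => (B ω).2.2.1,
    fiberSum_piMap_iff.2 fun ω => (B ω).2.2.2⟩) ⟨fun B B' h => ?_, fun β => ?_⟩)).symm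
  · have hB := fiberSum_injective (congrArg Subtype.val h)
    exact funext fun ω => Subtype.ext (congrFun hB ω)
  · obtain ⟨B, hB⟩ := exists_fiberSum_eq hT β.2.2.2
    have hβ := β.2
    rw [← hB, fiberSum_symmetric_iff, separatingLeft_fiberSum_iff, fiberSum_piMap_iff] at hβ
    exact ⟨fun ω => ⟨B ω, hβ.1 ω, hβ.2.1 ω, hβ.2.2 ω⟩, Subtype.ext hB⟩

end Pi

section Matrix

variable {K : Type*} [Field K]

theorem invFormCount_toLin' {n : ℕ} (A : Matrix (Fin n) (Fin n) K) :
    invFormCount (Matrix.toLin' A) = Nat.card {M : Matrix (Fin n) (Fin n) K //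
      M.transpose = M ∧ M.det ≠ 0 ∧ A.transpose * M * A = M} := by
  let e : Matrix (Fin n) (Fin n) K ≃ₗ[K] (Fin n → K) →ₗ[K] (Fin n → K) →ₗ[K] K :=
    Matrix.toLinearMap₂' K
  have he : ∀ M x y, e M x y = x ⬝ᵥ M.mulVec y := Matrix.toLinearMap₂'_apply'
  have hext : ∀ M M', M = M' ↔ ∀ x y, e M x y = e M' x y := fun M M' =>
    ⟨fun h x y => by rw [h], fun h => e.injective (LinearMap.ext₂ h)⟩
  refine (Nat.card_congr (e.toEquiv.subtypeEquiv fun M => ?_)).symm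
  refine and_congr ?_ (and_congr LinearMap.separatingLeft_toLinearMap₂'_iff_det_ne_zero.symm ?_)
  · rw [eq_comm, hext]
    refine forall₂_congr fun x y => ?_
    change _ ↔ e M x y = e M y x
    rw [he, he, he, Matrix.mulVec_transpose, dotProduct_comm x (Matrix.vecMul _ _),
      ← Matrix.dotProduct_mulVec]
  · rw [hext]
    refine forall₂_congr fun x y => ?_
    change _ ↔ e M (Matrix.toLin' A x) (Matrix.toLin' A y) = e M x y
    rw [he, he, he, Matrix.toLin'_apply, Matrix.toLin'_apply, ← Matrix.mulVec_mulVec,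
      ← Matrix.mulVec_mulVec, Matrix.dotProduct_mulVec, Matrix.vecMul_transpose]

theorem mul_mul_eq_iff_mul_inv_mul_eq {G : Type*} [Group G] (a b c : G) :
    a * b * c = b ↔ c * b⁻¹ * a = b⁻¹ := by
  rw [← inv_inj, mul_inv_rev, mul_inv_rev, inv_mul_eq_iff_eq_mul, mul_inv_eq_iff_eq_mul, eq_comm]

theorem transpose_mul_inv_mul_eq_iff {m : Type*} [Fintype m] [DecidableEq m] (A B : GL m K) :
    A.1.transpose * (B⁻¹ : GL m K).1 * A.1 = (B⁻¹ : GL m K).1 ↔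
      A.1 * B.1 * A.1.transpose = B.1 := by
  obtain ⟨C, hC⟩ : IsUnit A.1.transpose := (Matrix.isUnit_transpose _).2 A.isUnit
  rw [← hC]
  simp only [← Units.val_mul, Units.val_inj]
  exact (mul_mul_eq_iff_mul_inv_mul_eq A B C).symm

theorem transpose_inv_eq {m : Type*} [Fintype m] [DecidableEq m] {B : GL m K}
    (hB : B.1.transpose = B.1) : (B⁻¹ : GL m K).1.transpose = (B⁻¹ : GL m K).1 := by
  rw [Matrix.coe_units_inv, Matrix.transpose_nonsing_inv, hB]

/-- The Gram matrices of the forms preserved by `A` are the inverses of the matrices `B` with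
`A * B * Aᵀ = B`. -/
theorem formCount_eq_invFormCount {n : ℕ} (A : GL (Fin n) K) :
    formCount A = invFormCount (Matrix.toLin' (A : Matrix (Fin n) (Fin n) K)) := by
  rw [invFormCount_toLin', formCount]
  refine Nat.card_congr (Equiv.ofBijective (fun B => ⟨(B.1⁻¹ : GL (Fin n) K).1,
    transpose_inv_eq B.2.1, ((Matrix.isUnit_iff_isUnit_det _).1 B.1⁻¹.isUnit).ne_zero,
    (transpose_mul_inv_mul_eq_iff A B.1).2 B.2.2⟩) ⟨fun B B' h => ?_, fun M => ?_⟩)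
  · exact Subtype.ext (inv_injective (Units.ext (congrArg Subtype.val h)))
  · let B := (Matrix.GeneralLinearGroup.mkOfDetNeZero M.1 M.2.2.1)⁻¹
    have hB : (B⁻¹ : GL (Fin n) K).1 = M.1 := by rw [inv_inv]; rfl
    have hM := M.2
    rw [← hB, transpose_mul_inv_mul_eq_iff] at hM
    exact ⟨⟨B, by simpa only [inv_inv] using transpose_inv_eq hM.1, hM.2.2⟩, Subtype.ext hB⟩

end Matrix

/-! ### The modules of the conjugacy classes -/

theorem exists_equiv_of_map_univ_eq {α β γ : Type*} [Fintype α] [Fintype β] {f : α → γ} {g : β → γ}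
    (h : (Finset.univ : Finset α).val.map f = (Finset.univ : Finset β).val.map g) :
    ∃ e : α ≃ β, ∀ a, g (e a) = f a := by
  classical
  have hfiber : ∀ c, Nonempty ({a // f a = c} ≃ {b // g b = c}) := fun c => by
    refine ⟨Fintype.equivOfCardEq ?_⟩
    have hcount := congrArg (Multiset.count c) h
    rw [Multiset.count_map, Multiset.count_map] at hcount
    rw [Fintype.card_subtype, Fintype.card_subtype]
    simp only [eq_comm (a := c)] at hcount
    exact hcount
  exact ⟨Equiv.ofFiberEquiv fun c => (hfiber c).some, fun a => Equiv.ofFiberEquiv_map _ a⟩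

namespace IntPartition

/-- The number of parts. -/
abbrev length (lam : IntPartition) : ℕ := lam.sortedParts.length

/-- The `i`-th largest part. -/
def part (lam : IntPartition) (i : Fin lam.length) : ℕ := (lam.sortedParts.get i : ℕ)

theorem part_pos (lam : IntPartition) (i : Fin lam.length) : 0 < lam.part i := PNat.pos _

theorem coe_sortedParts (lam : IntPartition) : (lam.sortedParts : Multiset ℕ+) = lam :=
  Multiset.sort_eq _ _

theorem map_get_univ (lam : IntPartition) :
    (Finset.univ : Finset (Fin lam.length)).val.map (fun i => lam.sortedParts.get i) = lam := by
  rw [Fin.univ_val_map, List.ofFn_get, coe_sortedParts]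

theorem exists_equiv_toType (lam : IntPartition) :
    ∃ e : Fin lam.length ≃ lam.ToType, ∀ i, ((e i).1 : ℕ) = lam.part i := by
  obtain ⟨e, he⟩ := exists_equiv_of_map_univ_eq (f := fun i : Fin lam.length =>
    lam.sortedParts.get i) (g := fun x : lam.ToType => x.1) (by
      rw [map_get_univ, Multiset.map_univ_coe])
  exact ⟨e, fun i => congrArg _ (he i)⟩

theorem sum_part {M : Type*} [AddCommMonoid M] (lam : IntPartition) (g : ℕ → M) :
    ∑ i, g (lam.part i) = (lam.map fun d : ℕ+ => g d).sum := by
  conv_rhs => rw [← map_get_univ lam, Multiset.map_map]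
  rfl

theorem card_part_eq (lam : IntPartition) (d : ℕ+) :
    Fintype.card {i // lam.part i = d} = lam.count d := by
  conv_rhs => rw [← map_get_univ lam, Multiset.count_map]
  rw [Fintype.card_subtype, ← Finset.filter_val, Finset.card_val]
  refine congrArg _ (Finset.filter_congr fun i _ => ?_)
  rw [part, PNat.coe_inj, eq_comm]

end IntPartition

section Primary

open AdjoinRoot

variable {K : Type*} [Field K]

/-- The sum of the `K[t] / (f ^ k)` over the parts `k` of `lam`. -/
abbrev PrimaryModule (f : Phi K) (lam : IntPartition) : Type _ :=
  ∀ i, AdjoinRoot (f.1 ^ lam.part i)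

/-- Multiplication by `t` on `PrimaryModule f lam`. -/
noncomputable abbrev primaryEnd (f : Phi K) (lam : IntPartition) :
    PrimaryModule f lam →ₗ[K] PrimaryModule f lam := f.mulRoot lam.part

instance Phi.finiteDimensional_adjoinRoot_pow (f : Phi K) (k : ℕ) :
    FiniteDimensional K (AdjoinRoot (f.1 ^ k)) :=
  (AdjoinRoot.powerBasis (pow_ne_zero k f.2.2.1.ne_zero)).finite

theorem Phi.finrank_adjoinRoot_pow (f : Phi K) (k : ℕ) :
    Module.finrank K (AdjoinRoot (f.1 ^ k)) = k * f.deg := by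
  rw [(AdjoinRoot.powerBasis (pow_ne_zero k f.2.2.1.ne_zero)).finrank, AdjoinRoot.powerBasis_dim,
    natDegree_pow, deg]

theorem finrank_primaryModule_star (f : Phi K) (lam : IntPartition) :
    Module.finrank K (PrimaryModule f.star lam) = Module.finrank K (PrimaryModule f lam) := by
  simp only [Module.finrank_pi_fintype, Phi.finrank_adjoinRoot_pow, Phi.star_deg]

theorem map_aeval_of_intertwine {V W : Type*} [AddCommGroup V] [Module K V] [AddCommGroup W]
    [Module K W] {T : V →ₗ[K] V} {T' : W →ₗ[K] W} (φ : V →ₗ[K] W)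
    (h : ∀ x, φ (T x) = T' (φ x)) (p : K[X]) (x : V) : φ (aeval T p x) = aeval T' p (φ x) := by
  induction p using Polynomial.induction_on' with
  | add p q hp hq =>
    rw [map_add, map_add, LinearMap.add_apply, LinearMap.add_apply, map_add, hp, hq]
  | monomial n a =>
    have hpow : φ ((T ^ n) x) = (T' ^ n) (φ x) := by
      induction n with
      | zero => rfl
      | succ n ih => rw [pow_succ', pow_succ', Module.End.mul_apply, Module.End.mul_apply, h, ih]
    rw [aeval_monomial, aeval_monomial, Module.End.mul_apply, Module.End.mul_apply,
      Module.algebraMap_end_apply, Module.algebraMap_end_apply, map_smul, hpow]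

theorem aeval_piMap {ι : Type*} {V : ι → Type*} [∀ i, AddCommGroup (V i)] [∀ i, Module K (V i)]
    (T : ∀ i, V i →ₗ[K] V i) (p : K[X]) :
    aeval (LinearMap.piMap T) p = LinearMap.piMap fun i => aeval (T i) p :=
  LinearMap.ext fun x => funext fun i =>
    map_aeval_of_intertwine (T := LinearMap.piMap T) (LinearMap.proj i) (fun _ => rfl) p x

theorem Phi.aeval_mulRoot (f : Phi K) {I : Type*} (k : I → ℕ) (p : K[X]) :
    aeval (f.mulRoot k) p = LinearMap.piMap fun i => LinearMap.mulLeft K (mk (f.1 ^ k i) p) := by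
  refine (aeval_piMap _ p).trans (congrArg LinearMap.piMap (funext fun i => ?_))
  rw [← aeval_eq]
  exact aeval_algHom_apply (Algebra.lmul K (AdjoinRoot (f.1 ^ k i))) (root _) p

theorem exists_pow_aeval_primaryEnd (f : Phi K) (lam : IntPartition) :
    ∃ N, aeval (primaryEnd f lam) (f.1 ^ N) = 0 := by
  obtain ⟨N, -, hN⟩ := Phi.exists_pos_forall_le lam.part
  refine ⟨N, LinearMap.ext fun x => funext fun i => ?_⟩
  rw [Phi.aeval_mulRoot]
  change mk _ (f.1 ^ N) * x i = 0
  rw [mk_eq_zero.2 (pow_dvd_pow _ (hN i)), zero_mul]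

theorem Phi.isCoprime_of_ne {f g : Phi K} (h : f ≠ g) : IsCoprime f.1 g.1 := by
  rw [f.2.2.1.coprime_iff_not_dvd]
  exact fun hd => h (Subtype.ext (eq_of_monic_of_associated f.2.1 g.2.1
    (f.2.2.1.associated_of_dvd g.2.2.1 hd)))

theorem primary_pairing_eq_zero {f g : Phi K} (h : f.star ≠ g) {lam nu : IntPartition}
    {γ : PrimaryModule f lam →ₗ[K] PrimaryModule g nu →ₗ[K] K}
    (hγ : ∀ m m', γ (primaryEnd f lam m) (primaryEnd g nu m') = γ m m') : γ = 0 := by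
  obtain ⟨N, hN⟩ := exists_pow_aeval_primaryEnd f lam
  obtain ⟨N', hN'⟩ := exists_pow_aeval_primaryEnd g nu
  refine LinearMap.ext fun x => LinearMap.ext fun y => pairing_eq_zero hγ hN hN' ?_ x y
  rw [reverse_pow_of_noZeroDivisors, Phi.reverse_eq]
  exact .pow ((isCoprime_mul_unit_left_left (isUnit_C.2 (isUnit_iff_ne_zero.2 f.2.2.2)) _ _).2
    (Phi.isCoprime_of_ne h))

variable (μ : Phi K →₀ IntPartition)

/-- The product over the support of the primary components. -/
abbrev SupportModule : Type _ := ∀ f : μ.support, PrimaryModule f.1 (μ f.1)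

/-- Multiplication by `t` on `SupportModule μ`. -/
noncomputable abbrev supportEnd : SupportModule μ →ₗ[K] SupportModule μ :=
  LinearMap.piMap fun f : μ.support => primaryEnd f.1 (μ f.1)

/-- A direct sum whose components vanish outside a finite set, as the product over this set. -/
noncomputable def directSumEquivPi (R : Type*) [Semiring R] {ι : Type*} {M : ι → Type*}
    [∀ i, AddCommMonoid (M i)] [∀ i, Module R (M i)] (s : Finset ι)
    (hs : ∀ i ∉ s, Subsingleton (M i)) : (⨁ i, M i) ≃ₗ[R] ∀ i : s, M i :=
  LinearEquiv.ofBijective (LinearMap.pi fun i : s => DirectSum.component R ι M i) (by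
    classical
    refine ⟨fun x y h => DFinsupp.ext fun i => ?_, fun y => ⟨DFinsupp.mk s y, funext fun i =>
      DFinsupp.mk_of_mem i.2⟩⟩
    by_cases hi : i ∈ s
    · exact congrFun h ⟨i, hi⟩
    · exact (hs i hi).elim _ _)

/-- The `f`-primary component of the module defining `conjClass`, which is indexed by
`lam.ToType`, reindexed by the sorted parts of `lam`. -/
noncomputable def primaryEquiv (f : Phi K) (lam : IntPartition) :
    (⨁ i : lam.ToType, K[X] ⧸ Ideal.span {f.1 ^ (i.1 : ℕ)}) ≃ₗ[K[X]]
      ∀ i, K[X] ⧸ Ideal.span {f.1 ^ lam.part i} :=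
  haveI := Classical.decEq lam.ToType
  DirectSum.linearEquivFunOnFintype K[X] _ _ ≪≫ₗ
    (LinearEquiv.piCongrLeft K[X] _ lam.exists_equiv_toType.choose).symm ≪≫ₗ
    LinearEquiv.piCongrRight fun i => Submodule.quotEquivOfEq _ _ (by
      rw [lam.exists_equiv_toType.choose_spec])

theorem subsingleton_directSum_toType {lam : IntPartition} (h : lam = 0)
    (M : lam.ToType → Type*) [∀ i, AddCommMonoid (M i)] : Subsingleton (⨁ i, M i) := by
  subst h
  exact ⟨fun _ _ => DFinsupp.ext isEmptyElim⟩

theorem exists_equiv_supportModule {n : ℕ} {A : GL (Fin n) K} (hA : A ∈ conjClass n μ) :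
    ∃ e : (Fin n → K) ≃ₗ[K] SupportModule μ,
      ∀ x, e (Matrix.toLin' (A : Matrix (Fin n) (Fin n) K) x) = supportEnd μ (e x) := by
  obtain ⟨e⟩ := hA
  let φ := e ≪≫ₗ directSumEquivPi K[X] μ.support (fun f hf =>
    subsingleton_directSum_toType (Finsupp.notMem_support_iff.1 hf) _) ≪≫ₗ
      LinearEquiv.piCongrRight fun f => primaryEquiv f.1 (μ f.1)
  refine ⟨Module.AEval'.of _ ≪≫ₗ φ.restrictScalars K, fun x => ?_⟩
  have hX : φ (Module.AEval'.of _ (Matrix.toLin' A.1 x)) =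
      (X : K[X]) • φ (Module.AEval'.of _ x) := by
    rw [← Module.AEval'.X_smul_of, map_smul]
  exact hX.trans <| funext fun f => funext fun i => Algebra.smul_def
    (A := K[X] ⧸ Ideal.span {f.1.1 ^ (μ f.1).part i}) (X : K[X]) (φ (Module.AEval'.of _ x) f i)

theorem formCount_eq_supportEnd {n : ℕ} {A : GL (Fin n) K} (hA : A ∈ conjClass n μ) :
    formCount A = invFormCount (supportEnd μ) := by
  obtain ⟨e, he⟩ := exists_equiv_supportModule μ hA
  rw [formCount_eq_invFormCount, invFormCount_congr e he]

/-- The orbit `{f, f*}`. -/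
noncomputable def Phi.orbit (f : Phi K) : Sym2 (Phi K) := s(f, f.star)

theorem Phi.orbit_eq_iff {f g : Phi K} : f.orbit = g.orbit ↔ f = g ∨ f = g.star := by
  rw [orbit, orbit, Sym2.eq_iff]
  constructor
  · rintro (⟨h, -⟩ | ⟨h, -⟩)
    · exact Or.inl h
    · exact Or.inr h
  · rintro (rfl | rfl)
    · exact Or.inl ⟨rfl, rfl⟩
    · exact Or.inr ⟨rfl, Phi.star_star g⟩

theorem invFormCount_supportEnd [DecidableEq (Sym2 (Phi K))] :
    invFormCount (supportEnd μ) = ∏ ω ∈ Finset.univ.image (fun f : μ.support => f.1.orbit),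
      invFormCount (LinearMap.piMap fun f : {f : μ.support // f.1.orbit = ω} =>
        primaryEnd f.1.1 (μ f.1.1)) := by
  refine invFormCount_piMap _ _ fun f g hfg γ hγ =>
    primary_pairing_eq_zero (fun h => hfg (Phi.orbit_eq_iff.2 (Or.inr ?_))) hγ
  rw [← h, Phi.star_star]

theorem invFormCount_orbit_selfDual {f : Phi K} (hf : f.star = f) (hμ : f ∈ μ.support) :
    invFormCount (LinearMap.piMap fun g : {g : μ.support // g.1.orbit = f.orbit} =>
      primaryEnd g.1.1 (μ g.1.1)) = invFormCount (primaryEnd f (μ f)) := by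
  have huniq : ∀ g : {g : μ.support // g.1.orbit = f.orbit}, g = ⟨⟨f, hμ⟩, rfl⟩ := by
    rintro ⟨⟨g, hg⟩, h⟩
    have : g = f := by simpa only [hf, or_self] using Phi.orbit_eq_iff.1 h
    subst this
    rfl
  let _ : Unique {g : μ.support // g.1.orbit = f.orbit} := ⟨⟨⟨⟨f, hμ⟩, rfl⟩⟩, huniq⟩
  exact invFormCount_congr (LinearEquiv.piUnique K
    fun g : {g : μ.support // g.1.orbit = f.orbit} => PrimaryModule g.1.1 (μ g.1.1)) fun x => rfl

/-- A product over a two-element index type, as a product of two factors. -/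
def piEquivProdOfTwo {ι : Type*} [DecidableEq ι] {V : ι → Type*} [∀ i, AddCommGroup (V i)]
    [∀ i, Module K (V i)] {a b : ι} (hab : a ≠ b) (hcases : ∀ i, i = a ∨ i = b) :
    (∀ i, V i) ≃ₗ[K] V a × V b :=
  LinearEquiv.ofLinearMap ((LinearMap.proj a).prod (LinearMap.proj b))
    ((LinearMap.single K V a).coprod (LinearMap.single K V b))
    (by ext <;> simp [hab, hab.symm])
    (by
      refine LinearMap.ext fun x => funext fun i => ?_
      rcases hcases i with rfl | rfl <;> simp [hab, hab.symm])

theorem invFormCount_orbit_pair (hsymm : IsSymmetricMap μ) {f : Phi K}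
    (hf : f.star ≠ f) (hμ : f ∈ μ.support) :
    invFormCount (LinearMap.piMap fun g : {g : μ.support // g.1.orbit = f.orbit} =>
      primaryEnd g.1.1 (μ g.1.1)) =
      invPairingCount (f.mulRoot (μ f).part) (f.star.mulRoot (μ f).part) := by
  classical
  have hμ' : f.star ∈ μ.support := by
    rw [Finsupp.mem_support_iff, ← hsymm f]
    exact Finsupp.mem_support_iff.1 hμ
  let a : {g : μ.support // g.1.orbit = f.orbit} := ⟨⟨f, hμ⟩, rfl⟩
  let b : {g : μ.support // g.1.orbit = f.orbit} :=
    ⟨⟨f.star, hμ'⟩, Phi.orbit_eq_iff.2 (Or.inr rfl)⟩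
  have hab : a ≠ b := fun h => hf (congrArg (fun g => g.1.1) h).symm
  have hcases : ∀ g, g = a ∨ g = b := by
    rintro ⟨⟨g, hg⟩, h⟩
    exact (Phi.orbit_eq_iff.1 h).imp (fun h => Subtype.ext (Subtype.ext h))
      fun h => Subtype.ext (Subtype.ext h)
  rw [invFormCount_congr (T' := (primaryEnd f (μ f)).prodMap (primaryEnd f.star (μ f.star)))
    (piEquivProdOfTwo hab hcases) fun x => rfl, ← hsymm f]
  refine invFormCount_prodMap (finrank_primaryModule_star f (μ f)).symm
    (fun γ hγ => primary_pairing_eq_zero hf hγ) fun γ hγ => primary_pairing_eq_zero ?_ hγ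
  rw [Phi.star_star]
  exact hf.symm

end Primary

/-! ### Vanishing for maps that are not symmetric -/

theorem finrank_ker_aeval_reverse {K V : Type*} [Field K] [AddCommGroup V] [Module K V]
    [FiniteDimensional K V] {T : V →ₗ[K] V} {β : V →ₗ[K] V →ₗ[K] K}
    (hsymm : ∀ m m', β m m' = β m' m) (hsep : β.SeparatingLeft)
    (hT : ∀ m m', β (T m) (T m') = β m m') (p : K[X]) :
    Module.finrank K (LinearMap.ker (aeval T p)) =
      Module.finrank K (LinearMap.ker (aeval T p.reverse)) := by
  have hinj : Function.Injective T := by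
    rw [← LinearMap.ker_eq_bot, LinearMap.ker_eq_bot']
    intro m hm
    refine hsep m fun m' => ?_
    rw [← hT, hm, map_zero, LinearMap.zero_apply]
  have hsurj : Function.Surjective (T ^ p.natDegree) := by
    rw [Module.End.coe_pow]
    exact (LinearMap.surjective_of_injective hinj).iterate _
  have hnd : LinearMap.BilinForm.Nondegenerate β :=
    ⟨hsep, fun m h => hsep m fun m' => by rw [hsymm, h]⟩
  have hker : LinearMap.ker (aeval T p) =
      LinearMap.BilinForm.orthogonal β (LinearMap.range (aeval T p.reverse)) := by
    ext x
    rw [LinearMap.mem_ker, LinearMap.BilinForm.mem_orthogonal_iff]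
    constructor
    · rintro h _ ⟨y, rfl⟩
      change β _ x = 0
      rw [hsymm, ← pairing_aeval_apply hT, h, map_zero, LinearMap.zero_apply]
    · intro h
      refine hsep _ fun y => ?_
      obtain ⟨z, rfl⟩ := hsurj y
      rw [pairing_aeval_apply hT, hsymm]
      exact h _ ⟨z, rfl⟩
  rw [hker, LinearMap.BilinForm.finrank_orthogonal hnd]
  have := LinearMap.finrank_range_add_finrank_ker (aeval T p.reverse)
  omega

namespace IntPartition

/-- The sum of the parts, truncated at `m`. -/
def truncWeight (lam : IntPartition) (m : ℕ) : ℕ := (lam.map fun d : ℕ+ => min (d : ℕ) m).sum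

theorem two_mul_truncWeight (lam : IntPartition) (d : ℕ+) :
    2 * lam.truncWeight d = lam.truncWeight (d - 1) + lam.truncWeight (d + 1) + lam.count d := by
  have hd := d.pos
  induction lam using Multiset.induction with
  | empty => rfl
  | cons a s ih =>
    simp only [truncWeight, Multiset.map_cons, Multiset.sum_cons, Multiset.count_cons] at ih ⊢
    have ha : d = a ↔ (d : ℕ) = a := PNat.coe_inj.symm
    split_ifs with h
    · rw [ha] at h
      omega
    · rw [ha] at h
      omega

theorem eq_of_truncWeight_eq {lam nu : IntPartition}
    (h : ∀ m, lam.truncWeight m = nu.truncWeight m) : lam = nu := by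
  ext d
  have hlam := lam.two_mul_truncWeight d
  have hnu := nu.two_mul_truncWeight d
  rw [h, h, h] at hlam
  omega

end IntPartition

section Asymmetric

open AdjoinRoot

variable {K : Type*} [Field K]

theorem finrank_ker_piMap {ι : Type*} [Fintype ι] {V : ι → Type*} [∀ i, AddCommGroup (V i)]
    [∀ i, Module K (V i)] [∀ i, FiniteDimensional K (V i)] (T : ∀ i, V i →ₗ[K] V i) :
    Module.finrank K (LinearMap.ker (LinearMap.piMap T)) =
      ∑ i, Module.finrank K (LinearMap.ker (T i)) := by
  rw [← Module.finrank_pi_fintype]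
  exact LinearEquiv.finrank_eq
    { toFun := fun x i => ⟨x.1 i, congrFun x.2 i⟩
      invFun := fun x => ⟨fun i => x i, funext fun i => (x i).2⟩
      map_add' := fun _ _ => rfl
      map_smul' := fun _ _ => rfl }

namespace Phi

theorem mk_pow_mul_eq_zero_iff (f : Phi K) {k m : ℕ} {y : AdjoinRoot (f.1 ^ k)} :
    mk _ (f.1 ^ m) * y = 0 ↔ algHomOfDvd K _ _ (pow_dvd_pow f.1 (Nat.sub_le k m)) y = 0 := by
  obtain ⟨r, rfl⟩ := mk_surjective y
  rw [algHomOfDvd_mk, ← map_mul, mk_eq_zero, mk_eq_zero]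
  rcases le_total k m with h | h
  · rw [Nat.sub_eq_zero_of_le h, pow_zero]
    exact ⟨fun _ => one_dvd _, fun _ => (pow_dvd_pow _ h).mul_right _⟩
  · conv_lhs => rw [← Nat.add_sub_of_le h, pow_add]
    exact mul_dvd_mul_iff_left (pow_ne_zero _ f.2.2.1.ne_zero)

theorem finrank_ker_mulLeft_pow (f : Phi K) (k m : ℕ) :
    Module.finrank K (LinearMap.ker (LinearMap.mulLeft K (mk (f.1 ^ k) (f.1 ^ m)))) =
      min k m * f.deg := by
  have hdvd := pow_dvd_pow f.1 (Nat.sub_le k m)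
  let φ := (algHomOfDvd K _ _ hdvd).toLinearMap
  have hker : LinearMap.ker (LinearMap.mulLeft K (mk (f.1 ^ k) (f.1 ^ m))) = LinearMap.ker φ :=
    SetLike.ext fun y => f.mk_pow_mul_eq_zero_iff
  have hdim := LinearMap.finrank_range_add_finrank_ker φ
  rw [LinearMap.range_eq_top.2 (algHomOfDvd_surjective (hd := hdvd)), finrank_top,
    finrank_adjoinRoot_pow, finrank_adjoinRoot_pow] at hdim
  rw [hker, ← Nat.sub_sub_eq_min, Nat.sub_mul, ← hdim, Nat.add_sub_cancel_left]

theorem finrank_ker_mulLeft_pow_of_ne {f g : Phi K} (h : f ≠ g) (k m : ℕ) :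
    Module.finrank K (LinearMap.ker (LinearMap.mulLeft K (mk (g.1 ^ k) (f.1 ^ m)))) = 0 := by
  obtain ⟨u, v, huv⟩ := (isCoprime_of_ne h).pow (m := m) (n := k)
  have hunit : mk (g.1 ^ k) u * mk (g.1 ^ k) (f.1 ^ m) = 1 := by
    simpa only [map_add, map_mul, mk_self, mul_zero, add_zero, map_one]
      using congrArg (mk (g.1 ^ k)) huv
  rw [Submodule.finrank_eq_zero, LinearMap.ker_eq_bot']
  intro y hy
  rw [← one_mul y, ← hunit, mul_assoc]
  exact mul_eq_zero_of_right _ hy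

end Phi

theorem finrank_ker_aeval_primaryEnd (f : Phi K) (lam : IntPartition) (m : ℕ) :
    Module.finrank K (LinearMap.ker (aeval (primaryEnd f lam) (f.1 ^ m))) =
      lam.truncWeight m * f.deg := by
  rw [Phi.aeval_mulRoot, finrank_ker_piMap]
  simp only [Phi.finrank_ker_mulLeft_pow]
  rw [← Finset.sum_mul, IntPartition.sum_part _ fun d => min d m, IntPartition.truncWeight]

theorem finrank_ker_aeval_primaryEnd_of_ne {f g : Phi K} (h : f ≠ g) (lam : IntPartition) (m : ℕ) :
    Module.finrank K (LinearMap.ker (aeval (primaryEnd g lam) (f.1 ^ m))) = 0 := by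
  rw [Phi.aeval_mulRoot, finrank_ker_piMap]
  exact Finset.sum_eq_zero fun i _ => Phi.finrank_ker_mulLeft_pow_of_ne h _ _

variable (μ : Phi K →₀ IntPartition)

theorem finrank_ker_aeval_supportEnd (f : Phi K) (m : ℕ) :
    Module.finrank K (LinearMap.ker (aeval (supportEnd μ) (f.1 ^ m))) =
      (μ f).truncWeight m * f.deg := by
  classical
  rw [aeval_piMap, finrank_ker_piMap]
  by_cases hf : f ∈ μ.support
  · rw [Fintype.sum_eq_single ⟨f, hf⟩, finrank_ker_aeval_primaryEnd]
    exact fun g hg => finrank_ker_aeval_primaryEnd_of_ne (fun h => hg (Subtype.ext h.symm)) _ _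
  · rw [Finset.sum_eq_zero fun g _ => finrank_ker_aeval_primaryEnd_of_ne
      (ne_of_mem_of_not_mem g.2 hf).symm _ _, Finsupp.notMem_support_iff.1 hf]
    exact (zero_mul _).symm

/-- An invariant form makes the kernels of `f (T) ^ m` and `f* (T) ^ m` equidimensional, and the
dimensions of the former for all `m` determine `μ f`. -/
theorem invFormCount_eq_zero_of_not_symmetric (hμ : ¬ IsSymmetricMap μ) :
    invFormCount (supportEnd μ) = 0 := by
  by_contra hne
  obtain ⟨⟨β, hsymm, hsep, hT⟩⟩ := (Nat.card_ne_zero.1 hne).1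
  refine hμ fun f => IntPartition.eq_of_truncWeight_eq fun m => ?_
  have hstar : LinearMap.ker (aeval (supportEnd μ) (f.1 ^ m).reverse) =
      LinearMap.ker (aeval (supportEnd μ) (f.star.1 ^ m)) := by
    rw [reverse_pow_of_noZeroDivisors, Phi.reverse_eq, mul_pow, ← C_pow]
    ext x
    rw [LinearMap.mem_ker, LinearMap.mem_ker, map_mul, aeval_C, Module.End.mul_apply,
      Module.algebraMap_end_apply, smul_eq_zero, or_iff_right (pow_ne_zero _ f.2.2.2)]
  have hfinrank := finrank_ker_aeval_reverse hsymm hsep hT (f.1 ^ m)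
  rw [hstar, finrank_ker_aeval_supportEnd, finrank_ker_aeval_supportEnd, Phi.star_deg] at hfinrank
  exact Nat.eq_of_mul_eq_mul_right f.deg_pos hfinrank

end Asymmetric

/-! ### The polynomials of the primary components -/

section Sums

variable {I : Type*} [Fintype I]

theorem sum_sum_eq_of_symm [LinearOrder I] (g : I → I → ℕ) (hg : ∀ i j, g i j = g j i) :
    ∑ i, ∑ j, g i j = 2 * (∑ i, ∑ j with j < i, g i j) + ∑ i, g i i := by
  have hrow (i : I) :
      ∑ j, g i j = ∑ j with j < i, g i j + (∑ j with i < j, g i j) + g i i := by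
    rw [Finset.sum_filter, Finset.sum_filter, ← Finset.sum_add_distrib,
      ← (Finset.sum_ite_eq' Finset.univ i (g i)).trans (if_pos (Finset.mem_univ i)),
      ← Finset.sum_add_distrib]
    refine Finset.sum_congr rfl fun j _ => ?_
    rcases lt_trichotomy j i with h | h | h
    · simp [h, h.not_gt, h.ne]
    · simp [h]
    · simp [h, h.not_gt, h.ne']
  have hupper : ∑ i, ∑ j with i < j, g i j = ∑ i, ∑ j with j < i, g i j := by
    simp only [Finset.sum_filter]
    rw [Finset.sum_comm]
    simp only [hg]
  simp only [hrow, Finset.sum_add_distrib]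
  rw [hupper, two_mul]

theorem sum_image_card_mul {M : Type*} [CommSemiring M] (k : I → ℕ) (g : ℕ → M) :
    ∑ a ∈ Finset.univ.image k, (Fintype.card {i // k i = a} : M) * g a = ∑ i, g (k i) := by
  rw [Finset.sum_comp]
  refine Finset.sum_congr rfl fun a _ => ?_
  rw [Fintype.card_subtype, nsmul_eq_mul]

theorem sum_image_card_sq [LinearOrder I] (k : I → ℕ) :
    ∑ a ∈ Finset.univ.image k, Fintype.card {i // k i = a} * Fintype.card {i // k i = a} =
      2 * (∑ i, ∑ j with j < i, if k i = k j then 1 else 0) + Fintype.card I := by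
  have hcard (i : I) : Fintype.card {j // k j = k i} = ∑ j, if k i = k j then 1 else 0 := by
    rw [Fintype.card_subtype, Finset.card_filter]
    simp only [eq_comm]
  calc ∑ a ∈ Finset.univ.image k, Fintype.card {i // k i = a} * Fintype.card {i // k i = a}
      = ∑ i, Fintype.card {j // k j = k i} :=
        sum_image_card_mul k fun a => Fintype.card {i // k i = a}
    _ = ∑ i, ∑ j, if k i = k j then 1 else 0 := Finset.sum_congr rfl fun i _ => hcard i
    _ = _ := by
        rw [sum_sum_eq_of_symm _ fun i j => by simp only [eq_comm]]
        simp only [if_true, Finset.sum_const, Finset.card_univ, smul_eq_mul, mul_one]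

theorem sum_subExp [LinearOrder I] (k : I → ℕ) :
    ∑ i, ∑ j, Uniformized.subExp k i j =
      2 * (∑ i, ∑ j with j < i, Uniformized.subExp k i j) + ∑ i, (k i - 1) := by
  rw [sum_sum_eq_of_symm _ fun i j => Uniformized.subExp_comm i j]
  simp only [Uniformized.subExp_of_eq]

theorem sum_subExp_add {n : ℕ} {k : Fin n → ℕ} (hk : ∀ i, 0 < k i) (hanti : Antitone k) :
    (∑ i, ∑ j with j < i, Uniformized.subExp k i j) +
      (∑ i, ∑ j with j < i, if k i = k j then 1 else 0) = ∑ i : Fin n, (i : ℕ) * k i := by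
  rw [← Finset.sum_add_distrib]
  refine Finset.sum_congr rfl fun i _ => ?_
  rw [← Finset.sum_add_distrib]
  have hterm : ∀ j ∈ Finset.univ.filter (· < i),
      (Uniformized.subExp k i j + if k i = k j then 1 else 0) = k i := by
    intro j hj
    have hle := hanti (Finset.mem_filter.1 hj).2.le
    have hpos := hk i
    unfold Uniformized.subExp
    split_ifs <;> omega
  rw [Finset.sum_congr rfl hterm, Finset.sum_const, smul_eq_mul, Finset.filter_gt_eq_Iio,
    Fin.card_Iio]

end Sums

section NondegSeq

theorem two_mul_choose_two_add (m : ℕ) : 2 * m.choose 2 + m = m * m := by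
  induction m with
  | zero => rfl
  | succ m ih =>
    rw [Nat.choose_succ_succ', Nat.choose_one_right]
    linarith

theorem isMonicOfDegree_nondegSeq_X {Q : ℤ[X]} {e : ℕ} (he : 0 < e) (hQ : IsMonicOfDegree Q e)
    (m : ℕ) : IsMonicOfDegree (nondegSeq X Q m) (m + e * m.choose 2) := by
  have hX : IsMonicOfDegree (X - 1 : ℤ[X]) 1 := isMonicOfDegree_X_sub_one 1
  induction m using nondegSeq.induct with
  | case1 => simp [nondegSeq]
  | case2 => simpa [nondegSeq] using hX
  | case3 m ih_succ ih =>
    have hQ1 : IsMonicOfDegree (Q ^ (m + 1) - 1) (e * (m + 1)) :=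
      (hQ.pow (m + 1)).sub (by rw [natDegree_one]; positivity)
    have hlead := (hX.mul (hQ.pow (m + 1))).mul ih_succ
    have hlower := hQ1.mul (((isMonicOfDegree_X ℤ).mul (hQ.pow m)).mul ih)
    have hdeg :
        1 + e * (m + 1) + (m + 1 + e * (m + 1).choose 2) = m + 2 + e * (m + 2).choose 2 := by
      rw [Nat.choose_succ_succ' (m + 1), Nat.choose_one_right]
      ring
    rw [nondegSeq, ← hdeg]
    refine hlead.add_right ?_
    rw [hlower.natDegree_eq, Nat.choose_succ_succ', Nat.choose_one_right]
    linarith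

theorem nondegSeq_one_of_odd (Q : ℤ[X]) {m : ℕ} (hm : Odd m) : nondegSeq 1 Q m = 0 := by
  obtain ⟨j, rfl⟩ := hm
  induction j with
  | zero => simp [nondegSeq]
  | succ j ih =>
    rw [show 2 * (j + 1) + 1 = 2 * j + 1 + 2 by ring, nondegSeq, ih]
    ring

theorem isMonicOfDegree_nondegSeq_one {m : ℕ} (hm : Even m) :
    IsMonicOfDegree (nondegSeq 1 (X : ℤ[X]) m) (m.choose 2) := by
  obtain ⟨j, rfl⟩ := hm.two_dvd
  induction j with
  | zero => simp [nondegSeq]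
  | succ j ih =>
    have hX : IsMonicOfDegree (X ^ (2 * j + 1) - 1 : ℤ[X]) (2 * j + 1) :=
      (isMonicOfDegree_X_pow ℤ _).sub (by rw [natDegree_one]; positivity)
    rw [show 2 * (j + 1) = 2 * j + 2 by ring, nondegSeq, sub_self, zero_mul, zero_mul, zero_add,
      one_mul, Nat.choose_succ_succ', Nat.choose_one_right, Nat.choose_succ_succ',
      Nat.choose_one_right]
    exact hX.mul ((isMonicOfDegree_X_pow ℤ (2 * j)).mul (ih (even_two_mul j)))

theorem isMonicOfDegree_prod {R ι : Type*} [CommSemiring R] [Nontrivial R] (s : Finset ι)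
    {p : ι → R[X]} {n : ι → ℕ} (h : ∀ i ∈ s, IsMonicOfDegree (p i) (n i)) :
    IsMonicOfDegree (∏ i ∈ s, p i) (∑ i ∈ s, n i) := by
  classical
  induction s using Finset.induction_on with
  | empty => exact ⟨natDegree_one, monic_one⟩
  | insert a s ha ih =>
    rw [Finset.prod_insert ha, Finset.sum_insert ha]
    exact (h a (Finset.mem_insert_self a s)).mul
      (ih fun i hi => h i (Finset.mem_insert_of_mem hi))

end NondegSeq

namespace IntPartition

variable (lam : IntPartition)

/-- The number of indices of the parts equal to `a`. -/
def mult (a : ℕ) : ℕ := Fintype.card {i // lam.part i = a}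

/-- The polynomial counting the forms on the primary component of `t - 1` or `t + 1`. -/
noncomputable def linearPoly : ℤ[X] :=
  X ^ (∑ i, ∑ j with j < i, Uniformized.subExp lam.part i j) * (∏ i, X ^ (lam.part i / 2)) *
    ∏ a ∈ Finset.univ.image lam.part, nondegSeq (if Odd a then X else 1) X (lam.mult a)

/-- The polynomial in `q ^ d` counting the forms on the primary component of a self-dual `f` of
degree `2 d`. -/
noncomputable def selfDualPoly : ℤ[X] :=
  (X ^ 2) ^ (∑ i, ∑ j with j < i, Uniformized.subExp lam.part i j) *
    (∏ i, X ^ (lam.part i - 1)) *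
    ∏ a ∈ Finset.univ.image lam.part, nondegSeq X (X ^ 2) (lam.mult a)

/-- The polynomial in `q ^ d` counting the forms on the primary components of a pair `{f, f*}` of
polynomials of degree `d`. -/
noncomputable def pairPoly : ℤ[X] :=
  X ^ (∑ i, ∑ j, Uniformized.subExp lam.part i j) * ∏ a ∈ Finset.univ.image lam.part,
    ∏ i : Fin (lam.mult a), (X ^ lam.mult a - X ^ (i : ℕ))

theorem antitone_part : Antitone lam.part := fun i j hij => by
  have h : lam.sortedParts.Pairwise fun a b => b ≤ a := Multiset.pairwise_sort _ _
  rcases hij.eq_or_lt with rfl | hij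
  · exact le_rfl
  · exact List.pairwise_iff_get.1 h i j hij

theorem weight_eq : lam.weight = ∑ i, lam.part i := (lam.sum_part fun d => d).symm

theorem lengthOdd_eq : lam.lengthOdd = ∑ i, if Odd (lam.part i) then 1 else 0 := by
  rw [lam.sum_part fun d => if Odd d then 1 else 0, lengthOdd]
  induction lam using Multiset.induction with
  | empty => rfl
  | cons a s ih =>
    rw [Multiset.countP_cons, Multiset.map_cons, Multiset.sum_cons, ih, add_comm]

theorem sum_subExp_part : (∑ i, ∑ j with j < i, Uniformized.subExp lam.part i j) +
    (∑ i, ∑ j with j < i, if lam.part i = lam.part j then 1 else 0) = lam.nStat :=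
  sum_subExp_add lam.part_pos lam.antitone_part

theorem sum_mult_sq : ∑ a ∈ Finset.univ.image lam.part, lam.mult a * lam.mult a =
    2 * (∑ i, ∑ j with j < i, if lam.part i = lam.part j then 1 else 0) + lam.length :=
  (sum_image_card_sq lam.part).trans (by rw [Fintype.card_fin])

theorem sum_part_sub_one : ∑ i, (lam.part i - 1) + lam.length = lam.weight := by
  have hlength : lam.length = ∑ _i : Fin lam.length, 1 := by simp
  conv_lhs => rhs; rw [hlength]
  rw [weight_eq, ← Finset.sum_add_distrib]
  exact Finset.sum_congr rfl fun i _ => Nat.sub_add_cancel (lam.part_pos i)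

theorem two_mul_sum_part_div_two : 2 * (∑ i, lam.part i / 2) + lam.lengthOdd = lam.weight := by
  rw [lengthOdd_eq, weight_eq, Finset.mul_sum, ← Finset.sum_add_distrib]
  refine Finset.sum_congr rfl fun i _ => ?_
  split_ifs with ho
  · exact Nat.two_mul_div_two_add_one_of_odd ho
  · exact Nat.two_mul_div_two_of_even (Nat.not_odd_iff_even.1 ho)

theorem two_mul_sum_mult_choose_two :
    2 * (∑ a ∈ Finset.univ.image lam.part,
        ((if Odd a then lam.mult a else 0) + (lam.mult a).choose 2)) + lam.length =
      2 * lam.lengthOdd + ∑ a ∈ Finset.univ.image lam.part, lam.mult a * lam.mult a := by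
  have hlength : ∑ a ∈ Finset.univ.image lam.part, lam.mult a = lam.length := by
    simpa [mult] using sum_image_card_mul lam.part fun _ => (1 : ℕ)
  have hodd : ∑ a ∈ Finset.univ.image lam.part, (if Odd a then lam.mult a else 0) =
      lam.lengthOdd := by
    simpa [mult, lengthOdd_eq] using
      sum_image_card_mul lam.part fun a => if Odd a then (1 : ℕ) else 0
  simp only [← two_mul_choose_two_add]
  rw [Finset.sum_add_distrib, Finset.sum_add_distrib, hodd, hlength, ← Finset.mul_sum]
  ring

theorem isMonicOfDegree_selfDualPoly :
    IsMonicOfDegree lam.selfDualPoly (2 * lam.nStat + lam.weight) := by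
  have h := ((((isMonicOfDegree_X_pow ℤ 2).pow
    (∑ i, ∑ j with j < i, Uniformized.subExp lam.part i j)).mul
    (isMonicOfDegree_prod Finset.univ fun i _ => isMonicOfDegree_X_pow ℤ (lam.part i - 1))).mul
    (isMonicOfDegree_prod (Finset.univ.image lam.part) fun a _ =>
      isMonicOfDegree_nondegSeq_X two_pos (isMonicOfDegree_X_pow ℤ 2) (lam.mult a)))
  refine ⟨h.natDegree_eq.trans ?_, h.monic⟩
  simp only [add_comm (lam.mult _), two_mul_choose_two_add]
  have := lam.sum_subExp_part
  have := lam.sum_mult_sq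
  have := lam.sum_part_sub_one
  omega

theorem isMonicOfDegree_pairPoly :
    IsMonicOfDegree lam.pairPoly (2 * lam.nStat + lam.weight) := by
  have h := (isMonicOfDegree_X_pow ℤ (∑ i, ∑ j, Uniformized.subExp lam.part i j)).mul
    (isMonicOfDegree_prod (Finset.univ.image lam.part) fun a _ =>
      isMonicOfDegree_prod (Finset.univ : Finset (Fin (lam.mult a))) fun i _ =>
        (isMonicOfDegree_X_pow ℤ (lam.mult a)).sub (q := X ^ (i : ℕ))
          (by rw [natDegree_X_pow]; exact i.2))
  refine ⟨h.natDegree_eq.trans ?_, h.monic⟩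
  simp only [Finset.sum_const, Finset.card_univ, Fintype.card_fin, smul_eq_mul]
  have := lam.sum_subExp_part
  have := lam.sum_mult_sq
  have := lam.sum_part_sub_one
  have := sum_subExp lam.part
  omega

theorem even_mult (h : ∀ d : ℕ+, Even (d : ℕ) → Even (lam.count d)) {a : ℕ}
    (ha : a ∈ Finset.univ.image lam.part) (hae : ¬ Odd a) : Even (lam.mult a) := by
  obtain ⟨i, -, rfl⟩ := Finset.mem_image.1 ha
  have hcount : lam.mult (lam.part i) = lam.count ⟨lam.part i, lam.part_pos i⟩ :=
    lam.card_part_eq _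
  rw [hcount]
  exact h ⟨lam.part i, lam.part_pos i⟩ (Nat.not_odd_iff_even.1 hae)

theorem isMonicOfDegree_linearPoly (h : ∀ d : ℕ+, Even (d : ℕ) → Even (lam.count d)) :
    IsMonicOfDegree lam.linearPoly (lam.nStat + ∑ i, lam.part i / 2 + lam.lengthOdd) := by
  have hpoly := (((isMonicOfDegree_X_pow ℤ
    (∑ i, ∑ j with j < i, Uniformized.subExp lam.part i j)).mul
    (isMonicOfDegree_prod Finset.univ fun i _ => isMonicOfDegree_X_pow ℤ (lam.part i / 2))).mul
    (isMonicOfDegree_prod (Finset.univ.image lam.part)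
      (p := fun a => nondegSeq (if Odd a then X else 1) X (lam.mult a))
      (n := fun a => (if Odd a then lam.mult a else 0) + (lam.mult a).choose 2) fun a ha => by
        split_ifs with hao
        · simpa using isMonicOfDegree_nondegSeq_X one_pos (isMonicOfDegree_X ℤ) (lam.mult a)
        · simpa using isMonicOfDegree_nondegSeq_one (lam.even_mult h ha hao)))
  refine ⟨hpoly.natDegree_eq.trans ?_, hpoly.monic⟩
  have := lam.sum_subExp_part
  have := lam.sum_mult_sq
  have := lam.two_mul_sum_mult_choose_two
  omega

theorem linearPoly_eq_zero {d : ℕ+} (hd : Even (d : ℕ)) (hcount : ¬ Even (lam.count d)) :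
    lam.linearPoly = 0 := by
  have hmult : lam.mult d = lam.count d := lam.card_part_eq d
  have hmem : (d : ℕ) ∈ Finset.univ.image lam.part := by
    by_contra hne
    refine hcount ?_
    rw [← hmult, mult, Fintype.card_eq_zero_iff.2
      ⟨fun i => hne (Finset.mem_image.2 ⟨i.1, Finset.mem_univ _, i.2⟩)⟩]
    exact Even.zero
  rw [linearPoly, Finset.prod_eq_zero hmem, mul_zero]
  rw [if_neg (Nat.not_odd_iff_even.2 hd), hmult]
  exact nondegSeq_one_of_odd _ (Nat.not_even_iff_odd.1 hcount)

theorem linearPoly_zero : linearPoly 0 = 1 := by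
  have hlength : length 0 = 0 := by simp [length, sortedParts]
  have : IsEmpty (Fin (length 0)) := by
    rw [hlength]
    infer_instance
  simp [linearPoly]

end IntPartition

section Evaluation

theorem eval_nondegSeq (x : ℤ) (s Q : ℤ[X]) (m : ℕ) :
    (nondegSeq s Q m).eval x = nondegSeq (s.eval x) (Q.eval x) m :=
  map_nondegSeq (evalRingHom x) s Q m

variable {K : Type*} [Field K] [Finite K] (f : Phi K) (lam : IntPartition)

theorem invFormCount_primaryEnd_linear (h2 : (2 : K) ≠ 0) (hf : f.star = f) (hdeg : f.deg = 1) :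
    (invFormCount (primaryEnd f lam) : ℤ) = lam.linearPoly.eval (Nat.card K : ℤ) := by
  rw [Phi.invFormCount_mulRoot_linear f h2 hf hdeg lam.part_pos, IntPartition.linearPoly]
  simp only [eval_mul, eval_pow, eval_X, eval_prod, eval_nondegSeq,
    apply_ite (eval (Nat.card K : ℤ)), eval_one]
  rfl

theorem invFormCount_primaryEnd_selfDual (h2 : (2 : K) ≠ 0) (hf : f.star = f) {d : ℕ}
    (hd : f.deg = 2 * d) : (invFormCount (primaryEnd f lam) : ℤ) =
      (lam.selfDualPoly.comp (X ^ d)).eval (Nat.card K : ℤ) := by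
  rw [Phi.invFormCount_mulRoot_selfDual f h2 hf hd lam.part_pos, IntPartition.selfDualPoly]
  simp only [eval_comp, eval_mul, eval_pow, eval_X, eval_prod, eval_nondegSeq]
  rfl

theorem invPairingCount_primaryEnd :
    (invPairingCount (primaryEnd f lam) (primaryEnd f.star lam) : ℤ) =
      (lam.pairPoly.comp (X ^ f.deg)).eval (Nat.card K : ℤ) := by
  have hcast (m : ℕ) (i : Fin m) : (((Nat.card K ^ f.deg) ^ m - (Nat.card K ^ f.deg) ^ (i : ℕ) :
      ℕ) : ℤ) = ((Nat.card K : ℤ) ^ f.deg) ^ m - ((Nat.card K : ℤ) ^ f.deg) ^ (i : ℕ) := by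
    rw [Nat.cast_sub (Nat.pow_le_pow_right (pow_pos Nat.card_pos _) i.2.le)]
    push_cast
    rfl
  rw [Phi.invPairingCount_mulRoot f lam.part_pos, IntPartition.pairPoly]
  simp only [eval_comp, eval_mul, eval_sub, eval_pow, eval_X, eval_prod, Nat.cast_mul,
    Nat.cast_prod, hcast, Nat.cast_pow]
  rfl

end Evaluation

/-! ### The polynomial of a symmetric type -/

namespace SymType

/-- The multiplicity of `d` in `η_s(lam)` for `b = (lam, d)`, extended by `0` to the pairs `b` in
which `lam` is empty or `d = 0`. -/
def selfDualMult (η : SymType) (b : IntPartition × ℕ) : ℕ :=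
  if h : b.1 ≠ 0 ∧ 0 < b.2 then η.selfDual ⟨b.1, h.1⟩ ⟨b.2, h.2⟩ else 0

/-- The multiplicity of `d` in `η_p(lam)` for `b = (lam, d)`, extended by `0` to the pairs `b` in
which `lam` is empty or `d = 0`. -/
def pairMult (η : SymType) (b : IntPartition × ℕ) : ℕ :=
  if h : b.1 ≠ 0 ∧ 0 < b.2 then η.pairs ⟨b.1, h.1⟩ ⟨b.2, h.2⟩ else 0

/-- The polynomial counting the nondegenerate symmetric forms preserved by a matrix of symmetric
type `η`. -/
noncomputable def formPoly (η : SymType) : ℤ[X] :=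
  η.plus.linearPoly * η.minus.linearPoly *
    (∏ᶠ b : IntPartition × ℕ, (b.1.selfDualPoly.comp (X ^ b.2)) ^ η.selfDualMult b) *
    ∏ᶠ b : IntPartition × ℕ, (b.1.pairPoly.comp (X ^ b.2)) ^ η.pairMult b

end SymType

theorem finprod_pow_eq_prod {ι κ M : Type*} [CommMonoid M] [DecidableEq κ] (S : Finset ι)
    (key : ι → κ) (g : κ → M) (c : κ → ℕ)
    (hc : ∀ b, c b = (S.filter fun a => key a = b).card) :
    ∏ᶠ b, g b ^ c b = ∏ a ∈ S, g (key a) := by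
  rw [Finset.prod_comp, finprod_eq_prod_of_mulSupport_subset (s := S.image key)]
  · exact Finset.prod_congr rfl fun b _ => by rw [hc]
  · intro b hb
    by_contra hne
    refine hb ?_
    have hempty : (S.filter fun a => key a = b) = ∅ := by
      rw [Finset.filter_eq_empty_iff]
      exact fun a ha h => hne (Finset.mem_coe.2 (Finset.mem_image.2 ⟨a, ha, h⟩))
    change g b ^ c b = 1
    rw [hc, hempty, Finset.card_empty, pow_zero]

namespace Phi

variable {K : Type*} [Field K]

theorem orbit_star (f : Phi K) : f.star.orbit = f.orbit := orbit_eq_iff.2 (Or.inr rfl)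

/-- A representative of an orbit of the duality; junk on the other unordered pairs. -/
noncomputable def rep (ω : Sym2 (Phi K)) : Phi K := (Quot.out ω).1

theorem rep_orbit (f : Phi K) : rep f.orbit = f ∨ rep f.orbit = f.star :=
  Sym2.mem_iff.1 (Sym2.out_fst_mem f.orbit)

theorem rep_orbit_of_selfDual {f : Phi K} (hf : f.star = f) : rep f.orbit = f :=
  f.rep_orbit.elim id fun h => h.trans hf

theorem orbit_rep_orbit (f : Phi K) : (rep f.orbit).orbit = f.orbit := by
  rcases f.rep_orbit with h | h
  · rw [h]
  · rw [h, orbit_star]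

theorem star_linear {a : Kˣ} (ha : a⁻¹ = a) : (linear a).star = linear a := by
  have ha0 : (a : K) ≠ 0 := a.ne_zero
  have hinv : (a : K)⁻¹ = a := by rw [← Units.val_inv_eq_inv_val, ha]
  have hreverse : (X - C (a : K)).reverse = 1 - C (a : K) * X := by
    rw [reverse, natDegree_X_sub_C, reflect_sub, reflect_one_X, reflect_C, pow_one]
  refine Subtype.ext ?_
  change C ((X - C (a : K)).coeff 0)⁻¹ * (X - C (a : K)).reverse = X - C (a : K)
  rw [hreverse, coeff_sub, coeff_X_zero, coeff_C_zero, zero_sub, mul_sub, mul_one, ← mul_assoc,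
    ← C_mul, inv_neg, neg_mul, inv_mul_cancel₀ ha0, hinv, C_neg, C_neg, C_1]
  ring

theorem deg_linear (a : Kˣ) : (linear a).deg = 1 := natDegree_X_sub_C _

theorem eq_linear_of_selfDual {f : Phi K} (hf : f.star = f) (hdeg : f.deg = 1) :
    f = linear 1 ∨ f = linear (-1) := by
  have hX : f.1 = X + C (f.1.coeff 0) := f.2.1.eq_X_add_C hdeg
  have hstar : C (f.1.coeff 0)⁻¹ * f.1.reverse = f.1 := congrArg Subtype.val hf
  have hinv : (f.1.coeff 0)⁻¹ = f.1.coeff 0 := by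
    simpa [f.2.1.leadingCoeff] using congrArg (fun p => coeff p 0) hstar
  have hsq : f.1.coeff 0 * f.1.coeff 0 = 1 := by
    nth_rw 1 [← hinv]
    exact inv_mul_cancel₀ f.2.2.2
  rcases mul_self_eq_one_iff.1 hsq with h | h
  · refine Or.inr (Subtype.ext ?_)
    rw [hX, h]
    simp [linear]
  · refine Or.inl (Subtype.ext ?_)
    rw [hX, h]
    simp [linear, sub_eq_add_neg]

theorem linear_one_ne (h2 : (2 : K) ≠ 0) : linear (1 : Kˣ) ≠ linear (-1) := by
  intro h
  have hcoeff := congrArg (fun f : Phi K => f.1.coeff 0) h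
  simp only [linear, coeff_sub, coeff_X_zero, coeff_C_zero, Units.val_one, Units.val_neg]
    at hcoeff
  refine h2 ?_
  linear_combination -hcoeff

end Phi

section Assembly

variable {K : Type*} [Field K] (μ : Phi K →₀ IntPartition)

open Classical in
/-- The orbits of the duality that meet the support of `μ`. -/
noncomputable def orbits : Finset (Sym2 (Phi K)) := μ.support.image Phi.orbit

open Classical in
/-- The polynomial counting the forms on the components of the orbit of `f`. -/
noncomputable def orbitPoly (f : Phi K) : ℤ[X] :=
  if f.star = f then
    if f.deg = 1 then (μ f).linearPoly else (μ f).selfDualPoly.comp (X ^ (f.deg / 2))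
  else (μ f).pairPoly.comp (X ^ f.deg)

variable {μ}

theorem mem_orbits {ω : Sym2 (Phi K)} : ω ∈ orbits μ ↔ ∃ f ∈ μ.support, f.orbit = ω := by
  classical
  rw [orbits]
  exact Finset.mem_image

theorem IsSymmetricMap.star_mem_support (hμ : IsSymmetricMap μ) {f : Phi K} :
    f.star ∈ μ.support ↔ f ∈ μ.support := by
  rw [Finsupp.mem_support_iff, Finsupp.mem_support_iff, ← hμ f]

theorem IsSymmetricMap.rep_orbit (hμ : IsSymmetricMap μ) (f : Phi K) :
    μ (Phi.rep f.orbit) = μ f ∧ (Phi.rep f.orbit).deg = f.deg ∧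
      ((Phi.rep f.orbit).star = Phi.rep f.orbit ↔ f.star = f) := by
  rcases f.rep_orbit with h | h
  · rw [h]
    exact ⟨rfl, rfl, Iff.rfl⟩
  · rw [h, Phi.star_deg, Phi.star_star]
    exact ⟨(hμ f).symm, rfl, eq_comm⟩

theorem IsSymmetricMap.rep_spec (hμ : IsSymmetricMap μ) {ω : Sym2 (Phi K)} (hω : ω ∈ orbits μ) :
    Phi.rep ω ∈ μ.support ∧ (Phi.rep ω).orbit = ω := by
  obtain ⟨f, hf, rfl⟩ := mem_orbits.1 hω
  refine ⟨?_, f.orbit_rep_orbit⟩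
  rw [Finsupp.mem_support_iff, (hμ.rep_orbit f).1]
  exact Finsupp.mem_support_iff.1 hf

theorem invFormCount_supportEnd_eq_eval [Finite K] (h2 : (2 : K) ≠ 0) (hμ : IsSymmetricMap μ) :
    (invFormCount (supportEnd μ) : ℤ) =
      (∏ ω ∈ orbits μ, orbitPoly μ (Phi.rep ω)).eval (Nat.card K : ℤ) := by
  classical
  have himg : Finset.univ.image (fun f : μ.support => f.1.orbit) = orbits μ := by
    ext ω
    rw [mem_orbits, Finset.mem_image]
    exact ⟨fun ⟨f, _, h⟩ => ⟨f.1, f.2, h⟩, fun ⟨f, hf, h⟩ => ⟨⟨f, hf⟩, Finset.mem_univ _, h⟩⟩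
  rw [invFormCount_supportEnd, himg, eval_prod, Nat.cast_prod]
  refine Finset.prod_congr rfl fun ω hω => ?_
  obtain ⟨hmem, horbit⟩ := hμ.rep_spec hω
  generalize Phi.rep ω = r at hmem horbit
  subst horbit
  rw [orbitPoly]
  split_ifs with hs hd
  · rw [invFormCount_orbit_selfDual μ hs hmem, invFormCount_primaryEnd_linear r _ h2 hs hd]
  · obtain ⟨d, hd'⟩ := r.even_deg_of_selfDual h2 hs hd
    rw [invFormCount_orbit_selfDual μ hs hmem, invFormCount_primaryEnd_selfDual r _ h2 hs hd',
      hd', Nat.mul_div_cancel_left _ two_pos]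
  · rw [invFormCount_orbit_pair μ hμ hs hmem, invPairingCount_primaryEnd]

theorem prod_orbits_ite_linear (hμ : IsSymmetricMap μ) {a : Kˣ} (ha : a⁻¹ = a)
    [DecidableEq (Phi K)] :
    ∏ ω ∈ orbits μ, (if Phi.rep ω = Phi.linear a then (μ (Phi.linear a)).linearPoly else 1) =
      (μ (Phi.linear a)).linearPoly := by
  classical
  have hrep := Phi.rep_orbit_of_selfDual (Phi.star_linear ha)
  have hcond : ∀ ω ∈ orbits μ, (if Phi.rep ω = Phi.linear a then (μ (Phi.linear a)).linearPoly
      else 1) = if ω = (Phi.linear a).orbit then (μ (Phi.linear a)).linearPoly else 1 := by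
    intro ω hω
    refine if_congr ⟨fun h => ?_, fun h => ?_⟩ rfl rfl
    · rw [← (hμ.rep_spec hω).2, h]
    · rw [h, hrep]
  rw [Finset.prod_congr rfl hcond, Finset.prod_ite_eq']
  split_ifs with h
  · rfl
  · by_cases h0 : μ (Phi.linear a) = 0
    · rw [h0, IntPartition.linearPoly_zero]
    · exact absurd (mem_orbits.2 ⟨_, Finsupp.mem_support_iff.2 h0, rfl⟩) h

theorem selfDualMult_symType [Finite K] (h2 : (2 : K) ≠ 0) (hμ : IsSymmetricMap μ)
    [DecidableEq (Phi K)] [DecidableEq (IntPartition × ℕ)] (b : IntPartition × ℕ) :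
    (symType μ).selfDualMult b = (((orbits μ).filter fun ω => (Phi.rep ω).star = Phi.rep ω ∧
      (Phi.rep ω).deg ≠ 1).filter fun ω => (μ (Phi.rep ω), (Phi.rep ω).deg / 2) = b).card := by
  classical
  rw [SymType.selfDualMult]
  split_ifs with hb
  · change Set.ncard _ = _
    rw [← Set.ncard_coe_finset]
    refine Set.ncard_congr (fun f _ => f.orbit) ?_ ?_ ?_
    · rintro f ⟨hs, hd, hlam⟩
      rw [Finset.mem_coe, Finset.mem_filter, Finset.mem_filter, Phi.rep_orbit_of_selfDual hs]
      replace hd : f.deg = 2 * b.2 := hd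
      replace hlam : μ f = b.1 := hlam
      refine ⟨⟨mem_orbits.2 ⟨f, ?_, rfl⟩, hs, by omega⟩, ?_⟩
      · rw [Finsupp.mem_support_iff, hlam]
        exact hb.1
      · rw [hlam, hd, Nat.mul_div_cancel_left _ two_pos]
    · rintro f g ⟨hs, -⟩ ⟨hs', -⟩ h
      rw [← Phi.rep_orbit_of_selfDual hs, h, Phi.rep_orbit_of_selfDual hs']
    · intro ω hω
      rw [Finset.mem_coe, Finset.mem_filter, Finset.mem_filter] at hω
      obtain ⟨⟨horbit, hs, hd⟩, hkey⟩ := hω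
      refine ⟨Phi.rep ω, ⟨hs, ?_, congrArg Prod.fst hkey⟩, (hμ.rep_spec horbit).2⟩
      obtain ⟨d, hd'⟩ := (Phi.rep ω).even_deg_of_selfDual h2 hs hd
      have hhalf : (Phi.rep ω).deg / 2 = b.2 := congrArg Prod.snd hkey
      change (Phi.rep ω).deg = 2 * b.2
      omega
  · refine (Finset.card_eq_zero.2 (Finset.filter_eq_empty_iff.2 fun ω hω h => hb ?_)).symm
    rw [Finset.mem_filter] at hω
    obtain ⟨horbit, -, hd⟩ := hω
    rw [← h]
    refine ⟨Finsupp.mem_support_iff.1 (hμ.rep_spec horbit).1, ?_⟩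
    have hpos := (Phi.rep ω).deg_pos
    change 0 < (Phi.rep ω).deg / 2
    omega

theorem pairMult_symType (hμ : IsSymmetricMap μ)
    [DecidableEq (Phi K)] [DecidableEq (IntPartition × ℕ)] (b : IntPartition × ℕ) :
    (symType μ).pairMult b = (((orbits μ).filter fun ω => (Phi.rep ω).star ≠ Phi.rep ω).filter
      fun ω => (μ (Phi.rep ω), (Phi.rep ω).deg) = b).card := by
  classical
  rw [SymType.pairMult]
  split_ifs with hb
  · change Set.ncard _ = _
    rw [← Set.ncard_coe_finset]
    congr 1
    ext ω
    rw [Finset.mem_coe, Finset.mem_filter, Finset.mem_filter]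
    constructor
    · rintro ⟨f, hω, hs, hd, hlam⟩
      obtain rfl : ω = f.orbit := hω
      replace hd : f.deg = b.2 := hd
      replace hlam : μ f = b.1 := hlam
      obtain ⟨hrep, hdeg, hstar⟩ := hμ.rep_orbit f
      refine ⟨⟨mem_orbits.2 ⟨f, ?_, rfl⟩, fun h => hs (hstar.1 h)⟩, ?_⟩
      · rw [Finsupp.mem_support_iff, hlam]
        exact hb.1
      · rw [hrep, hdeg, hd, hlam]
    · rintro ⟨⟨horbit, hs⟩, hkey⟩
      exact ⟨Phi.rep ω, (hμ.rep_spec horbit).2.symm, hs, congrArg Prod.snd hkey,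
        congrArg Prod.fst hkey⟩
  · refine (Finset.card_eq_zero.2 (Finset.filter_eq_empty_iff.2 fun ω hω h => hb ?_)).symm
    rw [Finset.mem_filter] at hω
    rw [← h]
    exact ⟨Finsupp.mem_support_iff.1 (hμ.rep_spec hω.1).1, (Phi.rep ω).deg_pos⟩

theorem formPoly_symType [Finite K] (h2 : (2 : K) ≠ 0) (hμ : IsSymmetricMap μ) :
    (symType μ).formPoly = ∏ ω ∈ orbits μ, orbitPoly μ (Phi.rep ω) := by
  classical
  rw [SymType.formPoly, finprod_pow_eq_prod _ _ _ _ (selfDualMult_symType h2 hμ),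
    finprod_pow_eq_prod _ _ _ _ (pairMult_symType hμ), Finset.prod_filter, Finset.prod_filter]
  change (μ (Phi.linear 1)).linearPoly * (μ (Phi.linear (-1))).linearPoly * _ * _ = _
  rw [← prod_orbits_ite_linear hμ (a := 1) inv_one, ← prod_orbits_ite_linear hμ (a := -1) (by simp),
    ← Finset.prod_mul_distrib, ← Finset.prod_mul_distrib, ← Finset.prod_mul_distrib]
  refine Finset.prod_congr rfl fun ω _ => ?_
  have hne := Phi.linear_one_ne h2
  generalize Phi.rep ω = r
  rw [orbitPoly]
  by_cases hs : r.star = r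
  · by_cases hd : r.deg = 1
    · rcases Phi.eq_linear_of_selfDual hs hd with rfl | rfl
      · simp [hs, hd, hne]
      · simp [hs, hd, hne.symm]
    · have hlin (a : Kˣ) : r ≠ Phi.linear a := fun h => hd (h ▸ Phi.deg_linear a)
      simp [hs, hd, hlin]
  · have hlin (a : Kˣ) (ha : a⁻¹ = a) : r ≠ Phi.linear a := fun h => hs (h ▸ Phi.star_linear ha)
    simp [hs, hlin 1 inv_one, hlin (-1) (by simp)]

/-- Twice the contribution of `f` to the degree. -/
noncomputable def degContribution [DecidableEq (Phi K)] (μ : Phi K →₀ IntPartition) (f : Phi K) :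
    ℕ :=
  f.deg * (2 * (μ f).nStat + (μ f).weight) +
    if f.star = f ∧ f.deg = 1 then (μ f).lengthOdd else 0

theorem filter_orbit_eq_singleton [DecidableEq (Sym2 (Phi K))] {f : Phi K} (hf : f.star = f)
    (hmem : f ∈ μ.support) : μ.support.filter (fun g => g.orbit = f.orbit) = {f} := by
  ext g
  rw [Finset.mem_filter, Finset.mem_singleton, Phi.orbit_eq_iff, hf, or_self]
  exact ⟨fun h => h.2, fun h => ⟨h ▸ hmem, h⟩⟩

theorem IsSymmetricMap.filter_orbit_eq_pair [DecidableEq (Phi K)] [DecidableEq (Sym2 (Phi K))]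
    (hμ : IsSymmetricMap μ) {f : Phi K} (hmem : f ∈ μ.support) :
    μ.support.filter (fun g => g.orbit = f.orbit) = {f, f.star} := by
  ext g
  rw [Finset.mem_filter, Finset.mem_insert, Finset.mem_singleton, Phi.orbit_eq_iff]
  refine ⟨fun h => h.2, fun h => ⟨?_, h⟩⟩
  rcases h with rfl | rfl
  · exact hmem
  · exact hμ.star_mem_support.2 hmem

theorem EvenPartsPaired.even_count (hpair : EvenPartsPaired μ) {f : Phi K} (hf : f.star = f)
    (hdeg : f.deg = 1) (d : ℕ+) (hd : Even (d : ℕ)) : Even ((μ f).count d) := by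
  rcases Phi.eq_linear_of_selfDual hf hdeg with rfl | rfl
  · exact (hpair d hd).1
  · exact (hpair d hd).2

theorem exists_isMonicOfDegree_orbitPoly [DecidableEq (Phi K)] [DecidableEq (Sym2 (Phi K))]
    [Finite K] (h2 : (2 : K) ≠ 0) (hμ : IsSymmetricMap μ)
    (hpair : EvenPartsPaired μ) {ω : Sym2 (Phi K)} (hω : ω ∈ orbits μ) :
    ∃ D, IsMonicOfDegree (orbitPoly μ (Phi.rep ω)) D ∧
      2 * D = ∑ f ∈ μ.support with f.orbit = ω, degContribution μ f := by
  obtain ⟨hmem, horbit⟩ := hμ.rep_spec hω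
  generalize Phi.rep ω = r at hmem horbit
  subst horbit
  rw [orbitPoly]
  by_cases hs : r.star = r
  · rw [filter_orbit_eq_singleton hs hmem, Finset.sum_singleton, if_pos hs, degContribution]
    by_cases hd : r.deg = 1
    · rw [if_pos hd, if_pos ⟨hs, hd⟩, hd, one_mul]
      refine ⟨_, (μ r).isMonicOfDegree_linearPoly (hpair.even_count hs hd), ?_⟩
      have := (μ r).two_mul_sum_part_div_two
      omega
    · rw [if_neg hd, if_neg fun h => hd h.2, add_zero]
      obtain ⟨d, hd'⟩ := r.even_deg_of_selfDual h2 hs hd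
      have hpos := r.deg_pos
      refine ⟨_, (μ r).isMonicOfDegree_selfDualPoly.comp (n := r.deg / 2) (by omega)
        (isMonicOfDegree_X_pow ℤ _), ?_⟩
      rw [hd', Nat.mul_div_cancel_left _ two_pos]
      ring
  · rw [hμ.filter_orbit_eq_pair hmem, Finset.sum_pair (Ne.symm hs), if_neg hs, degContribution,
      degContribution, if_neg fun h => hs h.1, if_neg fun h => hs (h.1.symm.trans r.star_star),
      Phi.star_deg, ← hμ r]
    refine ⟨_, (μ r).isMonicOfDegree_pairPoly.comp r.deg_pos.ne' (isMonicOfDegree_X_pow ℤ _), ?_⟩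
    ring

theorem sum_lengthOdd [DecidableEq (Phi K)] (h2 : (2 : K) ≠ 0) :
    ∑ f ∈ μ.support, (if f.star = f ∧ f.deg = 1 then (μ f).lengthOdd else 0) =
      (μ (Phi.linear 1)).lengthOdd + (μ (Phi.linear (-1))).lengthOdd := by
  have hsingle (a : Kˣ) : ∑ f ∈ μ.support, (if f = Phi.linear a then (μ f).lengthOdd else 0) =
      (μ (Phi.linear a)).lengthOdd := by
    rw [Finset.sum_ite_eq']
    split_ifs with h
    · rfl
    · rw [Finsupp.notMem_support_iff.1 h]
      rfl
  rw [← hsingle 1, ← hsingle (-1), ← Finset.sum_add_distrib]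
  refine Finset.sum_congr rfl fun f _ => ?_
  have hne := Phi.linear_one_ne h2
  by_cases hf : f.star = f ∧ f.deg = 1
  · rcases Phi.eq_linear_of_selfDual hf.1 hf.2 with rfl | rfl
    · rw [if_pos hf, if_pos rfl, if_neg hne, add_zero]
    · rw [if_pos hf, if_pos rfl, if_neg hne.symm, zero_add]
  · have hlin (a : Kˣ) (ha : a⁻¹ = a) : f ≠ Phi.linear a := fun h =>
      hf (h ▸ ⟨Phi.star_linear ha, Phi.deg_linear a⟩)
    rw [if_neg hf, if_neg (hlin 1 inv_one), if_neg (hlin (-1) (by simp))]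

theorem sum_degContribution [DecidableEq (Phi K)] (h2 : (2 : K) ≠ 0) :
    ((∑ f ∈ μ.support, degContribution μ f : ℕ) : ℚ) = 2 * degFormula μ := by
  simp only [degContribution]
  rw [Finset.sum_add_distrib, sum_lengthOdd h2, degFormula, mul_add, Finset.mul_sum]
  push_cast
  rw [add_comm]
  congr 1
  · ring
  · exact Finset.sum_congr rfl fun f _ => by ring

theorem monic_formPoly_symType [Finite K] (h2 : (2 : K) ≠ 0) (hμ : IsSymmetricMap μ)
    (hpair : EvenPartsPaired μ) :
    (symType μ).formPoly.Monic ∧ ((symType μ).formPoly.natDegree : ℚ) = degFormula μ := by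
  classical
  choose! D hmonic hdeg using fun ω (hω : ω ∈ orbits μ) =>
    exists_isMonicOfDegree_orbitPoly h2 hμ hpair hω
  have h := isMonicOfDegree_prod (orbits μ) hmonic
  rw [← formPoly_symType h2 hμ] at h
  refine ⟨h.monic, ?_⟩
  have hsum : 2 * ∑ ω ∈ orbits μ, D ω = ∑ f ∈ μ.support, degContribution μ f := by
    rw [Finset.mul_sum, Finset.sum_congr rfl hdeg]
    exact Finset.sum_fiberwise_of_maps_to (fun f hf => mem_orbits.2 ⟨f, hf, rfl⟩) _
  have hformula := sum_degContribution (μ := μ) h2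
  rw [← hsum, ← h.natDegree_eq] at hformula
  push_cast at hformula
  linarith

theorem formPoly_symType_eq_zero (hpair : ¬ EvenPartsPaired μ) : (symType μ).formPoly = 0 := by
  have hzero : (symType μ).plus.linearPoly = 0 ∨ (symType μ).minus.linearPoly = 0 := by
    by_contra! hne
    refine hpair fun d hd => ⟨?_, ?_⟩
    · by_contra hcount
      exact hne.1 (IntPartition.linearPoly_eq_zero _ hd hcount)
    · by_contra hcount
      exact hne.2 (IntPartition.linearPoly_eq_zero _ hd hcount)
  rw [SymType.formPoly]
  rcases hzero with h | h <;> simp only [h, zero_mul, mul_zero]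

theorem two_ne_zero_of_odd_card [Fintype K] (h : Odd (Fintype.card K)) : (2 : K) ≠ 0 :=
  Ring.two_ne_zero fun hchar => absurd (FiniteField.even_card_of_char_two hchar) (by
    rw [Nat.odd_iff] at h
    omega)

end Assembly

theorem propositiont :
    ∃ P : SymType → ℤ[X],
      ∀ (K : Type*) [Field K] [Fintype K], Odd (Fintype.card K) →
      ∀ (n : ℕ) (μ : Phi K →₀ IntPartition) (A : GL (Fin n) K), A ∈ conjClass n μ →
        (¬ IsSymmetricMap μ → formCount A = 0) ∧
        (IsSymmetricMap μ →
          (formCount A : ℤ) = (P (symType μ)).eval (Fintype.card K : ℤ) ∧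
          (EvenPartsPaired μ →
            (P (symType μ)).Monic ∧ ((P (symType μ)).natDegree : ℚ) = degFormula μ) ∧
          (¬ EvenPartsPaired μ → P (symType μ) = 0)) := by
  refine ⟨SymType.formPoly, fun K _ _ hK n μ A hA => ?_⟩
  have htwo := two_ne_zero_of_odd_card hK
  rw [formCount_eq_supportEnd μ hA]
  refine ⟨invFormCount_eq_zero_of_not_symmetric μ, fun hμ => ⟨?_, monic_formPoly_symType htwo hμ,
    formPoly_symType_eq_zero⟩⟩
  rw [formPoly_symType htwo hμ, ← Nat.card_eq_fintype_card, invFormCount_supportEnd_eq_eval htwo hμ]
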